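/- \textbf{Trees.} A \emph{tree} is a finite connected and simply connected graph together with a set of boundary vertices, each of valence $1$, one of which is distinguished as the \emph{root} (output vertex). The other boundary vertices stand for the \emph{leaves}; the non-boundary vertices are the \emph{dots}; a dot of valence $1$ is a \emph{null-dot}. Vertices are ordered by $a\le b$ iff $b$ lies on the path from $a$ to the root. A tree is \emph{linear} if every dot has valence $2$. A \emph{subdivision} of $T$ is a tree $T'$ obtained by replacing each edge of $T$ by a linear tree; the new dots are called white, the dots of $T$ black. A \emph{kernel} in $T'$ is a set of dots spanning a non-empty connected full subgraph. \textbf{Constellations and zoom complexes.} A \emph{constellation} $T\to N$ between trees (underlying tree $T$, nesting $N$; the dots of $N$ are its spheres) is a subdivision $T'$ of $T$ with bijections $\sigma_\bullet:\mathrm{blackdots}(T')\cong\mathrm{leaves}(N)$ and $\sigma_\circ:\mathrm{whitedots}(T')\cong\mathrm{nulldots}(N)$ such that for each dot $x$ of $N$ the set of dots $t$ of $T'$ with $\sigma(t)\le x$ is a kernel. A \emph{zoom complex} of degree $n$ is a sequence of constellations $X_0,\dots,X_n$ in which the nesting of $X_i$ is the underlying tree of $X_{i+1}$. For $k\ge 0$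 let $\mathbf O^k$ be the set of isomorphism classes of zoom complexes of degree $k$ such that $X_0$ and (if $k\ge1$) $X_1$ have as underlying tree and as nesting a linear tree with one dot, and (if $k\ge 2$) the nesting of $X_2$ is a linear tree. The \emph{target} $\mathbf O^{k+1}\to\mathbf O^{k}$ omits $X_{k+1}$. \textbf{The Baez--Dolan construction.} Let $P$ be a polynomial monad, represented by $I\leftarrow E\to B\to I$ with $E\to B$ of finite fibres; $I$ is its set of types, $B$ its set of operations. A $P$-tree is a tree with edges decorated in $I$ and dots decorated in $B$, together with, for each dot decorated by $b$, a bijection of its input edges with $E_b$, compatibly with the decorations; $\mathrm{tr}(P)$ is the set of isomorphism classes of $P$-trees. Let $P^+$ be the polynomial monad $B\leftarrow \mathrm{tr}^\bullet(P)\to\mathrm{tr}(P)\xrightarrow{t}B$, where $\mathrm{tr}^\bullet(P)$ is the set of $P$-trees with a marked dot, the first map returns the operation at the marked dot, the second forgets the mark, and $t$ contracts a $P$-tree to an operation with the monad structure of $P$; its multiplication substitutes $P$-trees into the dots of a $P$-tree, and its unit sends an operation to the tree with one dot. Let $P^0$ be the identity monad on $\mathbf{Set}$, let $P^{k+1}=(P^k)^+$,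 and let $\mathbf Z^k$ be the set of types of $P^k$. So $\mathbf Z^{k+1}$ is the set of operations of $P^k$, with the target (output type) map $t:\mathbf Z^{k+1}\to\mathbf Z^k$, and $\mathbf Z^{k+2}=\mathrm{tr}(P^k)$. A $P^+$-tree $N$ determines a constellation: its underlying tree is that of the $P$-tree $M=t(N)$ obtained by substituting the decorating $P$-trees into each other as prescribed by $N$, its nesting is the underlying tree of $N$, and its spheres are the scars of the substitutions, so that the dots of $M$ correspond to the leaves of $N$, and the null-dots of $N$, being decorated by unit trees, mark positions on the edges of $M$ (the white dots). \textbf{Theorem.} There are bijections $\varphi_k:\mathbf O^k\to\mathbf Z^k$ $(k\ge 0)$ which commute with the target maps, $\varphi_k(\mathrm{target}\,X)=t(\varphi_{k+1}(X))$, and are natural in the following sense: for every zoom complex $X$ representing an element of $\mathbf O^{k}$, $k\ge2$, there is an isomorphism between the nesting of its top constellation $X_k$ and the underlying tree of the $P^{k-2}$-tree $\varphi_k(X)$, so that the spheres of $X_k$ correspond to the dots of this tree; and for $k\ge 3$ these isomorphisms can be chosen for $X$ and for all its iterated targets of degree $\ge 2$ in such a way that, in each degree $j$ with $3\le j\le k$,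 they identify $X_j$ with the constellation determined by the $(P^{j-3})^+$-tree $\varphi_j(X_0,\dots,X_j)$. -/

import Mathlib

/-! ## Polynomial functors and polynomial monads -/

namespace Opetopes

/-- A polynomial endofunctor `I ← E → B → I` of `Set/I`, with `E → B` of finite fibres, presented
by its fibres: `I` is the set of types, `Op i` the set of operations of output type `i` (so that
`B = Σ i, Op i`, with `t : B → I` the first projection), `Ar b` the fibre `E_b`, and `src` the
map `s : E → I`. Objects of `Set/I` are families `X : I → Type`. -/
structure Poly : Type 1 where
  I : Type
  Op : I → Type
  Ar : {i : I} → Op i → Type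
  src : {i : I} → {b : Op i} → Ar b → I
  fin : ∀ {i : I} (b : Op i), Finite (Ar b)

namespace Poly

/-- The value `∑_b ∏_{e ∈ E_b} X_{s(e)}` of the polynomial functor on `X`. -/
abbrev Obj (P : Poly) (X : P.I → Type) (i : P.I) : Type :=
  Σ b : P.Op i, ∀ e : P.Ar b, X (P.src e)

/-- The action of the polynomial functor on maps over `I`. -/
def map (P : Poly) {X Y : P.I → Type} (f : ∀ i, X i → Y i) {i : P.I} (z : P.Obj X i) :
    P.Obj Y i :=
  ⟨z.1, fun e => f _ (z.2 e)⟩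

end Poly

/-- A polynomial monad: a polynomial endofunctor `P` with natural transformations
`unit : Id ⇒ P` and `join : P ∘ P ⇒ P`, both cartesian (every naturality square is a pullback),
subject to the monad laws. -/
structure PolyMonad : Type 1 extends Poly where
  unit : ∀ {X : I → Type} {i : I}, X i → toPoly.Obj X i
  join : ∀ {X : I → Type} {i : I}, toPoly.Obj (toPoly.Obj X) i → toPoly.Obj X i
  unit_nat : ∀ {X Y : I → Type} (f : ∀ i, X i → Y i) {i : I} (x : X i),
    toPoly.map f (unit x) = unit (f i x)
  join_nat : ∀ {X Y : I → Type} (f : ∀ i, X i → Y i) {i : I} (z : toPoly.Obj (toPoly.Obj X) i),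
    toPoly.map f (join z) = join (toPoly.map (fun _ => toPoly.map f) z)
  unit_cart : ∀ {X Y : I → Type} (f : ∀ i, X i → Y i) {i : I} (y : Y i) (x : toPoly.Obj X i),
    toPoly.map f x = unit y → ∃! z : X i, f i z = y ∧ unit z = x
  join_cart : ∀ {X Y : I → Type} (f : ∀ i, X i → Y i) {i : I}
    (y : toPoly.Obj (toPoly.Obj Y) i) (x : toPoly.Obj X i),
    toPoly.map f x = join y →
      ∃! z : toPoly.Obj (toPoly.Obj X) i,
        toPoly.map (fun _ => toPoly.map f) z = y ∧ join z = x
  join_unit : ∀ {X : I → Type} {i : I} (z : toPoly.Obj X i), join (unit z) = z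
  join_map_unit : ∀ {X : I → Type} {i : I} (z : toPoly.Obj X i),
    join (toPoly.map (fun _ => unit) z) = z
  join_join : ∀ {X : I → Type} {i : I} (z : toPoly.Obj (toPoly.Obj (toPoly.Obj X)) i),
    join (join z) = join (toPoly.map (fun _ => join) z)

/-! ## `P`-trees -/

/-- `Tree P X i` is the set of (isomorphism classes of) `P`-trees with root edge of type `i` and
leaves decorated in `X`: the least fixpoint of `Y ↦ X + P(Y)`. The constructor `leaf` is the
unit tree; `node b f` is the tree with root dot decorated by the operation `b`, on the input
edges `e ∈ E_b` of which the trees `f e` are grafted. -/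
inductive Tree (P : Poly) (X : P.I → Type) : P.I → Type
  | leaf {i : P.I} (x : X i) : Tree P X i
  | node {i : P.I} (b : P.Op i) (f : ∀ e : P.Ar b, Tree P X (P.src e)) : Tree P X i

/-- `P`-trees with root edge of type `i`; thus `tr(P) = Σ i, Tr P i`. -/
abbrev Tr (P : Poly) (i : P.I) : Type := Tree P (fun _ => Unit) i

namespace Tree

variable {P : Poly} {X Y : P.I → Type}

/-- The dots of a `P`-tree. -/
inductive Nodes : {i : P.I} → Tree P X i → Type
  | here {i : P.I} {b : P.Op i} {f : ∀ e : P.Ar b, Tree P X (P.src e)} : Nodes (node b f)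
  | up {i : P.I} {b : P.Op i} {f : ∀ e : P.Ar b, Tree P X (P.src e)} (e : P.Ar b)
      (n : Nodes (f e)) : Nodes (node b f)

/-- The leaves of a `P`-tree. -/
inductive Leaves : {i : P.I} → Tree P X i → Type
  | here {i : P.I} {x : X i} : Leaves (leaf x)
  | up {i : P.I} {b : P.Op i} {f : ∀ e : P.Ar b, Tree P X (P.src e)} (e : P.Ar b)
      (l : Leaves (f e)) : Leaves (node b f)

/-- The operation decorating a dot (with its output type). -/
def deco : {i : P.I} → (T : Tree P X i) → T.Nodes → Σ j : P.I, P.Op j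
  | i, node b _, .here => ⟨i, b⟩
  | _, node _ f, .up e n => deco (f e) n

theorem finite_nodes {i : P.I} (T : Tree P X i) : Finite T.Nodes := by
  induction T with
  | leaf x => exact @Finite.of_subsingleton _ ⟨fun n => nomatch n⟩
  | node b f ih =>
    have := P.fin b
    refine Finite.of_surjective
      (fun o : Option (Σ e : P.Ar b, (f e).Nodes) => o.elim Nodes.here fun p => Nodes.up p.1 p.2) ?_
    rintro (_ | ⟨e, n⟩)
    · exact ⟨none, rfl⟩
    · exact ⟨some ⟨e, n⟩, rfl⟩

end Tree

/-! ### Trees whose dots carry an extra decoration -/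

/-- `P`-trees with leaves decorated in `X` in which each dot, say with operation `b`, is moreover
decorated by an element of `C b`. -/
inductive DTree (P : Poly) (C : (Σ i, P.Op i) → Type) (X : P.I → Type) : P.I → Type
  | leaf {i : P.I} (x : X i) : DTree P C X i
  | node {i : P.I} (b : P.Op i) (c : C ⟨i, b⟩) (f : ∀ e : P.Ar b, DTree P C X (P.src e)) :
      DTree P C X i

namespace DTree

variable {P : Poly} {C D : (Σ i, P.Op i) → Type} {X Y Z : P.I → Type}

/-- Change the decoration of the leaves. -/
def map (g : ∀ i, X i → Y i) : {i : P.I} → DTree P C X i → DTree P C Y i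
  | _, leaf x => leaf (g _ x)
  | _, node b c f => node b c fun e => map g (f e)

/-- Graft onto each leaf the tree that decorates it. -/
def graft : {i : P.I} → DTree P C (DTree P C X) i → DTree P C X i
  | _, leaf x => x
  | _, node b c f => node b c fun e => graft (f e)

/-- Change the extra decoration of the dots. -/
def mapDec (g : ∀ x, C x → D x) : {i : P.I} → DTree P C X i → DTree P D X i
  | _, leaf x => leaf x
  | _, node b c f => node b (g _ c) fun e => mapDec g (f e)

theorem map_map (g : ∀ i, X i → Y i) (h : ∀ i, Y i → Z i) {i : P.I}
    (T : DTree P C X i) : (T.map g).map h = T.map (fun i x => h i (g i x)) := by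
  induction T with
  | leaf x => rfl
  | node b c f ih => simp [map, ih]

theorem map_unit {i : P.I} (T : DTree P C (fun _ => Unit) i) (g : ∀ _ : P.I, Unit → Unit) :
    map g T = T := by
  induction T with
  | leaf x => rfl
  | node b c f ih => simp [map, ih]

theorem graft_map_leaf {i : P.I} (T : DTree P C X i) :
    (T.map fun _ x => (leaf x : DTree P C X _)).graft = T := by
  induction T with
  | leaf x => rfl
  | node b c f ih => simp [map, graft, ih]

theorem graft_nat (g : ∀ i, X i → Y i) {i : P.I} (T : DTree P C (DTree P C X) i) :
    T.graft.map g = (T.map fun _ => map g).graft := by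
  induction T with
  | leaf x => rfl
  | node b c f ih => simp [map, graft, ih]

theorem graft_graft {i : P.I} (T : DTree P C (DTree P C (DTree P C X)) i) :
    T.graft.graft = (T.map fun _ => graft).graft := by
  induction T with
  | leaf x => rfl
  | node b c f ih => simp [map, graft, ih]

theorem map_mapDec (g : ∀ x, C x → D x) (h : ∀ i, X i → Y i) {i : P.I} (T : DTree P C X i) :
    (T.mapDec g).map h = (T.map h).mapDec g := by
  induction T with
  | leaf x => rfl
  | node b c f ih => simp [map, mapDec, ih]

theorem graft_mapDec (g : ∀ x, C x → D x) {i : P.I} (T : DTree P C (DTree P C X) i) :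
    T.graft.mapDec g = ((T.map fun _ => mapDec g).mapDec g).graft := by
  induction T with
  | leaf x => rfl
  | node b c f ih => simp [map, mapDec, graft, ih]

theorem mapDec_id {i : P.I} (T : DTree P C X i) : (T.mapDec fun _ c => c) = T := by
  induction T with
  | leaf x => rfl
  | node b c f ih => simp [mapDec, ih]

theorem mapDec_mapDec {E : (Σ i, P.Op i) → Type} (g : ∀ x, C x → D x) (h : ∀ x, D x → E x)
    {i : P.I} (T : DTree P C X i) :
    (T.mapDec g).mapDec h = T.mapDec (fun x c => h x (g x c)) := by
  induction T with
  | leaf x => rfl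
  | node b c f ih => simp [mapDec, ih]

theorem graft_cart (g : ∀ x, C x → D x) {i : P.I} (w : DTree P D (DTree P D X) i) :
    ∀ z : DTree P C X i, z.mapDec g = w.graft →
    ∃! y : DTree P C (DTree P C X) i, (y.map fun _ => mapDec g).mapDec g = w ∧ y.graft = z := by
  induction w with
  | leaf x =>
    intro z hz
    refine ⟨leaf z, ⟨congrArg leaf hz, rfl⟩, ?_⟩
    rintro (y | ⟨b, c, f⟩) ⟨h1, h2⟩
    · exact congrArg leaf h2
    · cases h1
  | node b c f ih =>
    intro z hz
    cases z with
    | leaf x => cases hz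
    | node b' c' f' =>
      simp only [mapDec, graft, node.injEq] at hz
      obtain ⟨rfl, h1, h2⟩ := hz
      obtain rfl := eq_of_heq h1
      have h2 := fun e => congrFun (eq_of_heq h2) e
      choose y hy hu using fun e => ih e (f' e) (h2 e)
      refine ⟨node b' c' y, ⟨congrArg (node _ _) (funext fun e => (hy e).1),
        congrArg (node _ _) (funext fun e => (hy e).2)⟩, ?_⟩
      rintro (y' | ⟨b2, c2, k⟩) ⟨h3, h4⟩
      · cases h3
      · simp only [graft, node.injEq] at h4
        obtain ⟨rfl, h5, h6⟩ := h4
        obtain rfl := eq_of_heq h5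
        simp only [map, mapDec, node.injEq, heq_eq_eq, true_and] at h3 h6
        exact congrArg (node _ _) (funext fun e => hu e _ ⟨congrFun h3 e, congrFun h6 e⟩)

/-- A root dot with operation `b` and extra decoration `c`, and decorated trees on its inputs. -/
def glue {i : P.I} {b : P.Op i} (c : C ⟨i, b⟩)
    (w : ∀ e : P.Ar b, Σ T : Tree P X (P.src e), ∀ n : T.Nodes, C (T.deco n)) :
    Σ T : Tree P X i, ∀ n : T.Nodes, C (T.deco n) :=
  ⟨.node b fun e => (w e).1, fun n => match n with
    | .here => c
    | .up e n => (w e).2 n⟩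

/-- A decorated tree is a tree together with a decoration of its dots; `decorate` is the inverse. -/
def split : {i : P.I} → DTree P C X i → Σ T : Tree P X i, ∀ n : T.Nodes, C (T.deco n)
  | _, leaf x => ⟨.leaf x, fun n => nomatch n⟩
  | _, node _ c f => glue c fun e => split (f e)

/-- Put a decoration on the dots of a tree. -/
def decorate : {i : P.I} → (T : Tree P X i) → (∀ n : T.Nodes, C (T.deco n)) → DTree P C X i
  | _, .leaf x, _ => leaf x
  | _, .node b f, c => node b (c .here) fun e => decorate (f e) fun n => c (.up e n)

theorem decorate_split {i : P.I} (T : DTree P C X i) : decorate T.split.1 T.split.2 = T := by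
  induction T with
  | leaf x => rfl
  | node b c f ih => exact congrArg (node b c) (funext ih)

theorem split_decorate {i : P.I} (T : Tree P X i) (c : ∀ n : T.Nodes, C (T.deco n)) :
    split (decorate T c) = ⟨T, c⟩ := by
  induction T with
  | leaf x =>
    refine Sigma.ext rfl (heq_of_eq ?_)
    funext n; exact nomatch n
  | node b f ih =>
    refine (congrArg (glue (C := C) (c .here))
      (funext fun e => ih e fun n => c (.up e n))).trans ?_
    refine Sigma.ext rfl (heq_of_eq ?_)
    funext n; cases n <;> rfl

theorem split_mapDec (g : ∀ x, C x → D x) {i : P.I} (T : DTree P C X i) :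
    (T.mapDec g).split = ⟨T.split.1, fun n => g _ (T.split.2 n)⟩ := by
  induction T with
  | leaf x =>
    refine Sigma.ext rfl (heq_of_eq ?_)
    funext n; exact nomatch n
  | node b c f ih =>
    refine (congrArg (glue (C := D) (g _ c)) (funext fun e => ih e)).trans ?_
    refine Sigma.ext rfl (heq_of_eq ?_)
    funext n; cases n <;> rfl

end DTree

namespace PolyMonad

/-- Contraction of a tree to a single bouquet with the monad structure: all inner edges are
contracted, and a unit tree is sent to a unit operation. The decorations of the leaves are
carried along. -/
def contract (P : PolyMonad) {X : P.I → Type} : {i : P.I} → Tree P.toPoly X i → P.Obj X i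
  | _, .leaf x => P.unit x
  | _, .node b f => P.join ⟨b, fun e => P.contract (f e)⟩

/-- Contraction of a tree with extra decorations (which are forgotten). -/
def contractD (P : PolyMonad) {C : (Σ i, P.Op i) → Type} {X : P.I → Type} :
    {i : P.I} → DTree P.toPoly C X i → P.Obj X i
  | _, .leaf x => P.unit x
  | _, .node b _ f => P.join ⟨b, fun e => P.contractD (f e)⟩

variable {P : PolyMonad} {C D : (Σ i, P.Op i) → Type} {X Y : P.I → Type}

theorem contract_split {i : P.I} (T : DTree P.toPoly C X i) :
    P.contract T.split.1 = P.contractD T := by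
  induction T with
  | leaf x => rfl
  | node b c f ih =>
    exact congrArg (fun k => P.join ⟨b, k⟩) (funext ih)

theorem contractD_nat (h : ∀ i, X i → Y i) {i : P.I} (T : DTree P.toPoly C X i) :
    P.contractD (T.map h) = P.map h (P.contractD T) := by
  induction T with
  | leaf x => exact (P.unit_nat h x).symm
  | node b c f ih =>
    refine Eq.trans ?_ (P.join_nat h _).symm
    exact congrArg (fun k => P.join ⟨b, k⟩) (funext ih)

theorem contractD_mapDec (g : ∀ x, C x → D x) {i : P.I} (T : DTree P.toPoly C X i) :
    P.contractD (T.mapDec g) = P.contractD T := by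
  induction T with
  | leaf x => rfl
  | node b c f ih =>
    exact congrArg (fun k => P.join ⟨b, k⟩) (funext ih)

theorem contractD_graft {i : P.I} (T : DTree P.toPoly C (DTree P.toPoly C X) i) :
    P.contractD T.graft = P.join (P.map (fun _ => P.contractD) (P.contractD T)) := by
  induction T with
  | leaf x =>
    change P.contractD x = P.join (P.map _ (P.unit x))
    rw [P.unit_nat, P.join_unit]
  | node b c f ih =>
    change _ = P.join (P.map _ (P.join ⟨b, fun e => P.contractD (f e)⟩))
    rw [P.join_nat, P.join_join]
    exact congrArg (fun k => P.join ⟨b, k⟩) (funext ih)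

theorem contractD_cart (h : ∀ i, X i → Y i) {i : P.I} (w : DTree P.toPoly C Y i) :
    ∀ x : P.Obj X i, P.map h x = P.contractD w →
      ∃! z : DTree P.toPoly C X i, z.map h = w ∧ P.contractD z = x := by
  induction w with
  | leaf y =>
    intro x hx
    obtain ⟨z, ⟨h1, h2⟩, hu⟩ := P.unit_cart h y x hx
    refine ⟨.leaf z, ⟨congrArg DTree.leaf h1, h2⟩, ?_⟩
    rintro (z' | ⟨b, c, f⟩) ⟨h3, h4⟩
    · simp only [DTree.map, DTree.leaf.injEq] at h3
      exact congrArg DTree.leaf (hu z' ⟨h3, h4⟩)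
    · cases h3
  | node b c f ih =>
    intro x hx
    obtain ⟨⟨b', z⟩, ⟨h1, h2⟩, hu⟩ := P.join_cart h ⟨b, fun e => P.contractD (f e)⟩ x hx
    obtain ⟨h3, h4⟩ := Sigma.ext_iff.1 h1
    change b' = b at h3
    subst h3
    choose y hy hyu using fun e => ih e (z e) (congrFun (eq_of_heq h4) e)
    refine ⟨.node b' c y, ⟨congrArg (DTree.node _ _) (funext fun e => (hy e).1), ?_⟩, ?_⟩
    · rw [← h2]
      exact congrArg (fun k => P.join ⟨b', k⟩) (funext fun e => (hy e).2)
    · rintro (z' | ⟨b', c', f'⟩) ⟨h5, h6⟩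
      · cases h5
      · simp only [DTree.map, DTree.node.injEq] at h5
        obtain ⟨rfl, h7, h8⟩ := h5
        obtain rfl := eq_of_heq h7
        have h8 := fun e => congrFun (eq_of_heq h8) e
        have h9 := hu ⟨b', fun e => P.contractD (f' e)⟩ ⟨?_, h6⟩
        · exact congrArg (DTree.node _ _) (funext fun e => hyu e _
            ⟨h8 e, congrFun (eq_of_heq (Sigma.ext_iff.1 h9).2) e⟩)
        · refine Sigma.ext rfl (heq_of_eq (funext fun e => ?_))
          exact (contractD_nat h (f' e)).symm.trans (congrArg P.contractD (h8 e))

/-! ## The Baez-Dolan construction -/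

/-- `P`-trees with dots decorated in `C` that contract to the operation `x`. -/
def PlusObj (P : PolyMonad) (C : (Σ i, P.Op i) → Type) (x : Σ i, P.Op i) : Type :=
  {T : DTree P.toPoly C (fun _ => Unit) x.1 // (P.contractD T).1 = x.2}

theorem obj_unit {i : P.I} {b : P.Op i} (z : P.Obj (fun _ => Unit) i) (h : z.1 = b) :
    z = ⟨b, fun _ => ()⟩ := by
  subst h; rfl

theorem exists_fill {i : P.I} {b : P.Op i} (T : P.PlusObj C ⟨i, b⟩) (k : ∀ e : P.Ar b, X (P.src e)) :
    ∃! z : DTree P.toPoly C X i, z.map (fun _ _ => ()) = T.1 ∧ P.contractD z = ⟨b, k⟩ := by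
  obtain ⟨T, hT⟩ := T
  exact contractD_cart (fun _ _ => ()) T ⟨b, k⟩ (obj_unit _ hT).symm

/-- If `T` contracts to the operation `b`, its leaves are in bijection with `E_b`; `fill T k`
decorates the leaf corresponding to `e ∈ E_b` by `k e`. It is the unique decoration of the leaves
of `T` that contracts to `⟨b, k⟩`. -/
noncomputable def fill {i : P.I} {b : P.Op i} (T : P.PlusObj C ⟨i, b⟩) (k : ∀ e : P.Ar b, X (P.src e)) :
    DTree P.toPoly C X i :=
  (exists_fill T k).choose

theorem map_fill {i : P.I} {b : P.Op i} (T : P.PlusObj C ⟨i, b⟩) (k : ∀ e : P.Ar b, X (P.src e)) :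
    (fill T k).map (fun _ _ => ()) = T.1 :=
  (exists_fill T k).choose_spec.1.1

theorem contractD_fill {i : P.I} {b : P.Op i} (T : P.PlusObj C ⟨i, b⟩) (k : ∀ e : P.Ar b, X (P.src e)) :
    P.contractD (fill T k) = ⟨b, k⟩ :=
  (exists_fill T k).choose_spec.1.2

theorem eq_fill {i : P.I} {b : P.Op i} (T : P.PlusObj C ⟨i, b⟩) (k : ∀ e : P.Ar b, X (P.src e))
    (z : DTree P.toPoly C X i) (h1 : z.map (fun _ _ => ()) = T.1)
    (h2 : P.contractD z = ⟨b, k⟩) : z = fill T k :=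
  (exists_fill T k).choose_spec.2 z ⟨h1, h2⟩

/-- Substitution: each dot, with operation `b`, is decorated by a tree that contracts to `b`, and
this tree is substituted for the dot. -/
noncomputable def subst : {i : P.I} → DTree P.toPoly (P.PlusObj C) X i → DTree P.toPoly C X i
  | _, .leaf x => .leaf x
  | _, .node _ T f => (fill T fun e => subst (f e)).graft

theorem contractD_subst {i : P.I} (T : DTree P.toPoly (P.PlusObj C) X i) :
    P.contractD (subst T) = P.contractD T := by
  induction T with
  | leaf x => rfl
  | node b c f ih =>
    rw [subst, contractD_graft, contractD_fill]
    exact congrArg (fun k => P.join ⟨b, k⟩) (funext ih)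

theorem subst_nat (h : ∀ i, X i → Y i) {i : P.I} (T : DTree P.toPoly (P.PlusObj C) X i) :
    subst (T.map h) = (subst T).map h := by
  induction T with
  | leaf x => rfl
  | node b c f ih =>
    rw [subst, DTree.map, subst, DTree.graft_nat]
    congr 1
    symm
    refine eq_fill _ _ _ ?_ ?_
    · rw [DTree.map_map]; exact map_fill _ _
    · rw [contractD_nat, contractD_fill]
      exact Sigma.ext rfl (heq_of_eq (funext fun e => (ih e).symm))

theorem subst_graft {i : P.I}
    (T : DTree P.toPoly (P.PlusObj C) (DTree P.toPoly (P.PlusObj C) X) i) :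
    subst T.graft = ((subst T).map fun _ => subst).graft := by
  induction T with
  | leaf x => rfl
  | node b c f ih =>
    rw [DTree.graft, subst, subst, DTree.graft_nat, DTree.graft_graft, DTree.map_map]
    congr 1
    symm
    refine eq_fill _ _ _ ?_ ?_
    · rw [DTree.map_map]; exact map_fill _ _
    · rw [contractD_nat, contractD_fill]
      exact Sigma.ext rfl (heq_of_eq (funext fun e => (ih e).symm))

/-- Change of decorations. -/
def plusMap (g : ∀ x, C x → D x) {x : Σ i, P.Op i} (T : P.PlusObj C x) : P.PlusObj D x :=
  ⟨T.1.mapDec g, by rw [contractD_mapDec]; exact T.2⟩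

/-- The tree with one dot. -/
def plusUnit {x : Σ i, P.Op i} (c : C x) : P.PlusObj C x :=
  ⟨.node x.2 c fun _ => .leaf (), congrArg Sigma.fst
    (P.join_map_unit (X := fun _ => Unit) ⟨x.2, fun _ => ()⟩)⟩

/-- Substitution of all decorating trees. -/
noncomputable def plusJoin {x : Σ i, P.Op i} (T : P.PlusObj (P.PlusObj C) x) : P.PlusObj C x :=
  ⟨subst T.1, by rw [contractD_subst]; exact T.2⟩

theorem fill_mapDec (g : ∀ x, C x → D x) {i : P.I} {b : P.Op i} (T : P.PlusObj C ⟨i, b⟩)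
    (k : ∀ e : P.Ar b, X (P.src e)) : (fill T k).mapDec g = fill (plusMap g T) k := by
  refine eq_fill _ _ _ ?_ ?_
  · rw [DTree.map_mapDec, map_fill]; rfl
  · rw [contractD_mapDec, contractD_fill]

theorem map_fill' (h : ∀ i, X i → Y i) {i : P.I} {b : P.Op i} (T : P.PlusObj C ⟨i, b⟩)
    (k : ∀ e : P.Ar b, X (P.src e)) : (fill T k).map h = fill T fun e => h _ (k e) := by
  refine eq_fill _ _ _ ?_ ?_
  · rw [DTree.map_map]; exact map_fill _ _
  · rw [contractD_nat, contractD_fill]; rfl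

theorem subst_mapDec (g : ∀ x, C x → D x) {i : P.I} (T : DTree P.toPoly (P.PlusObj C) X i) :
    (subst T).mapDec g = subst (T.mapDec fun _ => plusMap g) := by
  induction T with
  | leaf x => rfl
  | node b c f ih =>
    rw [DTree.mapDec, subst, subst, DTree.graft_mapDec, map_fill', fill_mapDec]
    simp only [ih]

theorem plusJoin_unit {x : Σ i, P.Op i} (T : P.PlusObj C x) : plusJoin (plusUnit T) = T := by
  refine Subtype.ext ?_
  change (fill T fun e => DTree.leaf ()).graft = T.1
  conv_rhs => rw [← DTree.graft_map_leaf T.1]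
  congr 1
  symm
  refine eq_fill _ _ _ ?_ ?_
  · rw [DTree.map_map]; exact DTree.map_unit _ _
  · rw [contractD_nat]
    rw [obj_unit _ T.2]
    rfl

theorem subst_mapDec_unit {i : P.I} (T : DTree P.toPoly C X i) :
    subst (T.mapDec fun _ => plusUnit (P := P)) = T := by
  induction T with
  | leaf x => rfl
  | node b c f ih =>
    rw [DTree.mapDec, subst]
    simp only [ih]
    have : fill (plusUnit (P := P) c) f = .node b c fun e => .leaf (f e) := by
      symm
      refine eq_fill _ _ _ rfl ?_
      exact P.join_map_unit (X := DTree P.toPoly C X) ⟨b, f⟩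
    rw [this]
    rfl

theorem subst_subst {i : P.I} (T : DTree P.toPoly (P.PlusObj (P.PlusObj C)) X i) :
    subst (subst T) = subst (T.mapDec fun _ => plusJoin) := by
  induction T with
  | leaf x => rfl
  | node b c f ih =>
    rw [subst, subst_graft, DTree.mapDec, subst]
    congr 1
    refine eq_fill _ _ _ ?_ ?_
    · rw [DTree.map_map, ← subst_nat, map_fill]; rfl
    · rw [contractD_nat, contractD_subst, contractD_fill]
      exact Sigma.ext rfl (heq_of_eq (funext fun e => ih e))

theorem subst_cart (g : ∀ x, C x → D x) {i : P.I} (w : DTree P.toPoly (P.PlusObj D) X i) :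
    ∀ z : DTree P.toPoly C X i, z.mapDec g = subst w →
      ∃! y : DTree P.toPoly (P.PlusObj C) X i,
        (y.mapDec fun _ => plusMap g) = w ∧ subst y = z := by
  induction w with
  | leaf x =>
    intro z hz
    refine ⟨.leaf x, ⟨rfl, ?_⟩, ?_⟩
    · cases z with
      | leaf x' => exact (DTree.leaf.injEq .. ▸ hz : x' = x) ▸ rfl
      | node b c f => cases hz
    · rintro (y | ⟨b, c, f⟩) ⟨h1, h2⟩
      · exact congrArg DTree.leaf (DTree.leaf.injEq .. ▸ h1 : y = x)
      · cases h1
  | node b T' f ih =>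
    intro z hz
    obtain ⟨y, ⟨h1, h2⟩, hu⟩ := DTree.graft_cart g _ z hz
    have hy : P.map (fun _ => DTree.mapDec g) (P.contractD y) = ⟨b, fun e => subst (f e)⟩ := by
      rw [← contractD_nat, ← contractD_mapDec g, h1, contractD_fill]
    obtain ⟨b', k, hk⟩ : ∃ b' k, P.contractD y = ⟨b', k⟩ := ⟨_, _, rfl⟩
    rw [hk] at hy
    obtain ⟨h3, h4⟩ := Sigma.ext_iff.1 hy
    change b' = b at h3
    subst h3
    choose v hv hvu using fun e => ih e (k e) (congrFun (eq_of_heq h4) e)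
    let T : P.PlusObj C ⟨_, b'⟩ := ⟨y.map fun _ _ => (), by rw [contractD_nat, hk]; rfl⟩
    have hT : plusMap g T = T' := by
      refine Subtype.ext ?_
      change (y.map fun _ _ => ()).mapDec g = T'.1
      rw [← map_fill T' fun e => subst (f e), ← h1, ← DTree.map_mapDec, ← DTree.map_mapDec,
        DTree.map_map]
    have hyf : y = fill T k := eq_fill T k y rfl hk
    refine ⟨.node b' T v, ⟨?_, ?_⟩, ?_⟩
    · rw [DTree.mapDec, hT]
      exact congrArg (DTree.node _ _) (funext fun e => (hv e).1)
    · rw [subst, ← h2, hyf]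
      congr 2
      funext e
      exact (hv e).2
    · rintro (y' | ⟨b2, T2, f2⟩) ⟨h5, h6⟩
      · cases h5
      · simp only [DTree.mapDec, DTree.node.injEq] at h5
        obtain ⟨rfl, h7, h8⟩ := h5
        have h7 := eq_of_heq h7
        have h8 := fun e => congrFun (eq_of_heq h8) e
        have h9 := hu (fill T2 fun e => subst (f2 e)) ⟨?_, h6⟩
        · have e1 : T2 = T := Subtype.ext (by
            rw [← map_fill T2 fun e => subst (f2 e), h9])
          have e2 : (⟨b2, fun e => subst (f2 e)⟩ : P.Obj (DTree P.toPoly C X) _) = ⟨b2, k⟩ := by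
            rw [← contractD_fill T2 fun e => subst (f2 e), h9, hk]
          rw [e1]
          exact congrArg (DTree.node _ _) (funext fun e => hvu e _
            ⟨h8 e, congrFun (eq_of_heq (Sigma.ext_iff.1 e2).2) e⟩)
        · rw [map_fill', fill_mapDec, h7]
          simp only [subst_mapDec, h8]

/-- The polynomial endofunctor `B ← tr•(P) → tr(P) → B`: the types are the operations of `P`, the
operations of output type `b` are the `P`-trees that contract to `b`, the inputs of such a tree
are its dots, and the type of a dot is the operation decorating it. -/
abbrev plusPoly (P : PolyMonad) : Poly where
  I := Σ i, P.Op i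
  Op x := {T : Tr P.toPoly x.1 // (P.contract T).1 = x.2}
  Ar T := T.1.Nodes
  src {_ T} n := T.1.deco n
  fin T := T.1.finite_nodes

/-- The value of this functor at `C` is the set of trees with dots decorated in `C`. -/
def toObj {x : Σ i, P.Op i} (T : P.PlusObj C x) : P.plusPoly.Obj C x :=
  ⟨⟨T.1.split.1, by rw [contract_split]; exact T.2⟩, T.1.split.2⟩

/-- Inverse of `toObj`. -/
def ofObj {x : Σ i, P.Op i} (z : P.plusPoly.Obj C x) : P.PlusObj C x :=
  ⟨DTree.decorate z.1.1 z.2, by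
    have h := DTree.split_decorate z.1.1 z.2
    rw [← contract_split, congrArg Sigma.fst h]; exact z.1.2⟩

theorem ofObj_toObj {x : Σ i, P.Op i} (T : P.PlusObj C x) : ofObj (toObj T) = T :=
  Subtype.ext (DTree.decorate_split T.1)

theorem plusObj_ext {x : Σ i, P.Op i} {z w : P.plusPoly.Obj C x}
    (h : (⟨z.1.1, z.2⟩ : Σ T : Tr P.toPoly x.1, ∀ n : T.Nodes, C (T.deco n)) = ⟨w.1.1, w.2⟩) :
    z = w := by
  obtain ⟨⟨T, hT⟩, c⟩ := z
  obtain ⟨⟨T', hT'⟩, c'⟩ := w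
  cases h
  rfl

theorem toObj_ofObj {x : Σ i, P.Op i} (z : P.plusPoly.Obj C x) : toObj (ofObj z) = z :=
  plusObj_ext (DTree.split_decorate z.1.1 z.2)

theorem toObj_map (g : ∀ x, C x → D x) {x : Σ i, P.Op i} (T : P.PlusObj C x) :
    toObj (plusMap g T) = P.plusPoly.map g (toObj T) :=
  plusObj_ext (DTree.split_mapDec g T.1)

theorem ofObj_map (g : ∀ x, C x → D x) {x : Σ i, P.Op i} (z : P.plusPoly.Obj C x) :
    ofObj (P.plusPoly.map g z) = plusMap g (ofObj z) := by
  rw [← ofObj_toObj (plusMap g (ofObj z)), toObj_map, toObj_ofObj]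

theorem plusMap_id {x : Σ i, P.Op i} (T : P.PlusObj C x) : plusMap (fun _ c => c) T = T :=
  Subtype.ext (DTree.mapDec_id T.1)

theorem plusMap_map {E : (Σ i, P.Op i) → Type} (g : ∀ x, C x → D x) (h : ∀ x, D x → E x)
    {x : Σ i, P.Op i} (T : P.PlusObj C x) :
    plusMap h (plusMap g T) = plusMap (fun x c => h x (g x c)) T :=
  Subtype.ext (DTree.mapDec_mapDec g h T.1)

/-- The composition law of `P⁺`: substitute each decorating tree into the node it decorates. -/
noncomputable def plusMul {x : Σ i, P.Op i} (z : P.plusPoly.Obj (P.plusPoly.Obj C) x) :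
    P.plusPoly.Obj C x :=
  toObj (plusJoin (plusMap (fun _ => ofObj) (ofObj z)))

theorem ofObj_plusMul {x : Σ i, P.Op i} (z : P.plusPoly.Obj (P.plusPoly.Obj C) x) :
    ofObj (plusMul z) = plusJoin (plusMap (fun _ => ofObj) (ofObj z)) :=
  ofObj_toObj _

theorem plusJoin_nat (g : ∀ x, C x → D x) {x : Σ i, P.Op i} (T : P.PlusObj (P.PlusObj C) x) :
    plusMap g (plusJoin T) = plusJoin (plusMap (fun _ => plusMap g) T) :=
  Subtype.ext (subst_mapDec g T.1)

theorem ofObj_inj {x : Σ i, P.Op i} {z w : P.plusPoly.Obj C x} (h : ofObj z = ofObj w) :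
    z = w := by
  rw [← toObj_ofObj z, h, toObj_ofObj]

theorem plusMul_nat (g : ∀ x, C x → D x) {x : Σ i, P.Op i}
    (z : P.plusPoly.Obj (P.plusPoly.Obj C) x) :
    P.plusPoly.map g (plusMul z) = plusMul (P.plusPoly.map (fun _ => P.plusPoly.map g) z) := by
  apply ofObj_inj
  simp only [ofObj_map, ofObj_plusMul, plusJoin_nat, plusMap_map]

theorem plusUnit_cart (g : ∀ x, C x → D x) {x : Σ i, P.Op i} (d : D x)
    (w : P.plusPoly.Obj C x) (h : P.plusPoly.map g w = toObj (plusUnit d)) :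
    ∃! c : C x, g x c = d ∧ toObj (plusUnit c) = w := by
  have h' : plusMap g (ofObj w) = plusUnit d := by rw [← ofObj_map, h, ofObj_toObj]
  obtain ⟨T, hT⟩ : ∃ T, T = ofObj w := ⟨_, rfl⟩
  rw [← hT] at h'
  obtain ⟨T, hT'⟩ := T
  have h2 : T.mapDec g = .node x.2 d fun _ => .leaf () := congrArg Subtype.val h'
  cases T with
  | leaf y => cases h2
  | node b c f =>
    simp only [DTree.mapDec, DTree.node.injEq] at h2
    obtain ⟨rfl, h3, h4⟩ := h2
    have h4 := fun e => congrFun (eq_of_heq h4) e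
    have hf : f = fun _ => .leaf () := by
      funext e
      have := h4 e
      cases hfe : f e with
      | leaf y => rfl
      | node b' c' f' => rw [hfe] at this; cases this
    subst hf
    refine ⟨c, ⟨eq_of_heq h3, ofObj_inj ?_⟩, ?_⟩
    · rw [ofObj_toObj, ← hT]; rfl
    · rintro c' ⟨-, h5⟩
      have h6 : plusUnit (P := P) c' = _ := (ofObj_toObj _).symm.trans (h5 ▸ hT.symm)
      have h7 := congrArg Subtype.val h6
      simp only [plusUnit, DTree.node.injEq] at h7
      exact eq_of_heq h7.2.1

theorem plusMul_cart (g : ∀ x, C x → D x) {x : Σ i, P.Op i}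
    (y : P.plusPoly.Obj (P.plusPoly.Obj D) x) (w : P.plusPoly.Obj C x)
    (h : P.plusPoly.map g w = plusMul y) :
    ∃! z : P.plusPoly.Obj (P.plusPoly.Obj C) x,
      P.plusPoly.map (fun _ => P.plusPoly.map g) z = y ∧ plusMul z = w := by
  have h' := congrArg ofObj h
  rw [ofObj_map, ofObj_plusMul] at h'
  obtain ⟨v, ⟨h1, h2⟩, hu⟩ := subst_cart g _ _ (congrArg Subtype.val h')
  let V : P.PlusObj (P.PlusObj C) x := ⟨v, by
    rw [← contractD_subst, h2]; exact (ofObj w).2⟩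
  have hV1 : plusMap (fun _ => plusMap g) V = plusMap (fun _ => ofObj) (ofObj y) := Subtype.ext h1
  have hV2 : plusJoin V = ofObj w := Subtype.ext h2
  refine ⟨toObj (plusMap (fun _ => toObj) V), ⟨?_, ?_⟩, ?_⟩
  · apply ofObj_inj
    rw [ofObj_map, ofObj_toObj, plusMap_map]
    have := congrArg (plusMap fun _ => toObj) hV1
    simpa only [plusMap_map, toObj_map, toObj_ofObj, plusMap_id] using this
  · apply ofObj_inj
    rw [ofObj_plusMul, ofObj_toObj, plusMap_map]
    simp only [ofObj_toObj, plusMap_id, hV2]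
  · rintro z ⟨h3, h4⟩
    have h5 : plusMap (fun _ => ofObj) (ofObj z) = V := by
      refine Subtype.ext (hu _ ⟨?_, ?_⟩)
      · refine congrArg Subtype.val (a₁ := plusMap (fun _ => plusMap g) _)
          (a₂ := plusMap (fun _ => ofObj) (ofObj y)) ?_
        rw [← h3]
        simp only [ofObj_map, plusMap_map]
      · rw [← h4, ofObj_plusMul]; rfl
    rw [← h5]
    apply ofObj_inj
    simp only [plusMap_map, toObj_ofObj, plusMap_id]

theorem plusMul_unit {x : Σ i, P.Op i} (z : P.plusPoly.Obj C x) :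
    plusMul (toObj (plusUnit z)) = z := by
  apply ofObj_inj
  rw [ofObj_plusMul, ofObj_toObj]
  exact plusJoin_unit (ofObj z)

theorem plusMul_map_unit {x : Σ i, P.Op i} (z : P.plusPoly.Obj C x) :
    plusMul (P.plusPoly.map (fun _ c => toObj (plusUnit c)) z) = z := by
  apply ofObj_inj
  rw [ofObj_plusMul, ofObj_map, plusMap_map]
  simp only [ofObj_toObj]
  exact Subtype.ext (subst_mapDec_unit _)

theorem plusMul_plusMul {x : Σ i, P.Op i}
    (z : P.plusPoly.Obj (P.plusPoly.Obj (P.plusPoly.Obj C)) x) :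
    plusMul (plusMul z) = plusMul (P.plusPoly.map (fun _ => plusMul) z) := by
  apply ofObj_inj
  simp only [ofObj_map, ofObj_plusMul, plusJoin_nat, plusMap_map]
  refine Subtype.ext ((subst_subst _).trans ?_)
  change subst (DTree.mapDec _ (DTree.mapDec _ _)) = subst (DTree.mapDec _ _)
  rw [DTree.mapDec_mapDec]

/-- The Baez-Dolan construction `P⁺`: the unit sends an operation to the one-dot tree, and the
composition law substitutes each decorating tree into the dot it decorates. -/
noncomputable def plus (P : PolyMonad) : PolyMonad where
  toPoly := P.plusPoly
  unit c := toObj (plusUnit c)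
  join z := plusMul z
  unit_nat f _ x := (toObj_map f (plusUnit x)).symm
  join_nat f _ z := plusMul_nat f z
  unit_cart f _ y x h := plusUnit_cart f y x h
  join_cart f _ y x h := plusMul_cart f y x h
  join_unit z := plusMul_unit z
  join_map_unit z := plusMul_map_unit z
  join_join z := plusMul_plusMul z

/-- The identity monad on `Set`. -/
def idMonad : PolyMonad where
  I := Unit
  Op _ := Unit
  Ar _ := Unit
  src _ := ()
  fin _ := inferInstance
  unit x := ⟨(), fun _ => x⟩
  join z := z.2 ()
  unit_nat _ _ _ := rfl
  join_nat _ _ _ := rfl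
  unit_cart f _ y x h := by
    refine ⟨x.2 (), ⟨?_, rfl⟩, ?_⟩
    · have := eq_of_heq (Sigma.ext_iff.1 h).2
      exact congrFun this ()
    · rintro z ⟨-, rfl⟩; rfl
  join_cart f _ y x h := by
    refine ⟨⟨(), fun _ => x⟩, ⟨?_, rfl⟩, ?_⟩
    · exact Sigma.ext rfl (heq_of_eq (funext fun _ => h))
    · rintro z ⟨-, rfl⟩; rfl
  join_unit _ := rfl
  join_map_unit _ := rfl
  join_join _ := rfl

end PolyMonad

/-! ## Trees, constellations and zoom complexes -/

/-- A graph with a set of boundary vertices and a root vertex (the output vertex). -/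
structure RootedGraph : Type 1 where
  V : Type
  G : SimpleGraph V
  bdry : Set V
  root : V

namespace RootedGraph

/-- The number of edges incident to a vertex. -/
noncomputable def valence (T : RootedGraph) (v : T.V) : ℕ := (T.G.neighborSet v).ncard

/-- The dots are the vertices that are not boundary vertices. -/
def dots (T : RootedGraph) : Set T.V := {v | v ∉ T.bdry}

/-- The input vertices, that is, the boundary vertices other than the root; they stand for the
leaves (each leaf is the edge at exactly one input vertex). -/
def leaves (T : RootedGraph) : Set T.V := {v | v ∈ T.bdry ∧ v ≠ T.root}

/-- Dots of valence one. -/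
def nullDots (T : RootedGraph) : Set T.V := {v | v ∈ T.dots ∧ T.valence v = 1}

/-- The tree order, with the root as maximal element: `b` lies between `a` and the root. -/
def le (T : RootedGraph) (a b : T.V) : Prop := ∀ p : T.G.Walk a T.root, b ∈ p.support

/-- A kernel: a set of dots that spans a non-empty connected full subgraph. -/
def IsKernel (T : RootedGraph) (K : Set T.V) : Prop := K ⊆ T.dots ∧ (T.G.induce K).Connected

/-- Finite rooted trees with boundary: finite, connected and simply connected, the boundary
consisting of vertices of valence one and containing the root. -/
structure IsTree (T : RootedGraph) : Prop where
  finite : Finite T.V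
  isTree : T.G.IsTree
  root_mem : T.root ∈ T.bdry
  valence_bdry : ∀ v ∈ T.bdry, T.valence v = 1

/-- Every dot has exactly one input edge (besides its output edge). -/
def IsLinear (T : RootedGraph) : Prop := ∀ v ∈ T.dots, T.valence v = 2

/-- Isomorphisms of graphs that preserve root and boundary. -/
structure Iso (S T : RootedGraph) where
  toIso : S.G ≃g T.G
  map_root : toIso S.root = T.root
  map_bdry : ∀ v, toIso v ∈ T.bdry ↔ v ∈ S.bdry

instance (S T : RootedGraph) : CoeFun (Iso S T) fun _ => S.V → T.V := ⟨fun e => e.toIso⟩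

def Iso.refl (T : RootedGraph) : Iso T T := ⟨RelIso.refl _, rfl, fun _ => Iff.rfl⟩

def Iso.symm {S T : RootedGraph} (e : Iso S T) : Iso T S where
  toIso := e.toIso.symm
  map_root := by rw [← e.map_root]; exact e.toIso.symm_apply_apply _
  map_bdry v := by
    rw [← e.map_bdry]
    exact iff_of_eq (congrArg (· ∈ T.bdry) (e.toIso.apply_symm_apply v))

def Iso.trans {S T U : RootedGraph} (e : Iso S T) (f : Iso T U) : Iso S U where
  toIso := e.toIso.trans f.toIso
  map_root := (congrArg f e.map_root).trans f.map_root
  map_bdry v := (f.map_bdry _).trans (e.map_bdry v)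

end RootedGraph

/-- Finite rooted trees with boundary. -/
structure FTree : Type 1 extends RootedGraph where
  isTree : toRootedGraph.IsTree

/-- A subdivision of `T`: a tree obtained by replacing each edge of `T` by a linear tree. The new
dots, those outside the image of `emb`, are the white dots; they have valence two, and two
vertices of `T` are adjacent if and only if they are joined by a path with white interior. -/
structure Subdivision (T : RootedGraph) : Type 1 where
  tree : FTree
  emb : T.V ↪ tree.V
  emb_root : emb T.root = tree.root
  emb_bdry : ∀ v, emb v ∈ tree.bdry ↔ v ∈ T.bdry
  white_dot : ∀ w, w ∉ Set.range emb → w ∈ tree.dots ∧ tree.valence w = 2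
  adj_iff : ∀ u v, T.G.Adj u v ↔ u ≠ v ∧ ∃ p : tree.G.Walk (emb u) (emb v), p.IsPath ∧
    ∀ x ∈ p.support, x ∈ Set.range emb → x = emb u ∨ x = emb v

/-- The white dots. -/
def Subdivision.white {T : RootedGraph} (S : Subdivision T) : Set S.tree.V :=
  {w | w ∉ Set.range S.emb}

/-- A constellation `T → N`: a tree `T` with a nesting of spheres whose corresponding tree is `N`.
It consists of a subdivision of `T` and of bijections from the black dots (the dots of `T`) to
the leaves of `N` and from the white dots to the null-dots of `N`, subject to the kernel rule. The
dots of `N` are the spheres. -/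
structure Constellation (T N : FTree) : Type 1 where
  sub : Subdivision T.toRootedGraph
  black : T.dots ≃ N.leaves
  white : sub.white ≃ N.nullDots
  kernel_rule : ∀ x ∈ N.dots, sub.tree.IsKernel
    ({t | ∃ d : T.dots, sub.emb d = t ∧ N.le (black d) x} ∪
      {t | ∃ w : sub.white, (w : sub.tree.V) = t ∧ N.le (white w) x})

/-- The isomorphisms `e` and `f` of trees extend to an isomorphism of constellations. -/
def Constellation.IsoOver {T N T' N' : FTree} (C : Constellation T N) (C' : Constellation T' N')
    (e : T.Iso T'.toRootedGraph) (f : N.Iso N'.toRootedGraph) : Prop :=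
  ∃ τ : C.sub.tree.Iso C'.sub.tree.toRootedGraph,
    (∀ v, τ (C.sub.emb v) = C'.sub.emb (e v)) ∧
    (∀ (d : T.dots) (d' : T'.dots), e d = d' → f (C.black d) = C'.black d') ∧
    (∀ (w : C.sub.white) (w' : C'.sub.white), τ w = w' → f (C.white w) = C'.white w')

/-- Zoom complexes `X_0, …, X_n` of degree `n` whose last constellation has nesting `N`. In a zoom,
the nesting of one constellation is the underlying tree of the next, so this is a sequence of
trees and constellations `T_0 → T_1 → ⋯ → T_{n+1} = N`. -/
inductive ZoomComplex : ℕ → FTree → Type 1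
  | single {T N : FTree} (C : Constellation T N) : ZoomComplex 0 N
  | zoom {n : ℕ} {M N : FTree} (X : ZoomComplex n M) (C : Constellation M N) :
      ZoomComplex (n + 1) N

namespace ZoomComplex

/-- `f` extends to an isomorphism of zoom complexes, that is, to a sequence of isomorphisms of
constellations which agree on the trees that two consecutive constellations share. -/
def IsoOver : {n : ℕ} → {N N' : FTree} → ZoomComplex n N → ZoomComplex n N' →
    N.Iso N'.toRootedGraph → Prop
  | _, _, _, .single (T := T) C, .single (T := T') C', f =>
      ∃ e : T.Iso T'.toRootedGraph, C.IsoOver C' e f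
  | _, _, _, .zoom (M := M) X C, .zoom (M := M') X' C', f =>
      ∃ e : M.Iso M'.toRootedGraph, X.IsoOver X' e ∧ C.IsoOver C' e f

/-- The initial condition: `X_0` and `X_1` are one sphere around the dot of a tree with one dot and
one leaf, and the spheres of `X_2` are linearly nested (around its single dot). -/
def IsOpetopic : {n : ℕ} → {N : FTree} → ZoomComplex n N → Prop
  | _, N, .single (T := T) _ =>
      (T.IsLinear ∧ T.dots.ncard = 1) ∧ (N.IsLinear ∧ N.dots.ncard = 1)
  | 1, N, .zoom X _ => X.IsOpetopic ∧ (N.IsLinear ∧ N.dots.ncard = 1)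
  | 2, N, .zoom X _ => X.IsOpetopic ∧ N.IsLinear
  | _ + 3, _, .zoom X _ => X.IsOpetopic

end ZoomComplex

namespace Constellation

theorem IsoOver.refl {T N : FTree} (C : Constellation T N) :
    C.IsoOver C (.refl _) (.refl _) :=
  ⟨.refl _, fun _ => rfl, fun d d' h => by cases Subtype.ext h; rfl,
    fun w w' h => by cases Subtype.ext h; rfl⟩

theorem IsoOver.symm {T N T' N' : FTree} {C : Constellation T N} {C' : Constellation T' N'}
    {e : T.Iso T'.toRootedGraph} {f : N.Iso N'.toRootedGraph} (h : C.IsoOver C' e f) :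
    C'.IsoOver C e.symm f.symm := by
  obtain ⟨τ, h1, h2, h3⟩ := h
  refine ⟨τ.symm, fun v => ?_, fun d d' h => ?_, fun w w' h => ?_⟩
  · refine (τ.toIso.symm_apply_eq).2 ?_
    refine Eq.trans ?_ (h1 _).symm
    exact congrArg C'.sub.emb (e.toIso.apply_symm_apply v).symm
  · exact (f.toIso.symm_apply_eq).2 (h2 d' d ((e.toIso.symm_apply_eq).1 h).symm).symm
  · exact (f.toIso.symm_apply_eq).2 (h3 w' w ((τ.toIso.symm_apply_eq).1 h).symm).symm

theorem IsoOver.trans {T N T' N' T'' N'' : FTree} {C : Constellation T N}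
    {C' : Constellation T' N'} {C'' : Constellation T'' N''}
    {e : T.Iso T'.toRootedGraph} {f : N.Iso N'.toRootedGraph}
    {e' : T'.Iso T''.toRootedGraph} {f' : N'.Iso N''.toRootedGraph}
    (h : C.IsoOver C' e f) (h' : C'.IsoOver C'' e' f') :
    C.IsoOver C'' (e.trans e') (f.trans f') := by
  obtain ⟨τ, h1, h2, h3⟩ := h
  obtain ⟨τ', h1', h2', h3'⟩ := h'
  refine ⟨τ.trans τ', fun v => ?_, fun d d' h => ?_, fun w w' h => ?_⟩
  · exact (congrArg τ' (h1 v)).trans (h1' _)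
  · have hd : e d ∈ T'.dots := fun hb => d.2 ((e.map_bdry _).1 hb)
    exact (congrArg f' (h2 d ⟨_, hd⟩ rfl)).trans (h2' ⟨_, hd⟩ d' h)
  · have hw : τ w ∈ C'.sub.white := by
      rintro ⟨v, hv⟩
      refine w.2 ⟨e.symm v, τ.toIso.injective ?_⟩
      refine (h1 _).trans (Eq.trans ?_ hv)
      exact congrArg C'.sub.emb (e.toIso.apply_symm_apply v)
    exact (congrArg f' (h3 w ⟨_, hw⟩ rfl)).trans (h3' ⟨_, hw⟩ w' h)

end Constellation

namespace ZoomComplex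

theorem isoOver_refl {n : ℕ} {N : FTree} (X : ZoomComplex n N) : X.IsoOver X (.refl _) := by
  induction X with
  | single C => exact ⟨.refl _, .refl C⟩
  | zoom X C ih => exact ⟨.refl _, ih, .refl C⟩

theorem isoOver_symm {n : ℕ} {N N' : FTree} {X : ZoomComplex n N} {X' : ZoomComplex n N'}
    {f : N.Iso N'.toRootedGraph} (h : X.IsoOver X' f) : X'.IsoOver X f.symm := by
  induction X generalizing N' with
  | single C =>
    cases X' with
    | single C' =>
      obtain ⟨e, h⟩ := h
      exact ⟨e.symm, h.symm⟩
  | zoom X C ih =>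
    cases X' with
    | zoom X' C' =>
      obtain ⟨e, h1, h2⟩ := h
      exact ⟨e.symm, ih h1, h2.symm⟩

theorem isoOver_trans {n : ℕ} {N N' N'' : FTree} {X : ZoomComplex n N} {X' : ZoomComplex n N'}
    {X'' : ZoomComplex n N''} {f : N.Iso N'.toRootedGraph} {f' : N'.Iso N''.toRootedGraph}
    (h : X.IsoOver X' f) (h' : X'.IsoOver X'' f') : X.IsoOver X'' (f.trans f') := by
  induction X generalizing N' N'' with
  | single C =>
    cases X' with
    | single C' =>
      cases X'' with
      | single C'' =>
        obtain ⟨e, h⟩ := h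
        obtain ⟨e', h'⟩ := h'
        exact ⟨e.trans e', h.trans h'⟩
  | zoom X C ih =>
    cases X' with
    | zoom X' C' =>
      cases X'' with
      | zoom X'' C'' =>
        obtain ⟨e, h1, h2⟩ := h
        obtain ⟨e', h1', h2'⟩ := h'
        exact ⟨e.trans e', ih h1 h1', h2.trans h2'⟩

end ZoomComplex

/-- Zoom complexes of degree `n` that satisfy the initial condition. -/
structure OpetopicComplex (n : ℕ) : Type 1 where
  nesting : FTree
  complex : ZoomComplex n nesting
  isOpetopic : complex.IsOpetopic

/-- Isomorphism of zoom complexes. -/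
instance opetopicSetoid (n : ℕ) : Setoid (OpetopicComplex n) where
  r X Y := ∃ f : X.nesting.Iso Y.nesting.toRootedGraph, X.complex.IsoOver Y.complex f
  iseqv :=
    { refl := fun X => ⟨.refl _, X.complex.isoOver_refl⟩
      symm := fun ⟨f, h⟩ => ⟨f.symm, ZoomComplex.isoOver_symm h⟩
      trans := fun ⟨f, h⟩ ⟨g, k⟩ => ⟨f.trans g, ZoomComplex.isoOver_trans h k⟩ }

/-- The set of `n`-opetopes: isomorphism classes of zoom complexes with the initial condition. -/
def Opetope (n : ℕ) : Type 1 := Quotient (opetopicSetoid n)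

/-- The isomorphism class of a zoom complex. -/
def OpetopicComplex.toOpetope {n : ℕ} (X : OpetopicComplex n) : Opetope n := Quotient.mk _ X

/-- Omit the last constellation. -/
def OpetopicComplex.target {n : ℕ} : OpetopicComplex (n + 1) → OpetopicComplex n
  | ⟨_, .zoom (M := M) X _, h⟩ => ⟨M, X, match n, X, h with
    | 0, _, h => h.1
    | 1, _, h => h.1
    | _ + 2, _, h => h⟩

/-- The target facet of an opetope, obtained by omitting the last constellation. -/
def Opetope.target {n : ℕ} : Opetope (n + 1) → Opetope n :=
  Quotient.map OpetopicComplex.target (by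
    rintro ⟨N, X, hX⟩ ⟨N', X', hX'⟩ ⟨f, h⟩
    cases X with
    | zoom X C =>
      cases X' with
      | zoom X' C' =>
        obtain ⟨e, h1, -⟩ := h
        exact ⟨e, h1⟩)

/-! ## The underlying tree of a `P`-tree -/

namespace Tree

variable {P : Poly} {X : P.I → Type}

/-- The vertices other than the output vertex. -/
def Verts {i : P.I} (T : Tree P X i) : Type := T.Nodes ⊕ T.Leaves

/-- The vertex at the upper end of the root edge. -/
def top : {i : P.I} → (T : Tree P X i) → T.Verts
  | _, leaf _ => .inr .here
  | _, node _ _ => .inl .here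

/-- A vertex of the tree grafted on the input `e` of the root dot, as a vertex of the whole tree. -/
def upVert {i : P.I} {b : P.Op i} {f : ∀ e : P.Ar b, Tree P X (P.src e)} (e : P.Ar b) :
    (f e).Verts → (node b f).Verts :=
  Sum.map (Nodes.up e) (Leaves.up e)

/-- `T.IsInput n v`: the vertex `v` is at the upper end of an input edge of the dot `n`. -/
def IsInput : {i : P.I} → (T : Tree P X i) → T.Nodes → T.Verts → Prop
  | _, node _ f, .here, v => ∃ e, v = upVert e (f e).top
  | _, node _ f, .up e n, v => ∃ v' : (f e).Verts, IsInput (f e) n v' ∧ v = upVert e v'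

/-- The relation `child of`; `none` is the output vertex, the only child of which is `T.top`. -/
def Above {i : P.I} (T : Tree P X i) : Option T.Verts → Option T.Verts → Prop
  | none, some v => v = T.top
  | some (.inl n), some v => T.IsInput n v
  | _, _ => False

/-- The underlying graph of a `P`-tree, with the leaves and the output vertex as boundary. -/
def graph {i : P.I} (T : Tree P X i) : RootedGraph where
  V := Option T.Verts
  G := SimpleGraph.fromRel T.Above
  bdry := {v | v = none ∨ ∃ l : T.Leaves, v = some (.inr l)}
  root := none

/-- Decorate the leaves by a function. -/
def relabel {S : Type} : {i : P.I} → (T : Tree P X i) → (T.Leaves → S) → Tree P (fun _ => S) i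
  | _, leaf _, g => leaf (g .here)
  | _, node b f, g => node b fun e => relabel (f e) fun l => g (.up e l)

/-- Replace each null-dot by a leaf. Each leaf of the result is decorated by the value of `g` at
the leaf or null-dot of `T` it comes from. -/
noncomputable def prune {S : Type} :
    {i : P.I} → (T : Tree P X i) → (T.Verts → S) → Tree P (fun _ => S) i
  | _, leaf _, g => leaf (g (.inr .here))
  | _, node b f, g =>
      haveI := Classical.propDecidable (IsEmpty (P.Ar b))
      if IsEmpty (P.Ar b) then leaf (g (.inl .here))
      else node b fun e => prune (f e) fun v => g (upVert e v)

end Tree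

namespace PolyMonad

variable {P : PolyMonad}

theorem contract_relabel {X : P.I → Type} {S : Type} {i : P.I} (T : Tree P.toPoly X i)
    (g : T.Leaves → S) : (P.contract (T.relabel g)).1 = (P.contract T).1 := by
  suffices h : P.map (Y := fun _ => Unit) (fun _ _ => ()) (P.contract (T.relabel g)) =
      P.map (fun _ _ => ()) (P.contract T) from congrArg Sigma.fst h
  induction T with
  | leaf x => exact (P.unit_nat _ _).trans (P.unit_nat (fun _ _ => ()) x).symm
  | node b f ih =>
    refine (P.join_nat _ _).trans (Eq.trans ?_ (P.join_nat _ _).symm)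
    exact congrArg (fun k => P.join ⟨b, k⟩) (funext fun e => ih e _)

/-- The bijection `E_b ≃ leaves(T)` for a `P`-tree `T` that contracts to `b`. -/
def leafOf {i : P.I} {b : P.Op i} (T : Tr P.toPoly i) (h : (P.contract T).1 = b) (a : P.Ar b) :
    T.Leaves :=
  (P.contract (T.relabel id)).2 (cast (congrArg P.Ar ((contract_relabel T id).trans h).symm) a)

/-- The contraction of a `P⁺`-tree `N`, but without the substitutions at its null-dots. A null-dot
of `N` is decorated by a unit tree, and substituting it would erase a dot (decorated by a unit
operation). So this is the contraction of `N`, a `P`-tree, subdivided by one extra (white) dot for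
each null-dot of `N`; its dots are labelled by the leaves and the null-dots of `N`. -/
noncomputable def blowup {x : P.plus.I} (N : Tr P.plus.toPoly x) : P.plus.Obj (fun _ => N.Verts) x :=
  P.plus.contract (N.prune id)

/-- Let `N` be a `P⁺`-tree and `M` the `P`-tree obtained by performing all the substitutions that
`N` prescribes. The scars of these substitutions are spheres on `M`, which form a constellation
with underlying tree `M` and nesting `N`. This says that `C` is that constellation, under
isomorphisms `α` of its underlying tree with `M` and `β` of its nesting with `N`.

* `dots`: a dot of `M` corresponds to the leaf of `N` it comes from.
* `spheres`: the subdivision of `C` is `blowup N`, each black or white dot corresponds to the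
  leaf or null-dot of `N` it comes from, and the leaves of `M` and of `blowup N` correspond. -/
structure IsConstellationOf {x : P.plus.I} (M : P.plus.Op x) (N : Tr P.plus.toPoly x)
    (h : (P.plus.contract N).1 = M) {T U : FTree} (C : Constellation T U)
    (α : T.Iso M.1.graph) (β : U.Iso N.graph) : Prop where
  dots : ∀ d : T.dots, ∃ n : P.plus.Ar M,
    α d = some (.inl n) ∧ β (C.black d) = some (.inr (leafOf N h n))
  spheres : ∃ τ : C.sub.tree.Iso (blowup N).1.1.graph,
    (∀ d : T.dots, ∃ n : P.plus.Ar (blowup N).1,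
      τ (C.sub.emb d) = some (.inl n) ∧ β (C.black d) = some ((blowup N).2 n)) ∧
    (∀ w : C.sub.white, ∃ n : P.plus.Ar (blowup N).1,
      τ w = some (.inl n) ∧ β (C.white w) = some ((blowup N).2 n)) ∧
    (∀ l : T.leaves, ∃ a : P.Ar x.2,
      α l = some (.inr (leafOf M.1 M.2 a)) ∧
      τ (C.sub.emb l) = some (.inr (leafOf (blowup N).1.1 (blowup N).1.2 a)))

end PolyMonad

/-- `P^k`, the `k`-th iterated Baez-Dolan construction on the identity monad on `Set`. -/
noncomputable def opMonad : ℕ → PolyMonad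
  | 0 => PolyMonad.idMonad
  | k + 1 => (opMonad k).plus

/-- The set `Z^k` of types of `P^k`. -/
abbrev Z (k : ℕ) : Type := (opMonad k).I

/-- The target of `z ∈ Z^{k+1} = op(P^k)`: its output type in `Z^k = typ(P^k)`. -/
def Z.target {k : ℕ} (z : Z (k + 1)) : Z k := Sigma.fst (β := (opMonad k).Op) z

/-- The elements of `Z^{k+2} = op(P^{k+1})` are the `P^k`-trees. -/
def Z.tree {k : ℕ} (z : Z (k + 2)) : Tr (opMonad k).toPoly z.target.target :=
  (Sigma.snd (β := (opMonad (k + 1)).Op) z).1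

theorem Z.contract_tree {k : ℕ} (z : Z (k + 3)) :
    ((opMonad (k + 1)).contract z.tree).1 = Sigma.snd (β := (opMonad (k + 1)).Op) z.target :=
  (Sigma.snd (β := (opMonad (k + 2)).Op) z).2

/-- The zoom complex `X_0, …, X_{k+2}` corresponds to the `P^k`-tree `z` under the isomorphism `α` of
the nesting of its last constellation `X_{k+2}` with the underlying tree of `z` (so that the
spheres of `X_{k+2}` correspond to the dots of `z`). In degree 2 the isomorphism of the nesting,
which is a linear tree, with `z` is all there is. In higher degree, the complex without its last
constellation has to correspond to the target of `z` under some isomorphism, for which the last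
constellation is the constellation given by the scars of the substitutions prescribed by `z`. -/
def ZoomComplex.Corresponds : {k : ℕ} → {N : FTree} → ZoomComplex (k + 2) N → (z : Z (k + 2)) →
    N.Iso z.tree.graph → Prop
  | 0, _, _, _, _ => True
  | k + 1, _, .zoom (M := M) X C, z, β => ∃ α : M.Iso (Z.tree (k := k) z.target).graph,
      X.Corresponds z.target α ∧
      PolyMonad.IsConstellationOf (P := opMonad k) (Sigma.snd (β := (opMonad (k + 1)).Op) z.target)
        z.tree z.contract_tree C α β

end Opetopes

/-! The bijections come from a relation `Corr` between zoom complexes and types of `P^k`, defined by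
recursion on the degree. An abstract tree `U` is given the structure of a `P`-tree by using its
vertices as labels for the dots and leaves of a `P`-tree (`Decorates`). Such a labelled tree
remembers both the graph and the operations, and two trees decorated with the same shape are
isomorphic by an isomorphism that carries one decoration to the other
(`Decorates.exists_iso_of_shape`).

The heart of the matter is a single constellation `C` from `T` to `U`, where `T` is decorated as a
`P`-tree `DM`. It has to be shown that `C` and a `P⁺`-decoration `DN` of `U` determine each other.
The intermediary is the subdivided tree. Its white dots carry unit operations. Because the unit is
cartesian, a unit operation has exactly one input and a family over its inputs is a single value, so
a decoration of `T` extends uniquely to the subdivided tree. This is the comparison of `erase` on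
decorated trees with `FTree.erased` on graphs.

The dots of the subdivided tree are named by the leaves and null-dots of `U`. For a dot `v` of `U`
the kernel rule says that the names above `v` form a connected piece with one lowest dot, and the
vertices immediately above `v` divide this piece into smaller connected pieces. Collapsing each
smaller piece to one dot gives the `P`-tree that decorates `v`, and recursion into the pieces gives
`DN` (`exists_blowupObj_eq`). A division into connected monochrome parts of different colours is
unique, hence so is `DN` (`IsRepr.eq_of_blowupObj_eq`).

Conversely, all substitutions of `DN` except those at null-dots produce the subdivided tree
(`blowupObj`). The result of a partial substitution is connected, which is the kernel rule, and
erasing the white dots gives the contraction of `DN` (`IsRepr.contractObj_eq`). So `DN` has a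
constellation (`exists_constellation`), unique up to isomorphism (`Constellation.Matches.isoOver`).

The inputs of an operation are compared with the leaves of a tree contracting to it through
cartesianness: a property holds at all leaves iff it holds at all inputs
(`allLeaf_iff_of_contractD`). In degrees up to 2 everything is linear: decorations over the identity
monad are the linear trees, and a constellation with linear nesting puts no condition on
isomorphisms. Induction on the degree then shows that `Corr` is total and single-valued in both
directions up to isomorphism. -/

namespace Opetopes

/-! ### Predicates, supports and disjointness on decorated trees. -/

namespace DTree

variable {P : Poly} {C D : (Σ i, P.Op i) → Type} {X Y Z : P.I → Type} {W : Type}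

/-- Every leaf decoration satisfies `Q`. -/
def AllLeaf (Q : ∀ i, X i → Prop) : {i : P.I} → DTree P C X i → Prop
  | _, leaf x => Q _ x
  | _, node _ _ f => ∀ e, AllLeaf Q (f e)

/-- Every dot decoration satisfies `Q`. -/
def AllNode (Q : ∀ x, C x → Prop) : {i : P.I} → DTree P C X i → Prop
  | _, leaf _ => True
  | _, node _ c f => Q _ c ∧ ∀ e, AllNode Q (f e)

/-- The union of the sets `l c` of the dot decorations and the sets `m x` of the leaf
decorations. -/
def supp (l : ∀ x, C x → Set W) (m : ∀ i, X i → Set W) : {i : P.I} → DTree P C X i → Set W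
  | _, leaf x => m _ x
  | _, node _ c f => l _ c ∪ ⋃ e, supp l m (f e)

/-- The sets `l c` and `m x` attached to the vertices are pairwise disjoint. -/
def Disj (l : ∀ x, C x → Set W) (m : ∀ i, X i → Set W) : {i : P.I} → DTree P C X i → Prop
  | _, leaf _ => True
  | _, node _ c f => (∀ e, Disjoint (l _ c) (supp l m (f e))) ∧
      (∀ e e', e ≠ e' → Disjoint (supp l m (f e)) (supp l m (f e'))) ∧ ∀ e, Disj l m (f e)

theorem supp_map (l : ∀ x, C x → Set W) (m : ∀ i, Y i → Set W) (g : ∀ i, X i → Y i) {i : P.I}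
    (T : DTree P C X i) : supp l m (T.map g) = supp l (fun i x => m i (g i x)) T := by
  induction T with
  | leaf x => rfl
  | node b c f ih => simp [map, supp, ih]

theorem supp_graft (l : ∀ x, C x → Set W) (m : ∀ i, X i → Set W) {i : P.I}
    (T : DTree P C (DTree P C X) i) : supp l m T.graft = supp l (fun _ => supp l m) T := by
  induction T with
  | leaf x => rfl
  | node b c f ih => simp [graft, supp, ih]

theorem supp_eq_union (l : ∀ x, C x → Set W) (m : ∀ i, X i → Set W) {i : P.I}
    (T : DTree P C X i) :
    supp l m T = supp l (fun _ _ => ∅) T ∪ supp (fun _ _ => ∅) m T := by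
  induction T with
  | leaf x => simp [supp]
  | node b c f ih =>
    simp only [supp, Set.empty_union]
    rw [Set.iUnion_congr ih, Set.iUnion_union_distrib, Set.union_assoc]

theorem allLeaf_iff_supp (m : ∀ i, X i → Set W) (w : W) {i : P.I} (T : DTree P C X i) :
    AllLeaf (fun i x => w ∉ m i x) T ↔ w ∉ supp (fun _ _ => ∅) m T := by
  induction T with
  | leaf x => rfl
  | node b c f ih => simp [supp, AllLeaf, ih]

theorem allNode_iff_supp (l : ∀ x, C x → Set W) (w : W) {i : P.I} (T : DTree P C X i) :
    AllNode (fun i x => w ∉ l i x) T ↔ w ∉ supp l (fun _ _ => ∅) T := by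
  induction T with
  | leaf x => simp [supp, AllNode]
  | node b c f ih => simp [supp, AllNode, ih]

theorem AllLeaf.mono {Q Q' : ∀ i, X i → Prop} (h : ∀ i x, Q i x → Q' i x) {i : P.I}
    {T : DTree P C X i} (hT : AllLeaf Q T) : AllLeaf Q' T := by
  induction T with
  | leaf x => exact h _ _ hT
  | node b c f ih => exact fun e => ih e (hT e)

theorem AllNode.mono {Q Q' : ∀ i, C i → Prop} (h : ∀ i x, Q i x → Q' i x) {i : P.I}
    {T : DTree P C X i} (hT : AllNode Q T) : AllNode Q' T := by
  induction T with
  | leaf x => trivial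
  | node b c f ih => exact ⟨h _ _ hT.1, fun e => ih e (hT.2 e)⟩

theorem allNode_map (Q : ∀ x, C x → Prop) (g : ∀ i, X i → Y i) {i : P.I} (T : DTree P C X i) :
    AllNode Q (T.map g) ↔ AllNode Q T := by
  induction T with
  | leaf x => rfl
  | node b c f ih => simp [map, AllNode, ih]

theorem allNode_mapDec (Q : ∀ x, D x → Prop) (g : ∀ x, C x → D x) {i : P.I} (T : DTree P C X i) :
    AllNode Q (T.mapDec g) ↔ AllNode (fun x c => Q x (g x c)) T := by
  induction T with
  | leaf x => rfl
  | node b c f ih => simp [mapDec, AllNode, ih]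

theorem allNode_graft (Q : ∀ x, C x → Prop) {i : P.I} (T : DTree P C (DTree P C X) i) :
    AllNode Q T.graft ↔ AllNode Q T ∧ AllLeaf (fun _ => AllNode Q) T := by
  induction T with
  | leaf x => simp [graft, AllNode, AllLeaf]
  | node b c f ih => simp [graft, AllNode, AllLeaf, ih, forall_and, and_assoc]

theorem map_congr_iff (g h : ∀ i, X i → Y i) {i : P.I} (T : DTree P C X i) :
    T.map g = T.map h ↔ AllLeaf (fun i x => g i x = h i x) T := by
  induction T with
  | leaf x => simp [map, AllLeaf]
  | node b c f ih => simp [map, AllLeaf, ← ih, funext_iff]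

theorem mapDec_congr_iff (g h : ∀ i, C i → D i) {i : P.I} (T : DTree P C X i) :
    T.mapDec g = T.mapDec h ↔ AllNode (fun i x => g i x = h i x) T := by
  induction T with
  | leaf x => simp [mapDec, AllNode]
  | node b c f ih => simp [mapDec, AllNode, ← ih, funext_iff]

theorem exists_restrict {Q : ∀ i, X i → Prop} {i : P.I} (T : DTree P C X i) (h : AllLeaf Q T) :
    ∃ T' : DTree P C (fun i => {x : X i // Q i x}) i, T'.map (fun _ => Subtype.val) = T := by
  induction T with
  | leaf x => exact ⟨leaf ⟨x, h⟩, rfl⟩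
  | node b c f ih =>
    choose f' hf using fun e => ih e (h e)
    exact ⟨node b c f', congrArg (node b c) (funext hf)⟩

theorem disj_map (l : ∀ x, C x → Set W) (m : ∀ i, Y i → Set W) (g : ∀ i, X i → Y i) {i : P.I}
    (T : DTree P C X i) : Disj l m (T.map g) ↔ Disj l (fun i x => m i (g i x)) T := by
  induction T with
  | leaf x => rfl
  | node b c f ih => simp [map, Disj, ih, supp_map]

theorem disj_graft (l : ∀ x, C x → Set W) (m : ∀ i, X i → Set W) {i : P.I}
    (T : DTree P C (DTree P C X) i) :
    Disj l m T.graft ↔ Disj l (fun _ => supp l m) T ∧ AllLeaf (fun _ => Disj l m) T := by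
  induction T with
  | leaf x => simp [graft, Disj, AllLeaf]
  | node b c f ih => simp [graft, Disj, AllLeaf, ih, supp_graft, forall_and, and_assoc]

theorem supp_mono {l l' : ∀ x, C x → Set W} {m m' : ∀ i, X i → Set W}
    (hl : ∀ x c, l x c ⊆ l' x c) (hm : ∀ i x, m i x ⊆ m' i x) {i : P.I} (T : DTree P C X i) :
    supp l m T ⊆ supp l' m' T := by
  induction T with
  | leaf x => exact hm _ _
  | node b c f ih => exact Set.union_subset_union (hl _ _) (Set.iUnion_mono ih)

theorem Disj.disjoint_leaf {l : ∀ x, C x → Set W} {m : ∀ i, X i → Set W} {i : P.I}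
    {T : DTree P C X i} (h : Disj l m T) :
    Disjoint (supp l (fun _ _ => ∅) T) (supp (fun _ _ => ∅) m T) := by
  induction T with
  | leaf x => simp [supp]
  | node b c f ih =>
    have sub1 : ∀ e, supp (fun _ _ => ∅) m (f e) ⊆ supp l m (f e) := fun e =>
      supp_mono (fun _ _ => Set.empty_subset _) (fun _ _ => subset_rfl) _
    have sub2 : ∀ e, supp l (fun _ _ => ∅) (f e) ⊆ supp l m (f e) := fun e =>
      supp_mono (fun _ _ => subset_rfl) (fun _ _ => Set.empty_subset _) _
    simp only [supp, Set.empty_union, Set.disjoint_union_left, Set.disjoint_iUnion_right,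
      Set.disjoint_iUnion_left]
    intro e
    refine ⟨(h.1 e).mono_right (sub1 e), fun e' => ?_⟩
    by_cases hee : e' = e
    · subst hee; exact ih _ (h.2.2 _)
    · exact (h.2.1 e' e hee).mono (sub2 _) (sub1 _)

/-- The mark in the second component splits the leaves into two classes. Disjointness of individual
leaves thereby becomes disjointness of two supports, a form that survives contraction. -/
theorem Disj.disjoint_of_ne {l : ∀ x, C x → Set W} {m : ∀ i, X i → Set W} {i : P.I}
    (T : DTree P C (fun i => X i × Prop) i) (h : Disj l (fun i x => m i x.1) T) :
    Disjoint (supp (fun _ _ => ∅) (fun i x => {w | x.2 ∧ w ∈ m i x.1}) T)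
      (supp (fun _ _ => ∅) (fun i x => {w | ¬ x.2 ∧ w ∈ m i x.1}) T) := by
  induction T with
  | leaf x =>
    simp only [supp, Set.disjoint_left]
    rintro w ⟨h, -⟩ ⟨h', -⟩
    exact h' h
  | node b c f ih =>
    have sub : ∀ e (q : Prop → Prop), supp (fun _ _ => ∅) (fun i x => {w | q x.2 ∧ w ∈ m i x.1})
        (f e) ⊆ supp l (fun i x => m i x.1) (f e) := fun e q =>
      supp_mono (fun _ _ => Set.empty_subset _) (fun _ _ _ hw => hw.2) _
    simp only [supp, Set.empty_union, Set.disjoint_iUnion_right, Set.disjoint_iUnion_left]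
    intro e e'
    by_cases hee : e' = e
    · subst hee; exact ih _ (h.2.2 _)
    · exact (h.2.1 e' e hee).mono (sub e' id) (sub e Not)

theorem Disj.split_disjoint {l : ∀ x, C x → Set W} {m : ∀ i, X i → Set W} {i : P.I}
    {T : DTree P C X i} (h : Disj l m T) (n n' : T.split.1.Nodes) (hn : n ≠ n') :
    Disjoint (l _ (T.split.2 n)) (l _ (T.split.2 n')) := by
  have key : ∀ {i : P.I} (T : DTree P C X i) (n : T.split.1.Nodes),
      l _ (T.split.2 n) ⊆ supp l m T := by
    intro i T
    induction T with
    | leaf x => exact fun n => nomatch n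
    | node b c f ih =>
      intro n
      cases n with
      | here => exact Set.subset_union_left
      | up e n =>
        exact (ih e n).trans ((Set.subset_iUnion (fun e => supp l m (f e)) e).trans
          Set.subset_union_right)
  induction T with
  | leaf x => exact nomatch n
  | node b c f ih =>
    cases n with
    | here =>
      cases n' with
      | here => exact absurd rfl hn
      | up e n' => exact (h.1 e).mono_right (key _ n')
    | up e n =>
      cases n' with
      | here => exact ((h.1 e).mono_right (key _ n)).symm
      | up e' n' =>
        by_cases hee : e = e'
        · subst hee
          exact ih e (h.2.2 e) n n' (fun h => hn (h ▸ rfl))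
        · exact (h.2.1 e e' hee).mono (key _ n) (key _ n')

theorem allNode_iff_split (Q : ∀ x, C x → Prop) {i : P.I} (T : DTree P C X i) :
    AllNode Q T ↔ ∀ n : T.split.1.Nodes, Q _ (T.split.2 n) := by
  induction T with
  | leaf x => exact ⟨fun _ n => (nomatch n), fun _ => trivial⟩
  | node b c f ih =>
    refine ⟨fun h n => ?_, fun h => ⟨h Tree.Nodes.here,
      fun e => (ih e).2 fun n => h (Tree.Nodes.up e n)⟩⟩
    cases n with
    | here => exact h.1
    | up e n => exact (ih e).1 (h.2 e) n

theorem mem_supp_iff_split (l : ∀ x, C x → Set W) (w : W) {i : P.I} (T : DTree P C X i) :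
    w ∈ supp l (fun _ _ => ∅) T ↔ ∃ n : T.split.1.Nodes, w ∈ l _ (T.split.2 n) := by
  rw [← not_iff_not, ← allNode_iff_supp, allNode_iff_split]
  simp

end DTree

/-! ### Leaves of a tree versus inputs of its contraction. -/

namespace PolyMonad

variable {P : PolyMonad} {C D : (Σ i, P.Op i) → Type} {X Y : P.I → Type} {W : Type}

open DTree

/-- If all leaves satisfy `Q`, the tree lifts to the subtypes, and naturality of contraction gives
`Q` at the inputs. Conversely, decorating each leaf by the truth value of `Q` and decorating each
leaf by `True` give trees with the same contraction, so they agree by cartesianness. -/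
theorem allLeaf_iff_of_contractD {i : P.I} {z : DTree P.toPoly C X i} {b : P.Op i}
    {k : ∀ a : P.Ar b, X (P.src a)} (h : P.contractD z = ⟨b, k⟩) (Q : ∀ i, X i → Prop) :
    AllLeaf Q z ↔ ∀ a, Q _ (k a) := by
  constructor
  · intro hz
    obtain ⟨z', rfl⟩ := exists_restrict z hz
    rw [contractD_nat] at h
    generalize P.contractD z' = o at h
    obtain ⟨b', k'⟩ := o
    cases h
    exact fun a => (k' a).2
  · intro hk
    have h1 : P.contractD (z.map fun i x => Q i x) = ⟨b, fun _ => True⟩ := by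
      rw [contractD_nat, h]
      exact congrArg (Sigma.mk b) (funext fun a => eq_true (hk a))
    have h2 : P.contractD (z.map fun _ _ => True) = ⟨b, fun _ => True⟩ := by
      rw [contractD_nat, h]; rfl
    have h3 := (contractD_cart (X := fun _ => Prop) (Y := fun _ => Unit) (fun _ _ => ())
      (z.map fun _ _ => ()) ⟨b, fun _ => True⟩ (by rw [contractD_nat, h]; rfl)).unique (y₁ := z.map fun i x => Q i x)
        (y₂ := z.map fun _ _ => True) ⟨by rw [map_map], h1⟩ ⟨by rw [map_map], h2⟩
    exact ((map_congr_iff _ _ z).1 h3).mono fun i x h => of_eq_true h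

theorem supp_of_contractD {i : P.I} {z : DTree P.toPoly C X i} {b : P.Op i}
    {k : ∀ a : P.Ar b, X (P.src a)} (h : P.contractD z = ⟨b, k⟩) (m : ∀ i, X i → Set W) :
    supp (fun _ _ => ∅) m z = ⋃ a, m _ (k a) := by
  ext w
  rw [← not_iff_not, ← allLeaf_iff_supp, allLeaf_iff_of_contractD h]
  simp

theorem supp_of_contractD' {i : P.I} {z : DTree P.toPoly C X i} {b : P.Op i}
    {k : ∀ a : P.Ar b, X (P.src a)} (h : P.contractD z = ⟨b, k⟩) (l : ∀ x, C x → Set W)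
    (m : ∀ i, X i → Set W) : supp l m z = supp l (fun _ _ => ∅) z ∪ ⋃ a, m _ (k a) := by
  rw [supp_eq_union, supp_of_contractD h]

theorem disjoint_of_contractD {i : P.I} {z : DTree P.toPoly C X i} {b : P.Op i}
    {k : ∀ a : P.Ar b, X (P.src a)} (h : P.contractD z = ⟨b, k⟩) {l : ∀ x, C x → Set W}
    {m : ∀ i, X i → Set W} (hz : Disj l m z) (a a' : P.Ar b) (ha : a ≠ a') :
    Disjoint (m _ (k a)) (m _ (k a')) := by
  -- Mark the input `a` and no other; cartesianness lifts the marks to the leaves, where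
  -- `Disj.disjoint_of_ne` separates the marked from the unmarked ones.
  obtain ⟨z', ⟨rfl, h2⟩, -⟩ := contractD_cart (fun i (x : X i × Prop) => x.1) z
    ⟨b, fun e => (k e, e = a)⟩ h.symm
  have h3 := Disj.disjoint_of_ne z' ((disj_map _ _ _ _).1 hz)
  rw [supp_of_contractD h2, supp_of_contractD h2] at h3
  rw [Set.disjoint_left] at h3 ⊢
  exact fun w hw hw' => h3 (Set.mem_iUnion.2 ⟨a, ⟨rfl, hw⟩⟩)
    (Set.mem_iUnion.2 ⟨a', ⟨fun h => ha h.symm, hw'⟩⟩)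

/-- By naturality with respect to the map to the terminal family, the operation underlying `P.unit
x` does not depend on `x`. -/
theorem exists_arity_of_contractD_leaf {i : P.I} (x : X i) :
    ∃ k : ∀ a : P.Ar (P.unit (X := fun _ => Unit) (i := i) ()).1, X (P.src a),
      P.unit x = ⟨_, k⟩ := by
  have h := P.unit_nat (fun _ _ => ()) x
  generalize P.unit x = o at h
  obtain ⟨u, k⟩ := o
  have : u = (P.unit (X := fun _ => Unit) (i := i) ()).1 := congrArg Sigma.fst h
  subst this
  exact ⟨k, rfl⟩

theorem unit_forall {i : P.I} {x : X i} {b : P.Op i} {k : ∀ a : P.Ar b, X (P.src a)}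
    (h : P.unit x = ⟨b, k⟩) (Q : ∀ i, X i → Prop) : Q i x ↔ ∀ a, Q _ (k a) :=
  allLeaf_iff_of_contractD (C := fun _ => Unit) (z := leaf x) h Q

/-- A unit is the contraction of a tree that is a single leaf, where disjointness of the leaves is
vacuous. Attaching a non-empty set to that leaf, two different inputs would carry disjoint copies of
it. -/
theorem subsingleton_arity_unit {i : P.I} {x : X i} {b : P.Op i} {k : ∀ a : P.Ar b, X (P.src a)}
    (h : P.unit x = ⟨b, k⟩) : Subsingleton (P.Ar b) := by
  refine ⟨fun a a' => by_contra fun ha => ?_⟩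
  have := disjoint_of_contractD (C := fun _ => Unit) (z := leaf x) (W := Unit)
    (l := fun _ _ => ∅) (m := fun _ _ => Set.univ) h trivial a a' ha
  exact Set.disjoint_left.1 this (Set.mem_univ ()) (Set.mem_univ ())

theorem nonempty_arity_unit {i : P.I} {x : X i} {b : P.Op i} {k : ∀ a : P.Ar b, X (P.src a)}
    (h : P.unit x = ⟨b, k⟩) : Nonempty (P.Ar b) := by
  by_contra hn
  exact (unit_forall h fun _ _ => False).2 fun a => hn ⟨a⟩

end PolyMonad

end Opetopes

/-! ### Forests given by a parent relation, and trees whose labels represent them. -/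

namespace Opetopes

/-- When parents are unique, the ancestors of a point form a chain. -/
theorem reflTransGen_comparable {W : Type} {R : W → W → Prop}
    (hR : ∀ p p' q, R p q → R p' q → p = p') {a b c : W} (ha : Relation.ReflTransGen R a c)
    (hb : Relation.ReflTransGen R b c) :
    Relation.ReflTransGen R a b ∨ Relation.ReflTransGen R b a := by
  induction ha with
  | refl => exact Or.inr hb
  | tail h1 h2 ih =>
    rcases Relation.ReflTransGen.cases_tail hb with h | ⟨d, h3, h4⟩
    · subst h; exact Or.inl (h1.tail h2)
    · rw [hR _ _ _ h4 h2] at h3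
      exact ih h3

/-- The ancestors of `c` form a chain, and a chain without cycles contains at most one child of `p`.
Throughout, this identifies the child of a vertex through which a given vertex is reached. -/
theorem eq_of_siblings {W : Type} {R : W → W → Prop}
    (hR : ∀ p p' q, R p q → R p' q → p = p') (hA : ∀ a, ¬ Relation.TransGen R a a)
    {p a b c : W} (hpa : R p a) (hpb : R p b) (ha : Relation.ReflTransGen R a c)
    (hb : Relation.ReflTransGen R b c) : a = b := by
  have key : ∀ a b, R p a → R p b → Relation.ReflTransGen R a b → a = b := by
    intro a b hpa hpb h
    rcases Relation.ReflTransGen.cases_tail h with h | ⟨d, h3, h4⟩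
    · exact h.symm
    · rw [hR _ _ _ h4 hpb] at h3
      exact absurd (Relation.TransGen.head' hpa h3) (hA p)
  rcases reflTransGen_comparable hR ha hb with h | h
  · exact key a b hpa hpb h
  · exact (key b a hpb hpa h).symm

namespace DTree

variable {P : Poly} {X Y : P.I → Type} {W : Type}

/-- The label of the root dot. -/
def rootLabel : {i : P.I} → DTree P (fun _ => W) X i → Option W
  | _, leaf _ => none
  | _, node _ c _ => some c

/-- The labels of the dots. -/
abbrev labels {i : P.I} (T : DTree P (fun _ => W) X i) : Set W :=
  supp (fun _ c => {c}) (fun _ _ => ∅) T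

/-- The labels lie in `K`, and the dots above a dot labelled by `c` are labelled bijectively by the
`q ∈ K` with `R c q`. -/
def Represents (R : W → W → Prop) (K : Set W) : {i : P.I} → DTree P (fun _ => W) X i → Prop
  | _, leaf _ => True
  | _, node _ c f => c ∈ K ∧ (∀ e q, rootLabel (f e) = some q → R c q) ∧
      (∀ q ∈ K, R c q → ∃ e, rootLabel (f e) = some q) ∧
      (∀ e e' q, rootLabel (f e) = some q → rootLabel (f e') = some q → e = e') ∧
      ∀ e, Represents R K (f e)

/-- The labels of adjacent dots are related by `R`. -/
def AdjIn (R : W → W → Prop) : {i : P.I} → DTree P (fun _ => W) X i → Prop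
  | _, leaf _ => True
  | _, node _ c f => (∀ e q, rootLabel (f e) = some q → R c q) ∧ ∀ e, AdjIn R (f e)

theorem rootLabel_map (g : ∀ i, X i → Y i) {i : P.I} (T : DTree P (fun _ => W) X i) :
    rootLabel (T.map g) = rootLabel T := by
  cases T <;> rfl

theorem rootLabel_graft {i : P.I} (T : DTree P (fun _ => W) (DTree P (fun _ => W) X) i) {q : W}
    (h : rootLabel T = some q) : rootLabel T.graft = some q := by
  cases T with
  | leaf x => cases h
  | node b c f => exact h

theorem rootLabel_mem {i : P.I} {T : DTree P (fun _ => W) X i} {q : W}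
    (h : rootLabel T = some q) : q ∈ labels T := by
  cases T with
  | leaf x => cases h
  | node b c f => cases h; exact Or.inl rfl

theorem represents_map (R : W → W → Prop) (K : Set W) (g : ∀ i, X i → Y i) {i : P.I}
    (T : DTree P (fun _ => W) X i) : Represents R K (T.map g) ↔ Represents R K T := by
  induction T with
  | leaf x => rfl
  | node b c f ih => simp [map, Represents, rootLabel_map, ih]

theorem adjIn_map (R : W → W → Prop) (g : ∀ i, X i → Y i) {i : P.I}
    (T : DTree P (fun _ => W) X i) : AdjIn R (T.map g) ↔ AdjIn R T := by
  induction T with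
  | leaf x => rfl
  | node b c f ih => simp [map, AdjIn, rootLabel_map, ih]

/-- Only this direction is available: grafting creates new adjacencies across the leaves, about
which the two conclusions say nothing. -/
theorem AdjIn.of_graft {R : W → W → Prop} {i : P.I}
    {T : DTree P (fun _ => W) (DTree P (fun _ => W) X) i} (h : AdjIn R T.graft) :
    AdjIn R T ∧ AllLeaf (fun _ => AdjIn R) T := by
  induction T with
  | leaf x => exact ⟨trivial, h⟩
  | node b c f ih =>
    exact ⟨⟨fun e q hq => h.1 e q (rootLabel_graft _ hq), fun e => (ih e (h.2 e)).1⟩,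
      fun e => (ih e (h.2 e)).2⟩

theorem AdjIn.exists_parent {R : W → W → Prop} {i : P.I} {T : DTree P (fun _ => W) X i}
    (h : AdjIn R T) {r w : W} (hr : rootLabel T = some r) (hw : w ∈ labels T) (hwr : w ≠ r) :
    ∃ p ∈ labels T, R p w := by
  induction T generalizing r with
  | leaf x => cases hr
  | node b c f ih =>
    cases hr
    rcases hw with hw | hw
    · exact absurd hw hwr
    · obtain ⟨e, hw⟩ := Set.mem_iUnion.1 hw
      obtain ⟨q, hq⟩ : ∃ q, rootLabel (f e) = some q := by
        cases hfe : f e with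
        | leaf x => rw [hfe] at hw; exact hw.elim
        | node b' c' f' => exact ⟨_, rfl⟩
      by_cases hwq : w = q
      · subst hwq
        exact ⟨c, Or.inl rfl, h.1 e _ hq⟩
      · obtain ⟨p, hp, hpw⟩ := ih e (h.2 e) hq hw hwq
        exact ⟨p, Or.inr (Set.mem_iUnion.2 ⟨e, hp⟩), hpw⟩

theorem Represents.reflTransGen {R : W → W → Prop} {K : Set W} {i : P.I}
    {T : DTree P (fun _ => W) X i} (h : Represents R K T) {w : W} (hw : w ∈ labels T) :
    ∃ q, rootLabel T = some q ∧ Relation.ReflTransGen R q w := by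
  induction T with
  | leaf x => exact hw.elim
  | node b c f ih =>
    refine ⟨c, rfl, ?_⟩
    rcases hw with hw | hw
    · cases hw; exact .refl
    · obtain ⟨e, hw⟩ := Set.mem_iUnion.1 hw
      obtain ⟨q, hq, hqw⟩ := ih e (h.2.2.2.2 e) hw
      exact hqw.head (h.2.1 e q hq)

theorem Represents.subset {R : W → W → Prop} {K : Set W} {i : P.I}
    {T : DTree P (fun _ => W) X i} (h : Represents R K T) : labels T ⊆ K := by
  induction T with
  | leaf x => exact Set.empty_subset _
  | node b c f ih =>
    exact Set.union_subset (Set.singleton_subset_iff.2 h.1)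
      (Set.iUnion_subset fun e => ih e (h.2.2.2.2 e))

theorem Represents.closed {R : W → W → Prop} {K : Set W} {i : P.I}
    {T : DTree P (fun _ => W) X i} (h : Represents R K T) {a q : W} (ha : a ∈ labels T)
    (hq : q ∈ K) (haq : R a q) : q ∈ labels T := by
  induction T with
  | leaf x => exact ha.elim
  | node b c f ih =>
    rcases ha with ha | ha
    · cases ha
      obtain ⟨e, he⟩ := h.2.2.1 q hq haq
      exact Or.inr (Set.mem_iUnion.2 ⟨e, rootLabel_mem he⟩)
    · obtain ⟨e, ha⟩ := Set.mem_iUnion.1 ha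
      exact Or.inr (Set.mem_iUnion.2 ⟨e, ih e (h.2.2.2.2 e) ha⟩)

/-- Every label in a branch is a descendant of the label at the root of that branch. A label common
to two branches would make two siblings equal, and a recurrence of the root label would be a cycle.
-/
theorem Represents.disj {R : W → W → Prop} (hR : ∀ p p' q, R p q → R p' q → p = p')
    (hA : ∀ a, ¬ Relation.TransGen R a a) {K : Set W} {i : P.I}
    {T : DTree P (fun _ => W) X i} (h : Represents R K T) :
    Disj (fun _ c => {c}) (fun _ _ => ∅) T := by
  induction T with
  | leaf x => trivial
  | node b c f ih =>
    refine ⟨fun e => ?_, fun e e' hee => ?_, fun e => ih e (h.2.2.2.2 e)⟩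
    · rw [Set.disjoint_singleton_left]
      intro hc
      obtain ⟨q, hq, hqc⟩ := (h.2.2.2.2 e).reflTransGen hc
      exact hA c (Relation.TransGen.head' (h.2.1 e q hq) hqc)
    · rw [Set.disjoint_left]
      intro w hw hw'
      obtain ⟨q, hq, hqc⟩ := (h.2.2.2.2 e).reflTransGen hw
      obtain ⟨q', hq', hqc'⟩ := (h.2.2.2.2 e').reflTransGen hw'
      have := eq_of_siblings hR hA (h.2.1 e q hq) (h.2.1 e' q' hq') hqc hqc'
      subst this
      exact hee (h.2.2.2.1 e e' q hq hq')

end DTree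

/-! ### Predicates, supports and adjacency under substitution. -/

namespace PolyMonad

open DTree

variable {P : PolyMonad} {C : (Σ i, P.Op i) → Type} {X : P.I → Type} {W Γ : Type}

theorem allNode_fill {i : P.I} {b : P.Op i} (Q : ∀ x, C x → Prop) (T : P.PlusObj C ⟨i, b⟩)
    (k : ∀ e : P.Ar b, X (P.src e)) : AllNode Q (fill T k) ↔ AllNode Q T.1 := by
  rw [← map_fill T k, allNode_map]

theorem supp_fill {i : P.I} {b : P.Op i} (l : ∀ x, C x → Set W) (m : ∀ i, X i → Set W)
    (T : P.PlusObj C ⟨i, b⟩) (k : ∀ e : P.Ar b, X (P.src e)) :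
    supp l m (fill T k) = supp l (fun _ _ => ∅) T.1 ∪ ⋃ a, m _ (k a) := by
  rw [supp_of_contractD' (contractD_fill T k), ← map_fill T k, supp_map]

theorem allNode_subst (Q : ∀ x, C x → Prop) {i : P.I} (T : DTree P.toPoly (P.PlusObj C) X i) :
    AllNode Q (subst T) ↔ AllNode (fun _ S => AllNode Q S.1) T := by
  induction T with
  | leaf x => rfl
  | node b S f ih =>
    rw [subst, allNode_graft, allNode_fill, allLeaf_iff_of_contractD (contractD_fill S _)]
    simp only [AllNode, ih]

theorem supp_subst (l : ∀ x, C x → Set W) (m : ∀ i, X i → Set W) {i : P.I}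
    (T : DTree P.toPoly (P.PlusObj C) X i) :
    supp l m (subst T) = supp (fun _ S => supp l (fun _ _ => ∅) S.1) m T := by
  induction T with
  | leaf x => rfl
  | node b S f ih => simp only [subst, supp_graft, supp_fill, supp, ih]

/-- In the substituted tree the labels of `S` sit at the dots and those of the branches at the
grafted leaves. `Disj.disjoint_leaf` separates `S` from the branches, and `disjoint_of_contractD`
separates branches over different inputs. -/
theorem Disj.of_subst {l : ∀ x, C x → Set W} {m : ∀ i, X i → Set W} {i : P.I}
    {T : DTree P.toPoly (P.PlusObj C) X i} (h : Disj l m (subst T)) :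
    Disj (fun _ S => supp l (fun _ _ => ∅) S.1) m T := by
  induction T with
  | leaf x => trivial
  | node b S f ih =>
    rw [subst, disj_graft, allLeaf_iff_of_contractD (contractD_fill S _)] at h
    have h1 := h.1.disjoint_leaf
    rw [supp_of_contractD (contractD_fill S _)] at h1
    have h2 := disjoint_of_contractD (contractD_fill S _) h.1
    have h3 := supp_fill l (fun _ _ => ∅) S fun e => subst (f e)
    simp only [Set.iUnion_empty, Set.union_empty] at h3
    rw [h3] at h1
    refine ⟨fun e => ?_, fun e e' he => ?_, fun e => ih e (h.2 e)⟩
    · rw [← supp_subst]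
      exact h1.mono_right (Set.subset_iUnion (fun a => supp l m (subst (f a))) e)
    · rw [← supp_subst, ← supp_subst]
      exact h2 e e' he

theorem AdjIn.of_subst {R : W → W → Prop} {i : P.I}
    {T : DTree P.toPoly (P.PlusObj fun _ => W) X i} (h : AdjIn R (subst T)) :
    AllNode (fun _ S => AdjIn R S.1) T := by
  induction T with
  | leaf x => trivial
  | node b S f ih =>
    obtain ⟨h1, h2⟩ := AdjIn.of_graft h
    rw [allLeaf_iff_of_contractD (contractD_fill S _)] at h2
    refine ⟨?_, fun e => ih e (h2 e)⟩
    change AdjIn R S.1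
    rwa [← map_fill S fun e => subst (f e), adjIn_map]

/-! ### Clusters of a coloured tree -/

/-- A tree as a tree that contracts to its contraction. -/
def closeObj {i : P.I} (H : DTree P.toPoly C X i) : P.PlusObj C ⟨i, (P.contractD H).1⟩ :=
  ⟨H.map fun _ _ => (), by rw [contractD_nat]; rfl⟩

/-- Make a tree with decorated leaves into one dot, on which the decorations are grafted. -/
def close {i : P.I} (H : DTree P.toPoly C (DTree P.toPoly (P.PlusObj C) X) i) :
    DTree P.toPoly (P.PlusObj C) X i :=
  .node (P.contractD H).1 (closeObj H) (P.contractD H).2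

/-- Undoing a closed dot returns `H` itself with its grafted decorations, because `H` is the unique
filling of `closeObj H` by its own leaf decorations. -/
theorem subst_close {i : P.I} (H : DTree P.toPoly C (DTree P.toPoly (P.PlusObj C) X) i) :
    subst (close H) = (H.map fun _ => subst).graft := by
  change (fill (closeObj H) fun e => subst ((P.contractD H).2 e)).graft = _
  congr 1
  symm
  refine eq_fill _ _ _ ?_ ?_
  · rw [DTree.map_map]; rfl
  · rw [contractD_nat]; rfl

theorem allNode_close (Q : ∀ x, P.PlusObj C x → Prop) {i : P.I}
    (H : DTree P.toPoly C (DTree P.toPoly (P.PlusObj C) X) i) :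
    AllNode Q (close H) ↔
      Q _ (closeObj H) ∧ AllLeaf (fun _ => AllNode Q) H := by
  rw [allLeaf_iff_of_contractD (z := H) (b := (P.contractD H).1) (k := (P.contractD H).2) rfl]
  rfl

open Classical in
/-- The part of colour `c` at the bottom of a coloured tree; the rest is divided into its
monochrome parts and decorates the leaves. -/
noncomputable def cut (κ : W → Γ) : {i : P.I} → Γ → DTree P.toPoly (fun _ => W) X i →
    DTree P.toPoly (fun _ => W) (DTree P.toPoly (P.PlusObj fun _ => W) X) i
  | _, _, .leaf z => .leaf (.leaf z)
  | _, c, .node b x f =>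
      if κ x = c then .node b x fun e => cut κ c (f e)
      else .leaf (close (.node b x fun e => cut κ (κ x) (f e)))

/-- The division of a coloured tree into its monochrome parts. -/
noncomputable def clusters (κ : W → Γ) : {i : P.I} → DTree P.toPoly (fun _ => W) X i →
    DTree P.toPoly (P.PlusObj fun _ => W) X i
  | _, .leaf z => .leaf z
  | _, .node b x f => close (.node b x fun e => cut κ (κ x) (f e))

theorem graft_cut (κ : W → Γ) {i : P.I} (c : Γ) (T : DTree P.toPoly (fun _ => W) X i) :
    ((cut κ c T).map fun _ => subst).graft = T := by
  induction T generalizing c with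
  | leaf x => rfl
  | node b x f ih =>
    rw [cut]
    split_ifs with h
    · exact congrArg (DTree.node b x) (funext fun e => ih e c)
    · exact (subst_close _).trans (congrArg (DTree.node (C := fun _ => W) b x) (funext fun e => ih e (κ x)))

theorem subst_clusters (κ : W → Γ) {i : P.I} (T : DTree P.toPoly (fun _ => W) X i) :
    subst (clusters κ T) = T := by
  cases T with
  | leaf x => rfl
  | node b x f =>
    exact (subst_close _).trans (congrArg (DTree.node (C := fun _ => W) b x) (funext fun e => graft_cut κ (κ x) (f e)))

theorem rootLabel_cut (κ : W → Γ) {i : P.I} (c : Γ) (T : DTree P.toPoly (fun _ => W) X i) (q : W) :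
    rootLabel (cut κ c T) = some q ↔ rootLabel T = some q ∧ κ q = c := by
  cases T with
  | leaf x => simp [cut, rootLabel]
  | node b x f =>
    rw [cut]
    split_ifs with h
    · simp only [rootLabel, Option.some.injEq]
      exact ⟨fun hq => ⟨hq, hq ▸ h⟩, fun hq => hq.1⟩
    · simp only [rootLabel, Option.some.injEq]
      exact ⟨fun hq => (nomatch hq), fun hq => absurd (hq.1 ▸ hq.2) h⟩

/-- The labels of a monochrome part are represented bijectively, and nothing below its root dot has
its colour. -/
def IsCluster (R : W → W → Prop) (K : Set W) (κ : W → Γ) {x : Σ i, P.Op i}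
    (S : P.PlusObj (fun _ => W) x) : Prop :=
  ∃ t ∈ K, rootLabel S.1 = some t ∧ Represents R {w | w ∈ K ∧ κ w = κ t} S.1 ∧
    ∀ p ∈ K, R p t → κ p ≠ κ t

/-- A new part begins only where the colour changes, so its root cannot have a parent of its own
colour. The hypothesis `hc` carries this information upwards in the induction, since at the root of
a branch the parent lies outside the branch. -/
theorem isCluster_cut {R : W → W → Prop} (hR : ∀ p p' q, R p q → R p' q → p = p') {K : Set W}
    (κ : W → Γ) {i : P.I} {T : DTree P.toPoly (fun _ => W) X i} (hT : Represents R K T) (c : Γ)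
    (hc : ∀ q, rootLabel T = some q → κ q ≠ c → ∀ p ∈ K, R p q → κ p ≠ κ q) :
    Represents R {w | w ∈ K ∧ κ w = c} (cut κ c T) ∧
      AllLeaf (fun _ => AllNode fun _ => IsCluster R K κ) (cut κ c T) := by
  induction T generalizing c with
  | leaf x => exact ⟨trivial, trivial⟩
  | node b x f ih =>
    obtain ⟨h1, h2, h3, h4, h5⟩ := hT
    have key : ∀ d, κ x = d → Represents R {w | w ∈ K ∧ κ w = d}
          (.node (P := P.toPoly) (C := fun _ => W) b x fun e => cut κ d (f e)) ∧
        AllLeaf (fun _ => AllNode fun _ => IsCluster R K κ)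
          (.node (P := P.toPoly) (C := fun _ => W) b x fun e => cut κ d (f e)) := by
      intro d hd
      -- By uniqueness of parents, the only possible parent of the root label `q` of a branch is
      -- `x`, whose colour is `d`.
      have ih' := fun e => ih e (h5 e) d fun q hq hqd p hp hpq => by
        rw [hR p x q hpq (h2 e q hq), hd]
        exact hqd.symm
      refine ⟨⟨⟨h1, hd⟩, fun e q hq => h2 e q ((rootLabel_cut _ _ _ _).1 hq).1, ?_, ?_,
        fun e => (ih' e).1⟩, fun e => (ih' e).2⟩
      · rintro q ⟨hq, hqd⟩ hxq
        obtain ⟨e, he⟩ := h3 q hq hxq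
        exact ⟨e, (rootLabel_cut _ _ _ _).2 ⟨he, hqd⟩⟩
      · exact fun e e' q hq hq' => h4 e e' q ((rootLabel_cut _ _ _ _).1 hq).1
          ((rootLabel_cut _ _ _ _).1 hq').1
    rw [cut]
    split_ifs with h
    · exact key c h
    · refine ⟨trivial, (allNode_close _ _).2 ⟨⟨x, h1, rfl, ?_, hc x rfl h⟩, (key _ rfl).2⟩⟩
      exact (represents_map _ _ _ _).2 (key _ rfl).1

theorem isCluster_clusters {R : W → W → Prop} (hR : ∀ p p' q, R p q → R p' q → p = p')
    {K : Set W} (κ : W → Γ) {i : P.I} {T : DTree P.toPoly (fun _ => W) X i}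
    (hT : Represents R K T) (hr : ∀ q, rootLabel T = some q → ∀ p ∈ K, ¬ R p q) :
    AllNode (fun _ => IsCluster R K κ) (clusters κ T) := by
  cases T with
  | leaf x => trivial
  | node b x f =>
    classical
    have hr := hr x rfl
    have := isCluster_cut hR κ (T := .node b x f) hT (κ x) fun q hq hqc p hp hpq => by
      cases hq
      exact absurd hpq (hr p hp)
    rw [cut, if_pos rfl] at this
    exact (allNode_close _ _).2 ⟨⟨x, hT.1, rfl, (represents_map _ _ _ _).2 this.1,
      fun p hp hpx => absurd hpx (hr p hp)⟩, this.2⟩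

/-! ### Uniqueness of the division into monochrome parts -/

/-- The label of the root dot of the tree decorating the root dot. -/
def innerRootLabel : {i : P.I} → DTree P.toPoly (P.PlusObj fun _ => W) X i → Option W
  | _, .leaf _ => none
  | _, .node _ S _ => rootLabel S.1

/-- The decorating trees are non-trivial and monochrome, with different colours at adjacent
dots. -/
def IsDivision (κ : W → Γ) : {i : P.I} → DTree P.toPoly (P.PlusObj fun _ => W) X i → Prop
  | _, .leaf _ => True
  | _, .node _ S f => ∃ t, rootLabel S.1 = some t ∧
      AllNode (fun _ (w : W) => κ w = κ t) S.1 ∧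
      (∀ e t', innerRootLabel (f e) = some t' → κ t' ≠ κ t) ∧ ∀ e, IsDivision κ (f e)

theorem rootLabel_fill {i : P.I} {b : P.Op i} (T : P.PlusObj (fun _ => W) ⟨i, b⟩)
    (k : ∀ e : P.Ar b, X (P.src e)) : rootLabel (fill T k) = rootLabel T.1 := by
  rw [← map_fill T k, rootLabel_map]

theorem IsDivision.rootLabel_subst {κ : W → Γ} {i : P.I}
    {y : DTree P.toPoly (P.PlusObj fun _ => W) X i} (h : IsDivision κ y) :
    rootLabel (subst y) = innerRootLabel y := by
  cases y with
  | leaf x => rfl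
  | node b S f =>
    obtain ⟨t, ht, -⟩ := h
    refine (rootLabel_graft _ ((rootLabel_fill S _).trans ht)).trans ht.symm

/-- The border between the lower tree and the trees grafted on it can be read off from the result:
going up from the root, it lies where the colour `c` first stops. -/
theorem graft_injective_of_colour {κ : W → Γ} (c : Γ) {i : P.I}
    {H H' : DTree P.toPoly (fun _ => W) (DTree P.toPoly (fun _ => W) X) i}
    (h1 : AllNode (fun _ w => κ w = c) H) (h1' : AllNode (fun _ w => κ w = c) H')
    (h2 : AllLeaf (fun _ L => ∀ t, rootLabel L = some t → κ t ≠ c) H)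
    (h2' : AllLeaf (fun _ L => ∀ t, rootLabel L = some t → κ t ≠ c) H')
    (h : H.graft = H'.graft) : H = H' := by
  induction H with
  | leaf L =>
    cases H' with
    | leaf L' => exact congrArg DTree.leaf h
    | node b x f => exact absurd h1'.1 (h2 x (congrArg rootLabel h))
  | node b x f ih =>
    cases H' with
    | leaf L' => exact absurd h1.1 (h2' x (congrArg rootLabel h.symm))
    | node b' x' f' =>
      simp only [DTree.graft, DTree.node.injEq] at h
      obtain ⟨rfl, h3, h4⟩ := h
      obtain rfl := eq_of_heq h3
      have h4 := fun e => congrFun (eq_of_heq h4) e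
      exact congrArg (DTree.node b x) (funext fun e =>
        ih e (h1.2 e) (h1'.2 e) (h2 e) (h2' e) (h4 e))

/-- The root colour fixes the bottom part through `graft_injective_of_colour`; the rest follows by
induction on the branches. -/
theorem IsDivision.eq_of_subst_eq {κ : W → Γ} {i : P.I}
    {y y' : DTree P.toPoly (P.PlusObj fun _ => W) X i} (h : IsDivision κ y) (h' : IsDivision κ y')
    (hs : subst y = subst y') : y = y' := by
  induction y with
  | leaf x =>
    cases y' with
    | leaf x' => exact congrArg DTree.leaf (DTree.leaf.inj hs)
    | node b S f =>
      obtain ⟨t, ht, -⟩ := id h'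
      have := h'.rootLabel_subst
      rw [← hs] at this
      cases this.trans ht
  | node b S f ih =>
    cases y' with
    | leaf x' =>
      obtain ⟨t, ht, -⟩ := id h
      have := h.rootLabel_subst
      rw [hs] at this
      cases this.trans ht
    | node b' S' f' =>
      have hr := h.rootLabel_subst
      have hr' := h'.rootLabel_subst
      obtain ⟨t, ht, h1, h2, h3⟩ := h
      obtain ⟨t', ht', h1', h2', h3'⟩ := h'
      rw [hs, hr'] at hr
      obtain rfl : t' = t := Option.some.inj (ht'.symm.trans (hr.trans ht))
      have hH := graft_injective_of_colour (κ t') ((allNode_fill _ S _).2 h1)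
        ((allNode_fill _ S' _).2 h1')
        ((allLeaf_iff_of_contractD (contractD_fill S _) _).2 fun a q hq =>
          h2 a q ((h3 a).rootLabel_subst.symm.trans hq))
        ((allLeaf_iff_of_contractD (contractD_fill S' _) _).2 fun a q hq =>
          h2' a q ((h3' a).rootLabel_subst.symm.trans hq)) hs
      -- Contracting the equal filled trees recovers the operation at the root and the branches
      -- simultaneously.
      have hc := (contractD_fill S _).symm.trans ((congrArg P.contractD hH).trans
        (contractD_fill S' _))
      have hb : b = b' := congrArg Sigma.fst hc
      subst hb
      have hS : S = S' := Subtype.ext (by rw [← map_fill S, hH, map_fill])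
      subst hS
      have hf := congrFun (eq_of_heq (Sigma.ext_iff.1 hc).2)
      exact congrArg (DTree.node b S) (funext fun e => ih e (h3 e) (h3' e) (hf e))

theorem exists_rootLabel_of_innerRootLabel {i : P.I}
    {y : DTree P.toPoly (P.PlusObj fun _ => W) X i} {t : W} (h : innerRootLabel y = some t) :
    ∃ n : y.split.1.Nodes, rootLabel (y.split.2 n).1 = some t := by
  cases y with
  | leaf x => cases h
  | node b S f => exact ⟨Tree.Nodes.here, h⟩

/-- Pairwise different colours at all dots are more than enough: a division only needs different
colours at adjacent dots. -/
theorem IsDivision.of_injective {κ : W → Γ} {i : P.I}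
    {y : DTree P.toPoly (P.PlusObj fun _ => W) X i} (γ : y.split.1.Nodes → Γ)
    (hγ : Function.Injective γ)
    (h : ∀ n, (∃ t, rootLabel (y.split.2 n).1 = some t) ∧
      AllNode (fun _ (w : W) => κ w = γ n) (y.split.2 n).1) : IsDivision κ y := by
  have key : ∀ {x : Σ i, P.Op i} (S : P.PlusObj (fun _ => W) x) (t : W) (c : Γ),
      rootLabel S.1 = some t → AllNode (fun _ (w : W) => κ w = c) S.1 → κ t = c := by
    rintro x ⟨S, hS⟩ t c h1 h2
    cases S with
    | leaf x => cases h1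
    | node b x f => cases h1; exact h2.1
  induction y with
  | leaf x => trivial
  | node b S f ih =>
    obtain ⟨⟨t, ht⟩, h1⟩ := h Tree.Nodes.here
    have hc := key S t _ ht h1
    refine ⟨t, ht, h1.mono fun _ w hw => hw.trans hc.symm, fun e t' ht' => ?_, fun e => ?_⟩
    · obtain ⟨n, hn⟩ := exists_rootLabel_of_innerRootLabel ht'
      rw [key _ _ _ hn (h (Tree.Nodes.up e n)).2, hc]
      exact fun h => nomatch hγ h
    · exact ih e (fun n => γ (Tree.Nodes.up e n))
        (fun n n' hn => by have := hγ hn; cases this; rfl) fun n => h (Tree.Nodes.up e n)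

end PolyMonad

end Opetopes

/-! ### Finite rooted trees through the relation of lying immediately above. -/

namespace Opetopes

open Relation

/-- A cycle through `v` also passes through the parent of `v`, so it can be moved down to `r`, which
has no parent. -/
theorem not_transGen_of_reach {V : Type} {R : V → V → Prop} {r : V} (h0 : ∀ v, ¬ R v r)
    (h1 : ∀ p p' v, R p v → R p' v → p = p') (h2 : ∀ v, ReflTransGen R r v) (v : V) :
    ¬ TransGen R v v := by
  induction h2 v with
  | refl =>
    intro h
    obtain ⟨p, -, hp⟩ := TransGen.tail'_iff.1 h
    exact h0 _ hp
  | tail h3 h4 ih =>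
    intro h
    obtain ⟨p, hp, hp'⟩ := TransGen.tail'_iff.1 h
    rw [h1 _ _ _ hp' h4] at hp
    exact ih (TransGen.head' h4 hp)

theorem dist_iso {V V' : Type} {G : SimpleGraph V} {G' : SimpleGraph V'} (e : G ≃g G') (u v : V) :
    G'.dist (e u) (e v) = G.dist u v := by
  have key : ∀ {V V' : Type} {G : SimpleGraph V} {G' : SimpleGraph V'} (e : G ≃g G') (u v : V),
      G.Reachable u v → G'.dist (e u) (e v) ≤ G.dist u v := by
    intro V V' G G' e u v h
    obtain ⟨p, hp⟩ := h.exists_walk_length_eq_dist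
    rw [← hp, ← SimpleGraph.Walk.length_map e.toHom p]
    exact SimpleGraph.dist_le _
  by_cases h : G.Reachable u v
  · refine le_antisymm (key e u v h) ?_
    have := key e.symm (e u) (e v) (h.map e.toHom)
    simpa using this
  · rw [SimpleGraph.dist_eq_zero_of_not_reachable h, SimpleGraph.dist_eq_zero_of_not_reachable]
    intro h'
    have := h'.map e.symm.toHom
    apply h
    simpa using this

namespace RootedGraph

/-- `U.Ch p v`: the vertex `v` lies immediately above `p`. -/
def Ch (U : RootedGraph) (p v : U.V) : Prop :=
  U.G.Adj p v ∧ U.G.dist U.root v = U.G.dist U.root p + 1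

theorem Iso.ch_iff {U U' : RootedGraph} (e : U.Iso U') (p v : U.V) :
    U'.Ch (e p) (e v) ↔ U.Ch p v := by
  unfold Ch
  rw [← e.map_root]
  rw [dist_iso, dist_iso, e.toIso.map_adj_iff]

end RootedGraph

namespace FTree

variable (U : FTree)

theorem ch_or_ch_of_adj {p v : U.V} (h : U.G.Adj p v) : U.Ch p v ∨ U.Ch v p := by
  rcases U.isTree.isTree.dist_eq_dist_add_one_of_adj U.root h with h' | h'
  · exact Or.inr ⟨h.symm, h'⟩
  · exact Or.inl ⟨h, h'⟩

theorem adj_iff_ch {p v : U.V} : U.G.Adj p v ↔ U.Ch p v ∨ U.Ch v p :=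
  ⟨U.ch_or_ch_of_adj, fun h => h.elim (·.1) (·.1.symm)⟩

theorem not_ch_root (p : U.V) : ¬ U.Ch p U.root := fun h => by
  have := h.2
  rw [SimpleGraph.dist_self] at this
  omega

theorem exists_shortest (v : U.V) :
    ∃ p : U.G.Walk v U.root, p.length = U.G.dist U.root v := by
  obtain ⟨p, hp⟩ := U.isTree.isTree.connected.exists_walk_length_eq_dist v U.root
  exact ⟨p, hp.trans SimpleGraph.dist_comm⟩

theorem exists_shortest_of_ch {p v : U.V} (h : U.Ch p v) :
    ∃ q : U.G.Walk p U.root, (SimpleGraph.Walk.cons h.1.symm q).IsPath := by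
  obtain ⟨q, hq⟩ := U.exists_shortest p
  refine ⟨q, SimpleGraph.Walk.isPath_of_length_eq_dist _ ?_⟩
  rw [SimpleGraph.Walk.length_cons, hq, ← h.2, SimpleGraph.dist_comm]

/-- Going down from `v` through `p` or through `p'` and then along a shortest walk gives in each
case the unique path to the root, so the second vertices coincide. -/
theorem ch_unique (p p' v : U.V) (h : U.Ch p v) (h' : U.Ch p' v) : p = p' := by
  obtain ⟨q, hq⟩ := U.exists_shortest_of_ch h
  obtain ⟨q', hq'⟩ := U.exists_shortest_of_ch h'
  have := (U.isTree.isTree.existsUnique_path v U.root).unique hq hq'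
  simpa using congrArg SimpleGraph.Walk.snd this

theorem exists_ch {v : U.V} (h : v ≠ U.root) : ∃ p, U.Ch p v := by
  obtain ⟨p, hp⟩ := U.exists_shortest v
  cases p with
  | nil => exact absurd rfl h
  | cons h' q =>
    rename_i p
    refine ⟨p, (U.ch_or_ch_of_adj h'.symm).resolve_right fun h2 => ?_⟩
    have h3 := SimpleGraph.dist_le q
    rw [SimpleGraph.dist_comm] at h3
    rw [SimpleGraph.Walk.length_cons] at hp
    have := h2.2
    omega

theorem wf_ch : WellFounded U.Ch :=
  Subrelation.wf (r := InvImage (· < ·) fun v => U.G.dist U.root v)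
    (fun {a b} h => by change U.G.dist _ _ < U.G.dist _ _; rw [h.2]; omega)
    (InvImage.wf _ wellFounded_lt)

theorem reach (v : U.V) : ReflTransGen U.Ch U.root v := by
  induction v using U.wf_ch.induction with
  | _ v ih =>
    by_cases h : v = U.root
    · rw [h]
    · obtain ⟨p, hp⟩ := U.exists_ch h
      exact (ih p hp).tail hp

theorem not_transGen_ch (v : U.V) : ¬ TransGen U.Ch v v :=
  not_transGen_of_reach U.not_ch_root U.ch_unique U.reach v

theorem wf_ch_swap : WellFounded fun a b => U.Ch b a := by
  have := U.isTree.finite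
  have : Std.Irrefl (α := U.V) (fun a b => TransGen U.Ch b a) := ⟨U.not_transGen_ch⟩
  have : IsTrans U.V (fun a b => TransGen U.Ch b a) := ⟨fun a b c h h' => h'.trans h⟩
  exact Subrelation.wf (fun {a b} h => TransGen.single h)
    (Finite.wellFounded_of_trans_of_irrefl fun a b => TransGen U.Ch b a)

/-- The walk from `a` to the root through successive parents meets only vertices below `a`.
Conversely, every walk contains the unique path, and that path runs through all of them. -/
theorem le_iff (a b : U.V) : U.le a b ↔ ReflTransGen U.Ch b a := by
  constructor
  · intro h
    obtain ⟨p, hp⟩ : ∃ p : U.G.Walk a U.root, ∀ x ∈ p.support, ReflTransGen U.Ch x a := by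
      clear h
      induction U.reach a with
      | refl => exact ⟨.nil, by simp [ReflTransGen.refl]⟩
      | tail h1 h2 ih =>
        obtain ⟨p, hp⟩ := ih
        refine ⟨.cons h2.1.symm p, fun x hx => ?_⟩
        rw [SimpleGraph.Walk.support_cons, List.mem_cons] at hx
        rcases hx with rfl | hx
        · exact .refl
        · exact (hp x hx).tail h2
    exact hp b (h p)
  · intro h
    classical
    induction h with
    | refl => exact fun p => p.start_mem_support
    | tail h1 h2 ih =>
      intro p
      obtain ⟨q, hq⟩ := U.exists_shortest_of_ch h2
      have h3 := (U.isTree.isTree.existsUnique_path _ _).unique hq p.bypass_isPath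
      have h4 := SimpleGraph.Walk.support_bypass_subset_support p
      rw [← h3] at h4
      exact h4 (by
        rw [SimpleGraph.Walk.support_cons]
        exact List.mem_cons_of_mem _ (ih q))

/-- The vertex of `K` nearest to the root is its lowest vertex. A walk inside `K` can go down only
by retracing its last upward step, since parents are unique, so every vertex of `K` is reached from
the lowest one by going up within `K`. -/
theorem isKernel_iff (K : Set U.V) : U.IsKernel K ↔
    K ⊆ U.dots ∧ ∃ r ∈ K, ∀ k ∈ K, k ≠ r → ∃ p ∈ K, U.Ch p k := by
  refine and_congr_right fun _ => ⟨fun h => ?_, ?_⟩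
  · have hwf := InvImage.wf (fun v : K => U.G.dist U.root v) wellFounded_lt
    have := h.nonempty
    obtain ⟨r, -, hr⟩ := hwf.has_min Set.univ Set.univ_nonempty
    have key : ∀ k : K, ReflTransGen (fun a b : K => U.Ch a b) r k := by
      intro k
      have ⟨p⟩ := h.preconnected r k
      suffices H : ∀ {a b : K} (p : (U.G.induce K).Walk a b),
          ReflTransGen (fun a b : K => U.Ch a b) r a → ReflTransGen (fun a b : K => U.Ch a b) r b
        from H p .refl
      intro a b p
      induction p with
      | nil => exact id
      | cons hadj q ih =>
        intro ha
        refine ih ?_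
        rcases U.ch_or_ch_of_adj (SimpleGraph.induce_adj.1 hadj) with hc | hc
        · exact ha.tail hc
        -- A downward step from `r` itself would contradict minimality of the distance; from any
        -- other vertex it leads back to the vertex visited before.
        · rcases ReflTransGen.cases_tail ha with h' | ⟨d, h3, h4⟩
          · subst h'
            rename_i v _
            refine absurd ?_ (hr v (Set.mem_univ _))
            change U.G.dist _ _ < U.G.dist _ _
            rw [hc.2]
            omega
          · have := Subtype.ext (U.ch_unique _ _ _ h4 hc)
            rwa [this] at h3
    refine ⟨r, r.2, fun k hk hkr => ?_⟩
    rcases ReflTransGen.cases_tail (key ⟨k, hk⟩) with h' | ⟨d, h3, h4⟩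
    · exact absurd (congrArg Subtype.val h') hkr
    · exact ⟨d, d.2, h4⟩
  · rintro ⟨r, hr, h⟩
    rw [SimpleGraph.connected_iff_exists_forall_reachable]
    refine ⟨⟨r, hr⟩, fun ⟨k, hk⟩ => ?_⟩
    induction k using U.wf_ch.induction with
    | _ k ih =>
      by_cases hkr : k = r
      · subst hkr; rfl
      · obtain ⟨p, hp, hpk⟩ := h k hk hkr
        refine (ih p hpk hp).trans (SimpleGraph.Adj.reachable ?_)
        exact SimpleGraph.induce_adj.2 hpk.1

theorem valence_root : U.valence U.root = {w | U.Ch U.root w}.ncard := by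
  unfold RootedGraph.valence
  congr 1
  ext w
  rw [SimpleGraph.mem_neighborSet, U.adj_iff_ch, Set.mem_ofPred_eq, or_iff_left (U.not_ch_root w)]

/-- The extra 1 counts the edge to the parent. -/
theorem valence_of_ne_root {v : U.V} (hv : v ≠ U.root) :
    U.valence v = {w | U.Ch v w}.ncard + 1 := by
  have := U.isTree.finite
  obtain ⟨p, hp⟩ := U.exists_ch hv
  have h : U.G.neighborSet v = insert p {w | U.Ch v w} := by
    ext w
    rw [SimpleGraph.mem_neighborSet, U.adj_iff_ch, Set.mem_insert_iff, Set.mem_ofPred_eq, or_comm]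
    exact or_congr_left ⟨fun h => U.ch_unique _ _ _ h hp, fun h => h ▸ hp⟩
  unfold RootedGraph.valence
  rw [h, Set.ncard_insert_of_notMem]
  exact fun h : U.Ch v p => U.not_transGen_ch v ((TransGen.single h).tail hp)

theorem ne_root_of_dot {v : U.V} (hv : v ∈ U.dots) : v ≠ U.root :=
  fun h => hv (h ▸ U.isTree.root_mem)

theorem not_ch_of_bdry {v : U.V} (hv : v ∈ U.bdry) (hr : v ≠ U.root) (w : U.V) : ¬ U.Ch v w := by
  have := U.isTree.finite
  have h := U.isTree.valence_bdry v hv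
  rw [U.valence_of_ne_root hr, Nat.add_eq_right, Set.ncard_eq_zero] at h
  exact fun hw => (h ▸ hw : w ∈ (∅ : Set U.V))

theorem exists_root_ch : ∃ c, U.Ch U.root c ∧ ∀ c', U.Ch U.root c' → c' = c := by
  have h := U.isTree.valence_bdry _ U.isTree.root_mem
  rw [U.valence_root, Set.ncard_eq_one] at h
  obtain ⟨c, hc⟩ := h
  exact ⟨c, (hc ▸ rfl : c ∈ {w | U.Ch U.root w}), fun c' hc' => (hc ▸ hc' : c' ∈ ({c} : Set U.V))⟩

theorem mem_nullDots_iff (v : U.V) : v ∈ U.nullDots ↔ v ∈ U.dots ∧ ∀ w, ¬ U.Ch v w := by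
  have := U.isTree.finite
  refine and_congr_right fun hv => ?_
  rw [U.valence_of_ne_root (U.ne_root_of_dot hv), Nat.add_eq_right, Set.ncard_eq_zero,
    Set.eq_empty_iff_forall_notMem]
  rfl

theorem valence_eq_two_iff {v : U.V} (hv : v ∈ U.dots) :
    U.valence v = 2 ↔ ∃ c, U.Ch v c ∧ ∀ c', U.Ch v c' → c' = c := by
  rw [U.valence_of_ne_root (U.ne_root_of_dot hv), 
    show (_ + 1 = 2 ↔ _ = 1) from Nat.add_left_inj (n := 1) (k := 1), Set.ncard_eq_one]
  refine exists_congr fun c => ?_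
  rw [Set.eq_singleton_iff_unique_mem]
  rfl

end FTree

/-! ### The tree generated by a parent relation. -/

section FromRel

variable {V : Type} {R : V → V → Prop} {r : V}

theorem fromRel_adj_iff (h0 : ∀ v, ¬ R v r)
    (h1 : ∀ p p' v, R p v → R p' v → p = p') (h2 : ∀ v, ReflTransGen R r v) (a b : V) :
    (SimpleGraph.fromRel R).Adj a b ↔ R a b ∨ R b a := by
  rw [SimpleGraph.fromRel_adj]
  refine and_iff_right_of_imp ?_
  rintro h rfl
  exact not_transGen_of_reach h0 h1 h2 a (TransGen.single (h.elim id id))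

/-- The graph is connected, and each edge joins a vertex other than `r` to its parent. So there are
at most as many edges as vertices different from `r`, which forces a tree. -/
theorem isTree_fromRel [Finite V] (h0 : ∀ v, ¬ R v r)
    (h1 : ∀ p p' v, R p v → R p' v → p = p') (h2 : ∀ v, ReflTransGen R r v) :
    (SimpleGraph.fromRel R).IsTree := by
  have hc : (SimpleGraph.fromRel R).Connected := by
    rw [SimpleGraph.connected_iff_exists_forall_reachable]
    refine ⟨r, fun v => ?_⟩
    induction h2 v with
    | refl => rfl
    | tail h3 h4 ih =>
      exact ih.trans ((fromRel_adj_iff h0 h1 h2 _ _).2 (Or.inl h4)).reachable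
  rw [SimpleGraph.isTree_iff_connected_and_card]
  refine ⟨hc, le_antisymm ?_ hc.card_vert_le_card_edgeSet_add_one⟩
  have hpar : ∀ v : {v // v ≠ r}, ∃ p, R p v := fun v => by
    rcases ReflTransGen.cases_tail (h2 v) with h | ⟨p, -, hp⟩
    · exact absurd h v.2
    · exact ⟨p, hp⟩
  choose par hpar using hpar
  let φ : {v // v ≠ r} → (SimpleGraph.fromRel R).edgeSet := fun v =>
    ⟨s(par v, v), (fromRel_adj_iff h0 h1 h2 _ _).2 (Or.inl (hpar v))⟩
  have hφ : Function.Surjective φ := by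
    rintro ⟨e, he⟩
    induction e using Sym2.ind with
    | _ a b =>
      have hne : ∀ {a b}, R a b → b ≠ r := fun h hb => h0 _ (hb ▸ h)
      rcases (fromRel_adj_iff h0 h1 h2 _ _).1 he with h | h
      · exact ⟨⟨b, hne h⟩, Subtype.ext (by
          change s(par _, b) = _; rw [h1 _ _ _ (hpar ⟨b, hne h⟩) h])⟩
      · exact ⟨⟨a, hne h⟩, Subtype.ext (by
          change s(par _, a) = _; rw [h1 _ _ _ (hpar ⟨a, hne h⟩) h, Sym2.eq_swap])⟩
  have h3 := Nat.card_le_card_of_surjective φ hφ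
  have h4 : Nat.card {v // v ≠ r} + 1 = Nat.card V := by
    have h5 := Set.ncard_add_ncard_compl ({r} : Set V)
    rw [Set.ncard_singleton] at h5
    rw [← h5, add_comm, ← Nat.card_coe_set_eq]
    rfl
  omega

/-- Each related pair is an edge, so only its direction by distance is in question. By induction
from the root: if the edge from `a` to `d` went down, then `d` would be the parent of `a` by
distance and hence also by `R`, giving a cycle of length two. -/
theorem ch_fromRel (U : FTree) {R : U.V → U.V → Prop} (hG : U.G = SimpleGraph.fromRel R)
    (h0 : ∀ v, ¬ R v U.root) (h1 : ∀ p p' v, R p v → R p' v → p = p')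
    (h2 : ∀ v, ReflTransGen R U.root v) (a b : U.V) : U.Ch a b ↔ R a b := by
  have key : ∀ b, ∀ a, R a b → U.Ch a b := by
    intro b
    induction h2 b with
    | refl => exact fun a h => absurd h (h0 a)
    | tail h3 h4 ih =>
      rename_i c d
      intro a ha
      obtain rfl := h1 _ _ _ ha h4
      have hadj : U.G.Adj a d := by rw [hG]; exact (fromRel_adj_iff h0 h1 h2 _ _).2 (Or.inl ha)
      refine (U.ch_or_ch_of_adj hadj).resolve_right fun h => ?_
      rcases ReflTransGen.cases_tail h3 with h' | ⟨p, -, hp⟩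
      · exact U.not_ch_root _ (h' ▸ h)
      · have := U.ch_unique _ _ _ (ih p hp) h
        subst this
        exact not_transGen_of_reach h0 h1 h2 _ ((TransGen.single ha).tail hp)
  refine ⟨fun h => ?_, key b a⟩
  rcases ReflTransGen.cases_tail (h2 b) with h' | ⟨p, -, hp⟩
  · exact absurd (h' ▸ h) (U.not_ch_root a)
  · rwa [U.ch_unique _ _ _ h (key b p hp)]

end FromRel

end Opetopes

/-! ### The underlying tree of a `P`-tree. -/

namespace Opetopes

open Relation

namespace Tree

variable {P : Poly} {X : P.I → Type} {V V' : Type}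

/-- Decorate the dots and the leaves of a tree by the values of a function on the vertices. -/
def labelled : {i : P.I} → (T : Tree P X i) → (T.Verts → V) →
    DTree P (fun _ => V) (fun _ => V) i
  | _, leaf _, g => .leaf (g (.inr .here))
  | _, node b f, g => .node b (g (.inl .here)) fun e => labelled (f e) fun v => g (upVert e v)

theorem verts_cases {i : P.I} {b : P.Op i} {f : ∀ e : P.Ar b, Tree P X (P.src e)}
    (v : (node b f).Verts) : v = .inl .here ∨ ∃ e v', v = upVert e v' := by
  rcases v with n | l
  · cases n with
    | here => exact Or.inl rfl
    | up e n => exact Or.inr ⟨e, .inl n, rfl⟩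
  · cases l with
    | up e l => exact Or.inr ⟨e, .inr l, rfl⟩

theorem upVert_injective {i : P.I} {b : P.Op i} {f : ∀ e : P.Ar b, Tree P X (P.src e)}
    (e : P.Ar b) : Function.Injective (upVert (f := f) e) := by
  rintro (n | l) (n' | l') h
  · have := Sum.inl.inj h; cases this; rfl
  · cases h
  · cases h
  · have := Sum.inr.inj h; cases this; rfl

theorem upVert_ne_here {i : P.I} {b : P.Op i} {f : ∀ e : P.Ar b, Tree P X (P.src e)}
    (e : P.Ar b) (v : (f e).Verts) : upVert (f := f) e v ≠ .inl .here := by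
  rcases v with n | l <;> exact fun h => nomatch h

theorem eq_of_upVert_eq {i : P.I} {b : P.Op i} {f : ∀ e : P.Ar b, Tree P X (P.src e)}
    {e e' : P.Ar b} {v : (f e).Verts} {v' : (f e').Verts}
    (h : upVert (f := f) e v = upVert e' v') : e = e' := by
  rcases v with n | l <;> rcases v' with n' | l'
  · have := Sum.inl.inj h; cases this; rfl
  · cases h
  · cases h
  · have := Sum.inr.inj h; cases this; rfl

theorem finite_leaves {i : P.I} (T : Tree P X i) : Finite T.Leaves := by
  induction T with
  | leaf x =>
    refine @Finite.of_subsingleton _ ⟨fun l l' => ?_⟩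
    cases l; cases l'; rfl
  | node b f ih =>
    have := P.fin b
    refine Finite.of_surjective
      (fun o : Σ e : P.Ar b, (f e).Leaves => (Leaves.up o.1 o.2 : (node b f).Leaves)) ?_
    rintro ⟨e, n⟩
    exact ⟨⟨_, _⟩, rfl⟩

theorem finite_verts {i : P.I} (T : Tree P X i) : Finite T.Verts := by
  have := T.finite_nodes
  have := T.finite_leaves
  exact inferInstanceAs (Finite (T.Nodes ⊕ T.Leaves))

theorem isInput_up {i : P.I} {b : P.Op i} {f : ∀ e : P.Ar b, Tree P X (P.src e)}
    (e : P.Ar b) (n : (f e).Nodes) (v : (f e).Verts) :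
    (node b f).IsInput (.up e n) (upVert e v) ↔ (f e).IsInput n v :=
  ⟨fun ⟨_, h, h'⟩ => upVert_injective e h' ▸ h, fun h => ⟨v, h, rfl⟩⟩

theorem not_isInput_top {i : P.I} (T : Tree P X i) (n : T.Nodes) : ¬ T.IsInput n T.top := by
  cases T with
  | leaf x => exact nomatch n
  | node b f =>
    cases n with
    | here => exact fun ⟨e, h⟩ => upVert_ne_here e _ h.symm
    | up e n => exact fun ⟨v, _, h⟩ => upVert_ne_here e _ h.symm

theorem isInput_unique {i : P.I} (T : Tree P X i) {n n' : T.Nodes} {v : T.Verts}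
    (h : T.IsInput n v) (h' : T.IsInput n' v) : n = n' := by
  induction T with
  | leaf x => exact nomatch n
  | node b f ih =>
    cases n with
    | here =>
      cases n' with
      | here => rfl
      | up e n' =>
        obtain ⟨e', rfl⟩ := h
        obtain ⟨v, h1, h2⟩ := h'
        obtain rfl := eq_of_upVert_eq h2
        rw [← upVert_injective _ h2] at h1
        exact absurd h1 (not_isInput_top _ _)
    | up e n =>
      obtain ⟨v, h1, rfl⟩ := h
      cases n' with
      | here =>
        obtain ⟨e', h2⟩ := h'
        obtain rfl := eq_of_upVert_eq h2
        rw [upVert_injective _ h2] at h1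
        exact absurd h1 (not_isInput_top _ _)
      | up e' n' =>
        obtain ⟨v', h3, h4⟩ := h'
        obtain rfl := eq_of_upVert_eq h4
        rw [← upVert_injective _ h4] at h3
        rw [ih _ h1 h3]

theorem above_unique {i : P.I} (T : Tree P X i) (p p' v : Option T.Verts) (h : T.Above p v)
    (h' : T.Above p' v) : p = p' := by
  rcases v with _ | v
  · rcases p with _ | (_ | _) <;> exact h.elim
  rcases p with _ | (n | l)
  · rcases p' with _ | (n' | l')
    · rfl
    · exact absurd ((h : v = T.top) ▸ (h' : T.IsInput n' v)) (T.not_isInput_top n')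
    · exact h'.elim
  · rcases p' with _ | (n' | l')
    · exact absurd ((h' : v = T.top) ▸ (h : T.IsInput n v)) (T.not_isInput_top n)
    · rw [T.isInput_unique h h']
    · exact h'.elim
  · exact h.elim

theorem not_above_none {i : P.I} (T : Tree P X i) (p : Option T.Verts) : ¬ T.Above p none := by
  rcases p with _ | (_ | _) <;> exact id

theorem reach_top {i : P.I} (T : Tree P X i) (v : T.Verts) :
    ReflTransGen (fun a b : T.Verts => ∃ n, a = .inl n ∧ T.IsInput n b) T.top v := by
  induction T with
  | leaf x =>
    rcases v with n | l
    · exact nomatch n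
    · cases l; exact .refl
  | node b f ih =>
    rcases verts_cases v with rfl | ⟨e, v, rfl⟩
    · exact .refl
    · refine ReflTransGen.head (b := upVert e (f e).top) ⟨.here, rfl, e, rfl⟩ ?_
      refine ReflTransGen.lift (upVert e) ?_ _ _ (ih e v)
      rintro a c ⟨n, rfl, h⟩
      exact ⟨.up e n, rfl, (isInput_up e n c).2 h⟩

theorem reach_none {i : P.I} (T : Tree P X i) (v : Option T.Verts) :
    ReflTransGen T.Above none v := by
  rcases v with _ | v
  · exact .refl
  · refine ReflTransGen.head (b := some T.top) rfl (ReflTransGen.lift some ?_ _ _ (T.reach_top v))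
    rintro a b ⟨n, rfl, h⟩
    exact h

theorem graph_adj_iff {i : P.I} (T : Tree P X i) (a b : Option T.Verts) :
    T.graph.G.Adj a b ↔ T.Above a b ∨ T.Above b a :=
  fromRel_adj_iff T.not_above_none T.above_unique T.reach_none a b

/-- The underlying graph of a `P`-tree is a tree. -/
def ftree {i : P.I} (T : Tree P X i) : FTree where
  toRootedGraph := T.graph
  isTree :=
    { finite := by
        have := T.finite_verts
        exact inferInstanceAs (Finite (Option T.Verts))
      isTree := by
        have := T.finite_verts
        exact isTree_fromRel (V := Option T.Verts) T.not_above_none T.above_unique T.reach_none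
      root_mem := Or.inl rfl
      valence_bdry := by
        intro v hv
        refine Set.ncard_eq_one.2 ?_
        rcases hv with rfl | ⟨l, rfl⟩
        · refine ⟨some T.top, Set.ext fun w => ?_⟩
          refine (T.graph_adj_iff none w).trans ((or_iff_left (T.not_above_none w)).trans ?_)
          rcases w with _ | w
          · exact ⟨fun h => h.elim, fun h => nomatch h⟩
          · exact ⟨fun h => congrArg some h, fun h => Option.some.inj h⟩
        · obtain h | ⟨p, -, hp⟩ := ReflTransGen.cases_tail (T.reach_none (some (.inr l)))
          · cases h
          refine ⟨p, Set.ext fun w => ?_⟩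
          refine (T.graph_adj_iff (some (.inr l)) w).trans ((or_iff_right id).trans ?_)
          exact ⟨fun h => T.above_unique _ _ _ h hp, fun h => h ▸ hp⟩ }

theorem ch_ftree {i : P.I} (T : Tree P X i) (a b : Option T.Verts) :
    T.ftree.Ch a b ↔ T.Above a b :=
  ch_fromRel T.ftree rfl T.not_above_none T.above_unique T.reach_none a b

end Tree

/-! ### Labelled trees as `P`-tree structures on abstract trees. -/

namespace DTree

variable {P : Poly} {C : (Σ i, P.Op i) → Type} {X : P.I → Type} {V V' V'' : Type}

/-- The underlying tree. -/
def shape {i : P.I} (D : DTree P C X i) : Tr P i := (D.map fun _ _ => ()).split.1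

/-- The label of the lowest vertex other than the output vertex. -/
def vlabel : {i : P.I} → DTree P (fun _ => V) (fun _ => V) i → V
  | _, leaf x => x
  | _, node _ c _ => c

/-- Change the labels of the dots and of the leaves. -/
def relabel (h : V → V') {i : P.I} (D : DTree P (fun _ => V) (fun _ => V) i) :
    DTree P (fun _ => V') (fun _ => V') i :=
  (D.map fun _ => h).mapDec fun _ => h

theorem shape_labelled {i : P.I} (T : Tr P i) (g : T.Verts → V) : (T.labelled g).shape = T := by
  induction T with
  | leaf x => rfl
  | node b f ih => exact congrArg (Tree.node b) (funext fun e => ih e _)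

theorem shape_map {Y : P.I → Type} (h : ∀ i, X i → Y i) {i : P.I} (D : DTree P C X i) :
    (D.map h).shape = D.shape := by
  rw [shape, map_map]; rfl

theorem shape_mapDec {C' : (Σ i, P.Op i) → Type} (h : ∀ x, C x → C' x) {i : P.I}
    (D : DTree P C X i) : (D.mapDec h).shape = D.shape := by
  rw [shape, map_mapDec, split_mapDec]; rfl

theorem shape_relabel (h : V → V') {i : P.I} (D : DTree P (fun _ => V) (fun _ => V) i) :
    (D.relabel h).shape = D.shape := by
  rw [relabel, shape_mapDec, shape_map]

theorem exists_labelled {i : P.I} (D : DTree P (fun _ => V) (fun _ => V) i) :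
    ∃ g : D.shape.Verts → V, D = D.shape.labelled g := by
  induction D with
  | leaf x => exact ⟨fun _ => x, rfl⟩
  | node b c f ih =>
    choose g hg using ih
    refine ⟨fun v => match v with
      | .inl .here => c
      | .inl (.up e n) => g e (.inl n)
      | .inr (.up e l) => g e (.inr l), ?_⟩
    refine congrArg (node (C := fun _ => V) b c) (funext fun e => (hg e).trans ?_)
    congr 1
    funext v
    rcases v with n | l <;> rfl

theorem exists_labelled_of_shape {i : P.I} (D : DTree P (fun _ => V) (fun _ => V) i) {T : Tr P i}
    (h : D.shape = T) : ∃ g : T.Verts → V, D = T.labelled g := by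
  subst h
  exact D.exists_labelled

theorem relabel_labelled (h : V → V') {i : P.I} (T : Tree P X i) (g : T.Verts → V) :
    (T.labelled g).relabel h = T.labelled fun v => h (g v) := by
  induction T with
  | leaf x => rfl
  | node b f ih =>
    exact congrArg (node (C := fun _ => V') b (h (g (.inl .here)))) (funext fun e => ih e _)

theorem labelled_inj {i : P.I} (T : Tree P X i) {g g' : T.Verts → V} :
    T.labelled g = T.labelled g' ↔ g = g' := by
  refine ⟨fun h => ?_, fun h => h ▸ rfl⟩
  induction T with
  | leaf x =>
    funext v
    rcases v with n | l
    · exact nomatch n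
    · cases l; exact DTree.leaf.inj h
  | node b f ih =>
    simp only [Tree.labelled, node.injEq, heq_eq_eq, true_and] at h
    funext v
    rcases Tree.verts_cases v with rfl | ⟨e, v, rfl⟩
    · exact h.1
    · exact congrFun (ih e (congrFun h.2 e)) v

theorem relabel_relabel (h : V → V') (h' : V' → V'') {i : P.I}
    (D : DTree P (fun _ => V) (fun _ => V) i) :
    (D.relabel h).relabel h' = D.relabel fun v => h' (h v) := by
  obtain ⟨g, hg⟩ := D.exists_labelled
  rw [hg]
  simp only [relabel_labelled]

theorem vlabel_labelled {i : P.I} (T : Tree P X i) (g : T.Verts → V) :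
    (T.labelled g).vlabel = g T.top := by
  cases T <;> rfl

theorem vlabel_relabel (h : V → V') {i : P.I} (D : DTree P (fun _ => V) (fun _ => V) i) :
    (D.relabel h).vlabel = h D.vlabel := by
  cases D <;> rfl

/-- The vertices of `U` that label `D` are dots and leaves, and the vertices above a dot
correspond to its inputs. -/
def IsRepr (U : RootedGraph) : {i : P.I} → DTree P (fun _ => U.V) (fun _ => U.V) i → Prop
  | _, leaf x => x ∈ U.leaves
  | _, node _ c f => c ∈ U.dots ∧ Function.Injective (fun e => vlabel (f e)) ∧
      (∀ w, U.Ch c w ↔ ∃ e, vlabel (f e) = w) ∧ ∀ e, IsRepr U (f e)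

/-- `D` is the tree `U` with the structure of a `P`-tree. -/
def Decorates (U : RootedGraph) {i : P.I} (D : DTree P (fun _ => U.V) (fun _ => U.V) i) : Prop :=
  U.Ch U.root D.vlabel ∧ IsRepr U D

theorem IsRepr.iso {U U' : RootedGraph} (e : U.Iso U') {i : P.I}
    {D : DTree P (fun _ => U.V) (fun _ => U.V) i} (h : IsRepr U D) :
    IsRepr U' (D.relabel e) := by
  induction D with
  | leaf x =>
    exact ⟨(e.map_bdry x).2 h.1, fun h' => h.2 (e.toIso.injective (h'.trans e.map_root.symm))⟩
  | node b c f ih =>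
    refine ⟨fun h' => h.1 ((e.map_bdry c).1 h'), fun a a' haa => h.2.1 ?_, fun w => ?_,
      fun a => ih a (h.2.2.2 a)⟩
    · apply e.toIso.injective
      exact (vlabel_relabel e _).symm.trans (haa.trans (vlabel_relabel e _))
    · obtain ⟨w, rfl⟩ := e.toIso.surjective w
      rw [show U'.Ch (e c) (e.toIso w) ↔ U.Ch c w from e.ch_iff c w, h.2.2.1 w]
      refine exists_congr fun a => ?_
      change _ ↔ (relabel e (f a)).vlabel = _
      rw [vlabel_relabel]
      exact e.toIso.injective.eq_iff.symm

theorem Decorates.iso {U U' : RootedGraph} (e : U.Iso U') {i : P.I}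
    {D : DTree P (fun _ => U.V) (fun _ => U.V) i} (h : Decorates U D) :
    Decorates U' (D.relabel e) := by
  refine ⟨?_, h.2.iso e⟩
  rw [vlabel_relabel, ← e.map_root]
  exact (e.ch_iff _ _).2 h.1

theorem isRepr_labelled (U : RootedGraph) {i : P.I} (T : Tree P X i) {g : T.Verts → U.V}
    (h1 : ∀ n, g (.inl n) ∈ U.dots) (h2 : ∀ l, g (.inr l) ∈ U.leaves)
    (h3 : Function.Injective g)
    (h4 : ∀ n w, U.Ch (g (.inl n)) w ↔ ∃ v, T.IsInput n v ∧ g v = w) :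
    IsRepr U (T.labelled g) := by
  induction T with
  | leaf x => exact h2 _
  | node b f ih =>
    refine ⟨h1 _, fun e e' he => ?_, fun w => ?_, fun e => ih e (fun n => h1 (.up e n))
      (fun l => h2 (.up e l)) (h3.comp (Tree.upVert_injective e)) fun n w => ?_⟩
    · simp only [vlabel_labelled] at he
      exact Tree.eq_of_upVert_eq (h3 he)
    · rw [h4]
      simp only [vlabel_labelled]
      constructor
      · rintro ⟨v, ⟨e, rfl⟩, h⟩
        exact ⟨e, h⟩
      · rintro ⟨e, h⟩
        exact ⟨_, ⟨e, rfl⟩, h⟩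
    · refine (h4 (.up e n) w).trans ?_
      constructor
      · rintro ⟨v, ⟨v', h, rfl⟩, h'⟩
        exact ⟨v', h, h'⟩
      · rintro ⟨v', h, h'⟩
        exact ⟨_, ⟨v', h, rfl⟩, h'⟩

theorem decorates_ftree {i : P.I} (T : Tree P X i) : Decorates T.ftree.toRootedGraph (T.labelled some) := by
  refine ⟨(T.ch_ftree _ _).2 ?_, isRepr_labelled _ T ?_ ?_ (Option.some_injective _) ?_⟩
  · exact (congrArg (T.Above none) (vlabel_labelled T some)).mpr rfl
  · rintro n (h | ⟨l, h⟩) <;> cases h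
  · exact fun l => ⟨Or.inr ⟨l, rfl⟩, fun h => nomatch h⟩
  · intro n w
    refine (T.ch_ftree _ _).trans ?_
    rcases w with _ | w
    · exact ⟨fun h => h.elim, fun ⟨_, _, h⟩ => nomatch h⟩
    · exact ⟨fun h => ⟨w, h, rfl⟩, fun ⟨v, h, h'⟩ => Option.some.inj h' ▸ h⟩

section

variable {U : FTree} {i : P.I} {T : Tree P X i} {g : T.Verts → U.V}

theorem IsRepr.labelled_inl (h : IsRepr U.toRootedGraph (T.labelled g)) (n : T.Nodes) :
    g (.inl n) ∈ U.dots ∧ ∀ w, U.Ch (g (.inl n)) w ↔ ∃ v, T.IsInput n v ∧ g v = w := by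
  induction T with
  | leaf x => exact nomatch n
  | node b f ih =>
    cases n with
    | here =>
      refine ⟨h.1, fun w => (h.2.2.1 w).trans ?_⟩
      simp only [vlabel_labelled]
      exact ⟨fun ⟨e, h⟩ => ⟨_, ⟨e, rfl⟩, h⟩, fun ⟨v, ⟨e, h⟩, h'⟩ => ⟨e, h ▸ h'⟩⟩
    | up e n =>
      refine ⟨(ih e (h.2.2.2 e) n).1, fun w => ((ih e (h.2.2.2 e) n).2 w).trans ?_⟩
      exact ⟨fun ⟨v, h, h'⟩ => ⟨_, ⟨v, h, rfl⟩, h'⟩, fun ⟨_, ⟨v, h, h''⟩, h'⟩ => ⟨v, h, h'' ▸ h'⟩⟩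

theorem IsRepr.labelled_inr (h : IsRepr U.toRootedGraph (T.labelled g)) (l : T.Leaves) :
    g (.inr l) ∈ U.leaves := by
  induction T with
  | leaf x => cases l; exact h
  | node b f ih =>
    cases l with
    | up e l => exact ih e (h.2.2.2 e) l

theorem IsRepr.labelled_reach (h : IsRepr U.toRootedGraph (T.labelled g)) (v : T.Verts) :
    ReflTransGen U.Ch (g T.top) (g v) := by
  refine ReflTransGen.lift g ?_ _ _ (T.reach_top v)
  rintro a b ⟨n, rfl, hn⟩
  exact ((h.labelled_inl n).2 _).2 ⟨b, hn, rfl⟩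

/-- Labels in a branch lie above the label of its root. A label common to two branches makes their
roots equal by `eq_of_siblings`, hence the inputs equal; and no label in a branch equals that of the
root dot, by acyclicity. -/
theorem IsRepr.labelled_injective (h : IsRepr U.toRootedGraph (T.labelled g)) :
    Function.Injective g := by
  induction T with
  | leaf x =>
    rintro (n | l) (n' | l') -
    · exact nomatch n
    · exact nomatch n
    · exact nomatch n'
    · cases l; cases l'; rfl
  | node b f ih =>
    have hch : ∀ e, U.Ch (g (.inl .here)) (g (Tree.upVert e (f e).top)) := fun e =>
      (h.2.2.1 _).2 ⟨e, vlabel_labelled _ _⟩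
    have hre := fun e v => (h.2.2.2 e).labelled_reach v
    have hne : ∀ e v, g (Tree.upVert e v) ≠ g (.inl .here) := fun e v heq =>
      U.not_transGen_ch _ (TransGen.head' (hch e) (heq ▸ hre e v))
    intro v v' hv
    rcases Tree.verts_cases v with rfl | ⟨e, v, rfl⟩ <;>
      rcases Tree.verts_cases v' with rfl | ⟨e', v', rfl⟩
    · rfl
    · exact absurd hv.symm (hne _ _)
    · exact absurd hv (hne _ _)
    · have h1 := eq_of_siblings U.ch_unique U.not_transGen_ch (hch e) (hch e') (hre e v)
        (hv ▸ hre e' v')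
      obtain rfl : e = e' := h.2.1 (by simpa only [vlabel_labelled] using h1)
      rw [ih e (h.2.2.2 e) hv]

theorem IsRepr.labelled_ne_root (h : IsRepr U.toRootedGraph (T.labelled g)) (v : T.Verts) :
    g v ≠ U.root := by
  rcases v with n | l
  · exact U.ne_root_of_dot (h.labelled_inl n).1
  · exact (h.labelled_inr l).2

theorem Decorates.labelled_ch_iff (h : Decorates U.toRootedGraph (T.labelled g))
    (a : Option T.Verts) (w : U.V) :
    U.Ch (a.elim U.root g) w ↔ ∃ b, T.Above a b ∧ b.elim U.root g = w := by
  obtain ⟨h1, h2⟩ := h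
  rw [vlabel_labelled] at h1
  rcases a with _ | (n | l)
  · constructor
    · intro hw
      obtain ⟨c, hc, hu⟩ := U.exists_root_ch
      exact ⟨some T.top, rfl, (hu _ h1).trans (hu _ hw).symm⟩
    · rintro ⟨_ | b, h3, rfl⟩
      · exact h3.elim
      · cases (h3 : b = T.top)
        exact h1
  · refine ((h2.labelled_inl n).2 w).trans ⟨fun ⟨v, h3, h4⟩ => ⟨some v, h3, h4⟩, ?_⟩
    rintro ⟨_ | b, h3, h4⟩
    · exact h3.elim
    · exact ⟨b, h3, h4⟩
  · have h3 := h2.labelled_inr l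
    exact ⟨fun hw => absurd hw (U.not_ch_of_bdry h3.1 h3.2 w), fun ⟨b, h, _⟩ => h.elim⟩

/-- For surjectivity, every vertex is reached from the root, and whatever lies immediately above a
labelling vertex is again a label. -/
theorem Decorates.labelled_bijective (h : Decorates U.toRootedGraph (T.labelled g)) :
    Function.Bijective fun a : Option T.Verts => a.elim U.root g := by
  refine ⟨?_, fun v => ?_⟩
  · rintro (_ | a) (_ | b) hab
    · rfl
    · exact absurd hab.symm (h.2.labelled_ne_root b)
    · exact absurd hab (h.2.labelled_ne_root a)
    · exact congrArg some (h.2.labelled_injective hab)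
  · induction U.reach v with
    | refl => exact ⟨none, rfl⟩
    | tail h1 h2 ih =>
      obtain ⟨a, rfl⟩ := ih
      obtain ⟨b, -, hb⟩ := (h.labelled_ch_iff a _).1 h2
      exact ⟨b, hb⟩

/-- The isomorphism of a tree with the underlying tree of a `P`-tree whose vertices it labels. -/
theorem Decorates.exists_iso (h : Decorates U.toRootedGraph (T.labelled g)) :
    ∃ α : U.Iso T.graph, ∀ v, α (g v) = some v := by
  let ε := Equiv.ofBijective _ h.labelled_bijective
  have hch : ∀ a b, U.Ch (ε a) (ε b) ↔ T.Above a b := fun a b =>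
    (h.labelled_ch_iff a _).trans
      ⟨fun ⟨b', h1, h2⟩ => ε.injective (a₁ := b') (a₂ := b) h2 ▸ h1, fun h1 => ⟨b, h1, rfl⟩⟩
  let e : T.graph.Iso U.toRootedGraph :=
    { toIso :=
        { toEquiv := ε
          map_rel_iff' := fun {a b} => by
            refine U.adj_iff_ch.trans (Iff.trans ?_ (T.graph_adj_iff a b).symm)
            exact or_congr (hch a b) (hch b a) }
      map_root := rfl
      map_bdry := by
        rintro (_ | (n | l))
        · exact iff_of_true U.isTree.root_mem (Or.inl rfl)
        · refine iff_of_false (h.2.labelled_inl n).1 ?_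
          rintro (h | ⟨l, h⟩) <;> cases h
        · exact iff_of_true (h.2.labelled_inr l).1 (Or.inr ⟨l, rfl⟩) }
  exact ⟨e.symm, fun v => e.toIso.symm_apply_apply (some v)⟩

end

/-- Both trees are isomorphic to the underlying tree of the common shape. This turns equality of
`P`-trees into isomorphism of the abstract trees they decorate. -/
theorem Decorates.exists_iso_of_shape {U U' : FTree} {i : P.I}
    {D : DTree P (fun _ => U.V) (fun _ => U.V) i} {D' : DTree P (fun _ => U'.V) (fun _ => U'.V) i}
    (h : Decorates U.toRootedGraph D) (h' : Decorates U'.toRootedGraph D')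
    (hs : D.shape = D'.shape) : ∃ f : U.Iso U'.toRootedGraph, D' = D.relabel f := by
  obtain ⟨T, hT⟩ : ∃ T, T = D.shape := ⟨_, rfl⟩
  obtain ⟨g, rfl⟩ := D.exists_labelled_of_shape hT.symm
  obtain ⟨g', rfl⟩ := D'.exists_labelled_of_shape (hs.symm.trans hT.symm)
  obtain ⟨α, hα⟩ := h.exists_iso
  obtain ⟨α', hα'⟩ := h'.exists_iso
  refine ⟨α.trans α'.symm, ?_⟩
  rw [relabel_labelled, labelled_inj]
  funext v
  refine ((α'.toIso.symm_apply_eq).2 ?_).symm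
  exact (hα v).trans (hα' v).symm

end DTree

end Opetopes

/-! ### Leaves and null-dots above a vertex, the names of the dots inside a sphere. -/

namespace Opetopes

open Relation

namespace FTree

variable (U : FTree)

/-- The vertices without inputs. -/
def ends : Set U.V := U.leaves ∪ U.nullDots

/-- The leaves and null-dots above `v`. -/
def endsAbove (v : U.V) : Set U.V := {a | a ∈ U.ends ∧ ReflTransGen U.Ch v a}

theorem mem_ends_iff {v : U.V} (hv : v ≠ U.root) : v ∈ U.ends ↔ ∀ w, ¬ U.Ch v w := by
  constructor
  · rintro (h | h)
    · exact U.not_ch_of_bdry h.1 h.2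
    · exact ((U.mem_nullDots_iff v).1 h).2
  · intro h
    by_cases hb : v ∈ U.bdry
    · exact Or.inl ⟨hb, hv⟩
    · exact Or.inr ((U.mem_nullDots_iff v).2 ⟨hb, h⟩)

theorem ne_root_of_mem_ends {v : U.V} (h : v ∈ U.ends) : v ≠ U.root :=
  h.elim (·.2) (fun h => U.ne_root_of_dot h.1)

theorem ne_root_of_ch {p v : U.V} (h : U.Ch p v) : v ≠ U.root := fun hv => U.not_ch_root p (hv ▸ h)

theorem endsAbove_of_mem_ends {v : U.V} (hv : v ∈ U.ends) : U.endsAbove v = {v} := by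
  ext a
  refine ⟨fun h => ?_, fun h => ?_⟩
  · rcases ReflTransGen.cases_head h.2 with h' | ⟨w, hw, -⟩
    · exact h'.symm
    · exact absurd hw ((U.mem_ends_iff (U.ne_root_of_mem_ends hv)).1 hv w)
  · cases h; exact ⟨hv, .refl⟩

theorem exists_mem_endsAbove {v : U.V} (hv : v ≠ U.root) : ∃ a, a ∈ U.endsAbove v := by
  induction v using U.wf_ch_swap.induction with
  | _ v ih =>
    by_cases h : v ∈ U.ends
    · exact ⟨v, h, .refl⟩
    · rw [U.mem_ends_iff hv] at h
      push Not at h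
      obtain ⟨w, hw⟩ := h
      obtain ⟨a, ha, hwa⟩ := ih w hw (U.ne_root_of_ch hw)
      exact ⟨a, ha, hwa.head hw⟩

theorem mem_endsAbove_iff {v : U.V} (hv : v ∉ U.ends) (a : U.V) :
    a ∈ U.endsAbove v ↔ ∃ w, U.Ch v w ∧ a ∈ U.endsAbove w := by
  constructor
  · rintro ⟨h1, h2⟩
    rcases ReflTransGen.cases_head h2 with h' | ⟨w, hw, h3⟩
    · exact absurd (h' ▸ h1) hv
    · exact ⟨w, hw, h1, h3⟩
  · rintro ⟨w, hw, h1, h3⟩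
    exact ⟨h1, h3.head hw⟩

open Classical in
/-- The vertex immediately above `v` on the way to `a`. -/
noncomputable def branch (v a : U.V) : U.V :=
  if h : ∃ w, U.Ch v w ∧ ReflTransGen U.Ch w a then h.choose else v

theorem branch_eq {v w a : U.V} (h : U.Ch v w) (h' : ReflTransGen U.Ch w a) :
    U.branch v a = w := by
  have hex : ∃ w, U.Ch v w ∧ ReflTransGen U.Ch w a := ⟨w, h, h'⟩
  rw [branch, dif_pos hex]
  exact eq_of_siblings U.ch_unique U.not_transGen_ch hex.choose_spec.1 h hex.choose_spec.2 h'

end FTree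

namespace DTree

variable {P : Poly} {C : (Σ i, P.Op i) → Type} {X : P.I → Type} {W : Type}

theorem allNode_decorate (Q : ∀ x, C x → Prop) {i : P.I} (T : Tree P X i)
    (k : ∀ n : T.Nodes, C (T.deco n)) : AllNode Q (decorate T k) ↔ ∀ n, Q _ (k n) := by
  rw [allNode_iff_split, split_decorate]

theorem mem_supp_decorate (l : ∀ x, C x → Set W) (w : W) {i : P.I} (T : Tree P X i)
    (k : ∀ n : T.Nodes, C (T.deco n)) :
    w ∈ supp l (fun _ _ => ∅) (decorate T k) ↔ ∃ n, w ∈ l _ (k n) := by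
  rw [mem_supp_iff_split, split_decorate]

theorem allNode_of_labels (Q : W → Prop) {i : P.I} (T : DTree P (fun _ => W) X i)
    (h : ∀ a ∈ labels T, Q a) : AllNode (fun _ w => Q w) T := by
  induction T with
  | leaf x => trivial
  | node b c f ih =>
    exact ⟨h c (Or.inl rfl), fun e => ih e fun a ha => h a (Or.inr (Set.mem_iUnion.2 ⟨e, ha⟩))⟩

end DTree

/-! ### The blow-up of a `P⁺`-tree and its reconstruction from nested spheres. -/

namespace PolyMonad

open DTree

variable {P : PolyMonad} {C : (Σ i, P.Op i) → Type} {X : P.I → Type} {V : Type}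

theorem IsDivision.decorate {Γ W : Type} {κ : W → Γ} {i : P.I} (T : Tree P.toPoly X i)
    (k : ∀ n : T.Nodes, P.PlusObj (fun _ => W) (T.deco n)) (γ : T.Nodes → Γ)
    (hγ : Function.Injective γ)
    (h : ∀ n, (∃ t, rootLabel (k n).1 = some t) ∧
      AllNode (fun _ (w : W) => κ w = γ n) (k n).1) : IsDivision κ (DTree.decorate T k) := by
  -- The pair `S` is kept general because `split_decorate` is an equality of dependent pairs, in
  -- which `k` and `γ` cannot be rewritten separately.
  have key : ∀ (y : DTree P.toPoly (P.PlusObj fun _ => W) X i)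
      (S : Σ T : Tree P.toPoly X i, ∀ n : T.Nodes, P.PlusObj (fun _ => W) (T.deco n)),
      y.split = S → ∀ γ : S.1.Nodes → Γ, Function.Injective γ →
      (∀ n, (∃ t, rootLabel (S.2 n).1 = some t) ∧
        AllNode (fun _ (w : W) => κ w = γ n) (S.2 n).1) → IsDivision κ y := by
    rintro y S rfl γ hγ h
    exact IsDivision.of_injective γ hγ h
  exact key _ _ (split_decorate T k) γ hγ h

/-- The operation is a unit. -/
def IsUnitOp (P : PolyMonad) (x : Σ i, P.Op i) : Prop :=
  (P.unit (X := fun _ => Unit) (i := x.1) ()).1 = x.2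

/-- The unit tree, which contracts to a unit operation. -/
def unitTree {x : Σ i, P.Op i} (h : P.IsUnitOp x) : P.PlusObj C x := ⟨.leaf (), h⟩

open Classical in
/-- Replace each null-dot by a leaf. -/
noncomputable def pruneD : {x : Σ i, P.Op i} → DTree P.plusPoly (fun _ => V) (fun _ => V) x →
    DTree P.plusPoly (fun _ => V) (fun _ => V) x
  | _, .leaf v => .leaf v
  | _, .node R c f => if IsEmpty (P.plusPoly.Ar R) then .leaf c else .node R c fun e => pruneD (f e)

/-- The contraction of a `P⁺`-tree, as a `P`-tree with dots decorated by the leaves. -/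
noncomputable def contractObj {D : (Σ x, P.plusPoly.Op x) → Type} {x : Σ i, P.Op i}
    (N : DTree P.plusPoly D (fun _ => V) x) : P.PlusObj (fun _ => V) x :=
  ofObj (P.plus.contractD N)

theorem contractObj_leaf {D : (Σ x, P.plusPoly.Op x) → Type} {x : Σ i, P.Op i} (v : V) :
    P.contractObj (.leaf v : DTree P.plusPoly D (fun _ => V) x) = plusUnit v :=
  ofObj_toObj _

theorem contractObj_node {D : (Σ x, P.plusPoly.Op x) → Type} {x : Σ i, P.Op i} (R : P.plusPoly.Op x)
    (c : D ⟨x, R⟩) (f : ∀ e : P.plusPoly.Ar R, DTree P.plusPoly D (fun _ => V) (P.plusPoly.src e)) :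
    P.contractObj (.node R c f) =
      plusJoin (ofObj (C := P.PlusObj fun _ => V) ⟨R, fun e => P.contractObj (f e)⟩) := by
  refine (ofObj_plusMul ⟨R, fun e => P.plus.contractD (f e)⟩).trans ?_
  rw [← ofObj_map]
  rfl

/-- The labelled `P`-tree, subdivided by white dots, to which the spheres of `N` belong. -/
noncomputable def blowupObj {x : Σ i, P.Op i} (N : DTree P.plusPoly (fun _ => V) (fun _ => V) x) :
    P.PlusObj (fun _ => V) x :=
  P.contractObj (pruneD N)

theorem blowupObj_leaf {x : Σ i, P.Op i} (v : V) :
    P.blowupObj (.leaf v : DTree P.plusPoly (fun _ => V) (fun _ => V) x) = plusUnit v :=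
  contractObj_leaf v

theorem blowupObj_null {x : Σ i, P.Op i} {R : P.plusPoly.Op x} (hR : IsEmpty (P.plusPoly.Ar R)) (c : V)
    (f : ∀ e : P.plusPoly.Ar R, DTree P.plusPoly (fun _ => V) (fun _ => V) (P.plusPoly.src e)) :
    P.blowupObj (.node R c f) = plusUnit c := by
  rw [blowupObj, pruneD, if_pos hR, contractObj_leaf]

theorem blowupObj_node {x : Σ i, P.Op i} {R : P.plusPoly.Op x} (hR : ¬ IsEmpty (P.plusPoly.Ar R)) (c : V)
    (f : ∀ e : P.plusPoly.Ar R, DTree P.plusPoly (fun _ => V) (fun _ => V) (P.plusPoly.src e)) :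
    P.blowupObj (.node R c f) =
      plusJoin (ofObj (C := P.PlusObj fun _ => V) ⟨R, fun e => P.blowupObj (f e)⟩) := by
  rw [blowupObj, pruneD, if_neg hR, contractObj_node]
  rfl

/-- Without a dot above the root dot, all branches are leaves; by the unit law such a tree contracts
to the operation at its only dot. -/
theorem eq_plusUnit {x : Σ i, P.Op i} (S : P.PlusObj (fun _ => V) x) {v : V} {b : P.Op x.1}
    {f : ∀ e : P.Ar b, DTree P.toPoly (fun _ => V) (fun _ => Unit) (P.src e)}
    (hS : S.1 = .node b v f) (hf : ∀ e q, rootLabel (f e) ≠ some q) :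
    b = x.2 ∧ S = plusUnit v := by
  obtain rfl : f = fun _ => .leaf () := by
    funext e
    cases hfe : f e with
    | leaf x => rfl
    | node b' c' f' => exact absurd (by rw [hfe]; rfl) (hf e c')
  obtain ⟨S, h⟩ := S
  cases hS
  have hb : b = x.2 := by
    rw [← h]
    exact (congrArg Sigma.fst (P.join_map_unit (X := fun _ => Unit) ⟨b, fun _ => ()⟩)).symm
  obtain ⟨i, b'⟩ := x
  cases hb
  exact ⟨rfl, rfl⟩

/-- The tree to be substituted for a dot labelled by `v` to delete it if its label is in `W` and its
operation is a unit, and to keep it otherwise. -/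
noncomputable def eraser (W : Set V) (x : Σ i, P.Op i) (v : V) : P.PlusObj (fun _ => V) x :=
  open Classical in if h : v ∈ W ∧ P.IsUnitOp x then unitTree h.2 else plusUnit v

theorem eraser_pos {W : Set V} {x : Σ i, P.Op i} {v : V} (h : v ∈ W) (h' : P.IsUnitOp x) :
    eraser W x v = unitTree h' := by
  rw [eraser, dif_pos ⟨h, h'⟩]

theorem eraser_neg {W : Set V} {x : Σ i, P.Op i} {v : V} (h : v ∉ W) :
    eraser (P := P) W x v = plusUnit v := by
  rw [eraser, dif_neg fun h' => h h'.1]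

/-- Delete the dots with labels in `W` that carry unit operations. -/
noncomputable def erase (W : Set V) {i : P.I} (D : DTree P.toPoly (fun _ => V) X i) :
    DTree P.toPoly (fun _ => V) X i :=
  subst (D.mapDec (eraser W))

theorem plusJoin_plusJoin {x : Σ i, P.Op i} (T : P.PlusObj (P.PlusObj (P.PlusObj C)) x) :
    plusJoin (plusJoin T) = plusJoin (plusMap (fun _ => plusJoin) T) :=
  Subtype.ext (subst_subst T.1)

theorem isEmpty_nodes_iff {i : P.I} (T : Tr P.toPoly i) : IsEmpty T.Nodes ↔ T = .leaf () := by
  cases T with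
  | leaf x => exact iff_of_true ⟨fun n => nomatch n⟩ rfl
  | node b f => exact iff_of_false (fun h => h.false .here) (fun h => nomatch h)

section

variable {U : FTree} {x : P.plusPoly.I}

theorem IsRepr.mem_nullDots {R : P.plusPoly.Op x} {c : U.V}
    {f : ∀ e : P.plusPoly.Ar R, DTree P.plusPoly (fun _ => U.V) (fun _ => U.V) (P.plusPoly.src e)}
    (h : IsRepr U.toRootedGraph (.node R c f)) (hR : IsEmpty (P.plusPoly.Ar R)) : c ∈ U.nullDots :=
  (U.mem_nullDots_iff c).2 ⟨h.1, fun w hw => by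
    obtain ⟨e, -⟩ := (h.2.2.1 w).1 hw
    exact hR.false e⟩

theorem IsRepr.notMem_ends {R : P.plusPoly.Op x} {c : U.V}
    {f : ∀ e : P.plusPoly.Ar R, DTree P.plusPoly (fun _ => U.V) (fun _ => U.V) (P.plusPoly.src e)}
    (h : IsRepr U.toRootedGraph (.node R c f)) (hR : ¬ IsEmpty (P.plusPoly.Ar R)) : c ∉ U.ends := by
  rw [U.mem_ends_iff (U.ne_root_of_dot h.1)]
  rw [not_isEmpty_iff] at hR
  obtain ⟨e⟩ := hR
  exact fun h' => h' _ ((h.2.2.1 _).2 ⟨e, rfl⟩)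

theorem labels_plusUnit (y : Σ i, P.Op i) (v : V) :
    labels (plusUnit (P := P) (C := fun _ => V) (x := y) v).1 = {v} := by
  simp [plusUnit, supp]

/-- The dots of the blow-up correspond to the leaves and the null-dots. -/
theorem IsRepr.labels_blowupObj {N : DTree P.plusPoly (fun _ => U.V) (fun _ => U.V) x}
    (h : IsRepr U.toRootedGraph N) : labels (P.blowupObj N).1 = U.endsAbove N.vlabel := by
  induction N with
  | leaf v =>
    rw [blowupObj_leaf, labels_plusUnit]
    exact (U.endsAbove_of_mem_ends (Or.inl h)).symm
  | node R c f ih =>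
    by_cases hR : IsEmpty (P.plusPoly.Ar R)
    · rw [blowupObj_null hR, labels_plusUnit]
      exact (U.endsAbove_of_mem_ends (Or.inr (IsRepr.mem_nullDots h hR))).symm
    · rw [blowupObj_node hR]
      ext a
      refine (iff_of_eq (congrArg (a ∈ ·) (supp_subst _ _ _))).trans ?_
      refine (mem_supp_decorate _ a _ _).trans ?_
      refine Iff.trans ?_ (U.mem_endsAbove_iff (IsRepr.notMem_ends h hR) a).symm
      constructor
      · rintro ⟨n, hn⟩
        exact ⟨_, (h.2.2.1 _).2 ⟨n, rfl⟩, (ih n (h.2.2.2 n)) ▸ hn⟩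
      · rintro ⟨w, hw, ha⟩
        obtain ⟨n, rfl⟩ := (h.2.2.1 _).1 hw
        exact ⟨n, show a ∈ labels (P.blowupObj (f n)).1 from (ih n (h.2.2.2 n)).symm ▸ ha⟩

theorem exists_rootLabel_subst_decorate {i : P.I} (T : Tree P.toPoly X i)
    (hT : ¬ IsEmpty T.Nodes) (k : ∀ n : T.Nodes, P.PlusObj (fun _ => V) (T.deco n))
    (hk : ∀ n, ∃ t, rootLabel (k n).1 = some t) :
    ∃ t, rootLabel (subst (decorate T k)) = some t := by
  cases T with
  | leaf x => exact absurd ⟨fun n => nomatch n⟩ hT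
  | node b f =>
    obtain ⟨t, ht⟩ := hk .here
    exact ⟨t, rootLabel_graft _ ((rootLabel_fill _ _).trans ht)⟩

theorem exists_rootLabel_blowupObj (N : DTree P.plusPoly (fun _ => V) (fun _ => V) x) :
    ∃ t, rootLabel (P.blowupObj N).1 = some t := by
  induction N with
  | leaf v => rw [blowupObj_leaf]; exact ⟨v, rfl⟩
  | node R c f ih =>
    by_cases hR : IsEmpty (P.plusPoly.Ar R)
    · rw [blowupObj_null hR]; exact ⟨c, rfl⟩
    · rw [blowupObj_node hR]
      exact exists_rootLabel_subst_decorate R.1 hR _ ih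

/-- The kernel rule for the scars of the substitutions. -/
theorem IsRepr.exists_top {r : U.V → U.V → Prop}
    {N : DTree P.plusPoly (fun _ => U.V) (fun _ => U.V) x} (h : IsRepr U.toRootedGraph N)
    (hr : AdjIn r (P.blowupObj N).1) {v : U.V} (hv : ReflTransGen U.Ch N.vlabel v) :
    ∃ t ∈ U.endsAbove v, ∀ k ∈ U.endsAbove v, k ≠ t → ∃ p ∈ U.endsAbove v, r p k := by
  have key : ∀ {x : Σ i, P.Op i} {N : DTree P.plusPoly (fun _ => U.V) (fun _ => U.V) x},
      IsRepr U.toRootedGraph N → AdjIn r (P.blowupObj N).1 → ∃ t ∈ U.endsAbove N.vlabel,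
        ∀ k ∈ U.endsAbove N.vlabel, k ≠ t → ∃ p ∈ U.endsAbove N.vlabel, r p k := by
    intro x N h hr
    obtain ⟨t, ht⟩ := exists_rootLabel_blowupObj N
    rw [← IsRepr.labels_blowupObj h]
    exact ⟨t, rootLabel_mem ht, fun k hk hkt => hr.exists_parent ht hk hkt⟩
  induction N with
  | leaf u =>
    rcases ReflTransGen.cases_head hv with rfl | ⟨w, hw, -⟩
    · exact key h hr
    · exact absurd hw (U.not_ch_of_bdry h.1 h.2 w)
  | node R c f ih =>
    rcases ReflTransGen.cases_head hv with rfl | ⟨w, hw, hwv⟩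
    · exact key h hr
    · obtain ⟨n, rfl⟩ := (h.2.2.1 _).1 hw
      have hR : ¬ IsEmpty (P.plusPoly.Ar R) := fun hR => hR.false n
      rw [blowupObj_node hR] at hr
      -- Adjacency in the substituted tree restricts to the tree inserted at the dot `n`, so the
      -- smaller sphere inherits it.
      exact ih n (h.2.2.2 n) ((allNode_decorate _ _ _).1 (AdjIn.of_subst hr) n) hwv

/-- A `P⁺`-tree is determined by its blow-up and its underlying tree. -/
theorem IsRepr.eq_of_blowupObj_eq {N N' : DTree P.plusPoly (fun _ => U.V) (fun _ => U.V) x}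
    (h : IsRepr U.toRootedGraph N) (h' : IsRepr U.toRootedGraph N') (hv : N.vlabel = N'.vlabel)
    (hb : P.blowupObj N = P.blowupObj N') : N = N' := by
  induction N with
  | leaf v =>
    cases N' with
    | leaf v' => exact congrArg DTree.leaf hv
    | node R c f => exact absurd ((show v = c from hv) ▸ h.1) h'.1
  | node R c f ih =>
    cases N' with
    | leaf v' => exact absurd ((show v' = c from hv.symm) ▸ h'.1) h.1
    | node R' c' f' =>
      obtain rfl : c = c' := hv
      by_cases hR : IsEmpty (P.plusPoly.Ar R)
      -- Whether `c` is a null-dot is a property of `U` alone, so both trees have a unit tree at `c`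
      -- or neither has.
      · have hR' : IsEmpty (P.plusPoly.Ar R') := by
          by_contra hR'
          exact IsRepr.notMem_ends h' hR' (Or.inr (IsRepr.mem_nullDots h hR))
        obtain rfl : R = R' := Subtype.ext
          (((isEmpty_nodes_iff R.1).1 hR).trans ((isEmpty_nodes_iff R'.1).1 hR').symm)
        exact congrArg (DTree.node (C := fun _ => U.V) R c) (funext fun e => hR.elim e)
      · have hR' : ¬ IsEmpty (P.plusPoly.Ar R') := fun hR' =>
          IsRepr.notMem_ends h hR (Or.inr (IsRepr.mem_nullDots h' hR'))
        rw [blowupObj_node hR, blowupObj_node hR'] at hb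
        -- Each dot of the blow-up is coloured by the vertex immediately above `c` on the way to its
        -- name; the part inserted at `n` has the colour of the root of `f n`.
        have hκ : ∀ {y : P.plusPoly.I} {R : P.plusPoly.Op y} {f : ∀ e : P.plusPoly.Ar R, DTree P.plusPoly (fun _ => U.V)
            (fun _ => U.V) (P.plusPoly.src e)}, IsRepr U.toRootedGraph (.node R c f) →
            ∀ n, ∀ a ∈ labels (P.blowupObj (f n)).1, U.branch c a = (f n).vlabel := by
          intro y R f h n a ha
          rw [IsRepr.labels_blowupObj (h.2.2.2 n)] at ha
          exact U.branch_eq ((h.2.2.1 _).2 ⟨n, rfl⟩) ha.2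
        have hdiv : ∀ {y : P.plusPoly.I} {R : P.plusPoly.Op y} {f : ∀ e : P.plusPoly.Ar R, DTree P.plusPoly (fun _ => U.V)
            (fun _ => U.V) (P.plusPoly.src e)}, IsRepr U.toRootedGraph (.node R c f) →
            IsDivision (U.branch c) (decorate R.1 fun n => P.blowupObj (f n)) := by
          intro y R f h
          refine IsDivision.decorate R.1 _ (fun n => (f n).vlabel) h.2.1 fun n =>
            ⟨exists_rootLabel_blowupObj _, ?_⟩
          exact allNode_of_labels _ _ (hκ h n)
        have hy := IsDivision.eq_of_subst_eq (hdiv (R := R) (f := f) h)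
          (hdiv (R := R') (f := f') h') (congrArg Subtype.val hb)
        have hO := ofObj_inj (z := (⟨R, fun n => P.blowupObj (f n)⟩ :
          P.plusPoly.Obj (P.PlusObj fun _ => U.V) _)) (w := ⟨R', fun n => P.blowupObj (f' n)⟩)
          (Subtype.ext hy)
        obtain rfl : R = R' := congrArg Sigma.fst hO
        have hn := congrFun (eq_of_heq (Sigma.ext_iff.1 hO).2)
        refine congrArg (DTree.node (C := fun _ => U.V) R c) (funext fun n =>
          ih n (h.2.2.2 n) (h'.2.2.2 n) ?_ (hn n))
        -- The common blow-up at `n` has some label, and the colour of that label is the root vertex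
        -- of both branches.
        obtain ⟨t, ht⟩ := exists_rootLabel_blowupObj (f n)
        have ht := rootLabel_mem ht
        rw [← hκ h n t ht]
        exact hκ h' n t ((congrArg (fun o => labels (Subtype.val o)) (hn n)) ▸ ht)

/-- The contraction of a `P⁺`-tree is obtained from its blow-up by deleting the white dots. -/
theorem IsRepr.contractObj_eq {N : DTree P.plusPoly (fun _ => U.V) (fun _ => U.V) x}
    (h : IsRepr U.toRootedGraph N) :
    P.contractObj N = plusJoin (plusMap (eraser U.nullDots) (P.blowupObj N)) := by
  induction N with
  | leaf v =>
    rw [blowupObj_leaf, contractObj_leaf]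
    refine ((plusJoin_unit _).trans (eraser_neg fun h' => h'.1 h.1)).symm
  | node R c f ih =>
    by_cases hR : IsEmpty (P.plusPoly.Ar R)
    · rw [blowupObj_null hR, contractObj_node]
      rename_i y
      -- A null-dot of a `P⁺`-tree is decorated by a unit tree, and its output type is the
      -- contraction of that tree, a unit operation.
      have hu : P.IsUnitOp y := by
        refine Eq.trans ?_ R.2
        rw [(isEmpty_nodes_iff R.1).1 hR]
        rfl
      refine Eq.trans ?_ ((plusJoin_unit _).trans
        (eraser_pos (IsRepr.mem_nullDots h hR) hu)).symm
      have hR' := (isEmpty_nodes_iff R.1).1 hR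
      obtain ⟨R, hR2⟩ := R
      cases hR'
      rfl
    -- Substitution is natural and associative, so erasing after the outer substitution equals
    -- erasing first inside each inserted tree.
    · rw [blowupObj_node hR, contractObj_node, plusJoin_nat, plusJoin_plusJoin, plusMap_map,
        ← ofObj_map]
      congr 2
      exact Sigma.ext rfl (heq_of_eq (funext fun n => ih n (h.2.2.2 n)))

/-- A nesting of spheres on a `P`-tree makes the tree of spheres into a `P⁺`-tree. -/
theorem exists_blowupObj_eq {r : U.V → U.V → Prop} (hr : ∀ p p' q, r p q → r p' q → p = p')
    (hwf : WellFounded r)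
    (hker : ∀ v ∈ U.dots,
      ∃ t ∈ U.endsAbove v, ∀ k ∈ U.endsAbove v, k ≠ t → ∃ p ∈ U.endsAbove v, r p k)
    (v : U.V) (hv : v ≠ U.root) (x : Σ i, P.Op i) (D : P.PlusObj (fun _ => U.V) x) {t : U.V}
    (ht : rootLabel D.1 = some t) (htp : ∀ p ∈ U.endsAbove v, ¬ r p t)
    (hD : Represents r (U.endsAbove v) D.1)
    (hu : AllNode (fun y w => w ∈ U.nullDots → P.IsUnitOp y) D.1) :
    ∃ N : DTree P.plusPoly (fun _ => U.V) (fun _ => U.V) x,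
      N.vlabel = v ∧ IsRepr U.toRootedGraph N ∧ P.blowupObj N = D := by
  have hA : ∀ a, ¬ TransGen r a a := fun a h => by
    exact (hwf.transGen.irrefl).irrefl a h
  induction v using U.wf_ch_swap.induction generalizing x t with
  | _ v ih =>
    by_cases he : v ∈ U.ends
    · have hE := U.endsAbove_of_mem_ends he
      rw [hE] at hD
      cases hD1 : D.1 with
      | leaf y => rw [hD1] at ht; cases ht
      | node b c f =>
        rw [hD1] at hD hu
        obtain rfl : c = v := hD.1
        -- A second dot would again be labelled by `c`, the only name available, and would make `c`
        -- its own parent.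
        obtain ⟨rfl, hDu⟩ := eq_plusUnit D hD1 fun e q hq => by
          have hq' : q ∈ ({c} : Set U.V) := (hD.2.2.2.2 e).subset (rootLabel_mem hq)
          obtain rfl : q = c := hq'
          exact hA q (TransGen.single (hD.2.1 e q hq))
        -- The same one-dot tree arises from a leaf and from a null-dot of `U`. At a null-dot the
        -- operation has to be a unit, by `hu`, so that the unit tree is an admissible decoration.
        by_cases hn : c ∈ U.nullDots
        · have hn' := (U.mem_nullDots_iff c).1 hn
          let R : P.plusPoly.Op ⟨x.1, x.2⟩ := ⟨.leaf (), hu.1 hn⟩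
          have hR : ∀ e : P.plusPoly.Ar R, False := fun e => nomatch e
          refine ⟨.node (P := P.plusPoly) (C := fun _ => U.V) R c
            fun e => (hR e).elim, rfl, ⟨hn.1, fun e => (hR e).elim, fun w => ?_,
            fun e => (hR e).elim⟩, ?_⟩
          · exact iff_of_false (hn'.2 w) fun ⟨e, _⟩ => hR e
          · rw [hDu]
            exact blowupObj_null ⟨hR⟩ _ _
        · refine ⟨.leaf c, rfl, he.resolve_right hn, ?_⟩
          rw [hDu]
          exact blowupObj_leaf c
    · have hvd : v ∈ U.dots := fun hb => he (Or.inl ⟨hb, hv⟩)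
      -- `Represents` alone gives one inclusion. For the other, the kernel rule connects every name
      -- above `v` down to its lowest name, which must be `t` because `t` has no parent there.
      have hlab : labels D.1 = U.endsAbove v := by
        refine Set.Subset.antisymm hD.subset fun k hk => ?_
        obtain ⟨r', hr', hp⟩ := hker v hvd
        have htv := hD.subset (rootLabel_mem ht)
        obtain rfl : t = r' := by_contra fun h => by
          obtain ⟨p, hp1, hp2⟩ := hp t htv h
          exact htp p hp1 hp2
        induction k using hwf.induction with
        | _ k ihk =>
          by_cases hkt : k = t
          · exact hkt ▸ rootLabel_mem ht
          · obtain ⟨p, hp1, hp2⟩ := hp k hk hkt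
            exact hD.closed (ihk p hp2 hp1) hk hp2
      -- Colouring by the vertex immediately above `v` makes the monochrome parts the pieces that
      -- the next smaller spheres cut out.
      let κ := U.branch v
      let Y : P.PlusObj (P.PlusObj fun _ => U.V) x := ⟨clusters κ D.1, by
        rw [← contractD_subst, subst_clusters]; exact D.2⟩
      have hY : plusJoin Y = D := Subtype.ext (subst_clusters κ D.1)
      have hcl : AllNode (fun _ => IsCluster r (U.endsAbove v) κ) Y.1 :=
        isCluster_clusters hr κ hD fun q hq => by
          obtain rfl := Option.some.inj (hq.symm.trans ht)
          exact htp
      have hun : AllNode (fun _ S => AllNode (fun y w => w ∈ U.nullDots → P.IsUnitOp y) S.1) Y.1 := by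
        rw [← allNode_subst, subst_clusters]; exact hu
      have hdisj : Disj (fun _ (S : P.PlusObj (fun _ => U.V) _) => labels S.1) (fun _ _ => ∅) Y.1 := by
        refine Disj.of_subst ?_
        rw [subst_clusters]
        exact hD.disj hr hA
      have hlabY : ∀ a ∈ U.endsAbove v, ∃ n, a ∈ labels (Y.1.split.2 n).1 := by
        intro a ha
        refine (mem_supp_iff_split (fun _ (S : P.PlusObj (fun _ => U.V) _) => labels S.1) a _).1 ?_
        rw [← supp_subst, subst_clusters]
        exact (hlab.symm ▸ ha : a ∈ labels D.1)
      rw [allNode_iff_split] at hcl hun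
      choose s hs1 hs2 hs3 hs4 using hcl
      have hκ : ∀ {w a}, U.Ch v w → a ∈ U.endsAbove w → κ a = w := fun h h' => U.branch_eq h h'.2
      have hex : ∀ a ∈ U.endsAbove v, U.Ch v (κ a) ∧ a ∈ U.endsAbove (κ a) := by
        intro a ha
        obtain ⟨w, hw, haw⟩ := (U.mem_endsAbove_iff he a).1 ha
        rw [hκ hw haw]
        exact ⟨hw, haw⟩
      -- So the part at `n` is represented in exactly the set of names above `κ (s n)`, as the
      -- induction hypothesis requires.
      have hset : ∀ n, {a | a ∈ U.endsAbove v ∧ κ a = κ (s n)} = U.endsAbove (κ (s n)) := by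
        intro n
        ext a
        constructor
        · rintro ⟨ha, hk⟩
          exact hk ▸ (hex a ha).2
        · intro ha
          exact ⟨(U.mem_endsAbove_iff he a).2 ⟨_, (hex _ (hs1 n)).1, ha⟩, hκ (hex _ (hs1 n)).1 ha⟩
      have htop : ∀ n, ∀ p ∈ U.endsAbove (κ (s n)), ¬ r p (s n) := by
        intro n p hp hps
        rw [← hset n] at hp
        exact hs4 n p hp.1 hps hp.2
      choose N hN1 hN2 hN3 using fun n => ih (κ (s n)) (hex _ (hs1 n)).1
        (U.ne_root_of_ch (hex _ (hs1 n)).1) _ (Y.1.split.2 n) (hs2 n) (htop n)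
        ((hset n) ▸ hs3 n) (hun n)
      -- Two parts of the same colour would have roots without parent in the same kernel. A kernel
      -- has only one such vertex, so the roots coincide, against the disjointness of the parts.
      -- This is where connectedness of the smaller spheres enters.
      have hinj : Function.Injective fun n => κ (s n) := by
        intro n n' hnn
        change κ (s n) = κ (s n') at hnn
        have hst : s n = s n' := by
          have h1 : s n ∈ U.endsAbove (κ (s n)) := (hex _ (hs1 n)).2
          have h2 : s n' ∈ U.endsAbove (κ (s n)) := hnn ▸ (hex _ (hs1 n')).2
          have htop' : ∀ p ∈ U.endsAbove (κ (s n)), ¬ r p (s n') := hnn ▸ htop n'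
          by_cases hd : κ (s n) ∈ U.dots
          · obtain ⟨r', -, hp⟩ := hker _ hd
            have e1 : s n = r' := by_contra fun h => by
              obtain ⟨p, hp1, hp2⟩ := hp _ h1 h
              exact htop n p hp1 hp2
            have e2 : s n' = r' := by_contra fun h => by
              obtain ⟨p, hp1, hp2⟩ := hp _ h2 h
              exact htop' p hp1 hp2
            exact e1.trans e2.symm
          · have hl : κ (s n) ∈ U.ends :=
              Or.inl ⟨not_not.1 hd, U.ne_root_of_ch (hex _ (hs1 n)).1⟩
            rw [U.endsAbove_of_mem_ends hl] at h1 h2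
            exact (show s n = _ from h1).trans (show s n' = _ from h2).symm
        by_contra hne
        have := Disj.split_disjoint hdisj n n' hne
        exact Set.disjoint_left.1 this (rootLabel_mem (hs2 n)) (hst ▸ rootLabel_mem (hs2 n'))
      -- Above every vertex there is a leaf or a null-dot, so each vertex immediately above `v`
      -- occurs as a colour.
      have hsurj : ∀ w, U.Ch v w → ∃ n, κ (s n) = w := by
        intro w hw
        obtain ⟨a, ha⟩ := U.exists_mem_endsAbove (U.ne_root_of_ch hw)
        obtain ⟨n, hn⟩ := hlabY a ((U.mem_endsAbove_iff he a).2 ⟨w, hw, ha⟩)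
        exact ⟨n, ((hs3 n).subset hn).2.symm.trans (hκ hw ha)⟩
      have hne : ¬ IsEmpty Y.1.split.1.Nodes := by
        rw [U.mem_ends_iff hv] at he
        push Not at he
        obtain ⟨w, hw⟩ := he
        obtain ⟨n, -⟩ := hsurj w hw
        exact fun h => h.false n
      refine ⟨.node (P := P.plusPoly) (C := fun _ => U.V) (toObj Y).1 v N, rfl,
        ⟨hvd, fun n n' hnn => hinj ?_, fun w => ⟨fun hw => ?_, ?_⟩, hN2⟩, ?_⟩
      · exact (hN1 n).symm.trans (hnn.trans (hN1 n'))
      · obtain ⟨n, hn⟩ := hsurj w hw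
        exact ⟨n, (hN1 n).trans hn⟩
      · rintro ⟨n, rfl⟩
        exact (congrArg (U.Ch v) (hN1 n)).mpr (hex _ (hs1 n)).1
      · refine (blowupObj_node (R := (toObj Y).1) hne v N).trans (Eq.trans ?_ hY)
        congr 1
        refine Eq.trans ?_ (ofObj_toObj Y)
        exact congrArg ofObj (Sigma.ext rfl (heq_of_eq (funext hN3)))

end

end PolyMonad

end Opetopes

/-! ### Deleting unary dots from a rooted tree. -/

namespace Opetopes

open Relation

namespace FTree

variable (U : FTree)

/-- The vertices of `W` are dots with exactly one input edge. -/
def IsWhite (W : Set U.V) : Prop :=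
  ∀ w ∈ W, w ∈ U.dots ∧ ∃ c, U.Ch w c ∧ ∀ c', U.Ch w c' → c' = c

/-- Go up one edge from a vertex of `W`. -/
def Pass (W : Set U.V) (a b : U.V) : Prop := a ∈ W ∧ U.Ch a b

/-- `v` is the first vertex outside `W` above an input edge of `u`. -/
def Skip (W : Set U.V) (u v : U.V) : Prop := ∃ x, U.Ch u x ∧ ReflTransGen (U.Pass W) x v

variable {U} {W : Set U.V}

/-- The two chains of vertices of `W` ending at `v` are comparable. If one were strictly longer, it
would run through the starting point of the other, which lies outside `W`. -/
theorem Skip.unique {p p' v : U.V} (hp : p ∉ W) (hp' : p' ∉ W) (h : U.Skip W p v)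
    (h' : U.Skip W p' v) : p = p' := by
  have key : ∀ {p p' x x' : U.V}, p' ∉ W → U.Ch p x → U.Ch p' x' →
      ReflTransGen (U.Pass W) x x' → p = p' := by
    intro p p' x x' hp' hx hx' hxx
    rcases ReflTransGen.cases_tail hxx with h | ⟨c, -, h⟩
    · subst h; exact U.ch_unique _ _ _ hx hx'
    · exact absurd (U.ch_unique _ _ _ h.2 hx' ▸ h.1) hp'
  obtain ⟨x, hx, hxv⟩ := h
  obtain ⟨x', hx', hxv'⟩ := h'
  rcases reflTransGen_comparable (fun p p' v h h' => U.ch_unique p p' v h.2 h'.2) hxv hxv' with h | h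
  · exact key hp' hx hx' h
  · exact (key hp hx' hx h).symm

theorem exists_pass (hW : U.IsWhite W) (x : U.V) :
    ∃ v, v ∉ W ∧ ReflTransGen (U.Pass W) x v := by
  induction x using U.wf_ch_swap.induction with
  | _ x ih =>
    by_cases hx : x ∈ W
    · obtain ⟨-, c, hc, -⟩ := hW x hx
      obtain ⟨v, hv, hcv⟩ := ih c hc
      exact ⟨v, hv, hcv.head ⟨hx, hc⟩⟩
    · exact ⟨x, hx, .refl⟩

theorem pass_unique (hW : U.IsWhite W) {x v v' : U.V} (hv : v ∉ W) (hv' : v' ∉ W)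
    (h : ReflTransGen (U.Pass W) x v) (h' : ReflTransGen (U.Pass W) x v') : v = v' := by
  induction h using ReflTransGen.head_induction_on with
  | refl =>
    rcases ReflTransGen.cases_head h' with h | ⟨c, h, -⟩
    · exact h
    · exact absurd h.1 hv
  | head hp _ ih =>
    rcases ReflTransGen.cases_head h' with h | ⟨c, hc, h2⟩
    · exact absurd (h ▸ hp.1) hv'
    · obtain ⟨d, -, hd⟩ := (hW _ hp.1).2
      rw [hd _ hp.2] at ih
      rw [hd _ hc.2] at h2
      exact ih h2

theorem exists_skip (hW : U.IsWhite W) {v : U.V} (hv : v ≠ U.root) :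
    ∃ p, p ∉ W ∧ U.Skip W p v := by
  induction v using U.wf_ch.induction with
  | _ v ih =>
    obtain ⟨p, hp⟩ := U.exists_ch hv
    by_cases hpW : p ∈ W
    · obtain ⟨q, hq, x, hx, hxp⟩ := ih p hp (U.ne_root_of_dot (hW p hpW).1)
      exact ⟨q, hq, x, hx, hxp.tail ⟨hpW, hp⟩⟩
    · exact ⟨p, hpW, v, hp, .refl⟩

theorem Pass.reach {x v : U.V} (h : ReflTransGen (U.Pass W) x v) : ReflTransGen U.Ch x v :=
  ReflTransGen.mono (fun _ _ h => h.2) _ _ h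

theorem Skip.transGen {u v : U.V} (h : U.Skip W u v) : TransGen U.Ch u v := by
  obtain ⟨x, hx, hxv⟩ := h
  exact TransGen.head' hx (Pass.reach hxv)

theorem Skip.ne_root {u v : U.V} (h : U.Skip W u v) : v ≠ U.root := by
  rintro rfl
  rcases TransGen.tail'_iff.1 h.transGen with ⟨c, -, hc⟩
  exact U.not_ch_root c hc

theorem IsWhite.root_notMem (hW : U.IsWhite W) : U.root ∉ W :=
  fun h => (hW _ h).1 U.isTree.root_mem

theorem reach_skip (hW : U.IsWhite W) (v : {v : U.V // v ∉ W}) :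
    ReflTransGen (fun a b : {v : U.V // v ∉ W} => U.Skip W a b) ⟨U.root, hW.root_notMem⟩ v := by
  obtain ⟨v, hv⟩ := v
  induction v using U.wf_ch.transGen.induction with
  | _ v ih =>
    by_cases h : v = U.root
    · subst h; exact .refl
    · obtain ⟨p, hp, hpv⟩ := exists_skip hW h
      exact (ih p hpv.transGen hp).tail hpv

variable (U) in
/-- Delete the dots in `W`, each of which has one input edge. -/
def erased (W : Set U.V) (hW : U.IsWhite W) : FTree where
  V := {v : U.V // v ∉ W}
  G := SimpleGraph.fromRel fun a b => U.Skip W a b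
  bdry := {v | v.1 ∈ U.bdry}
  root := ⟨U.root, hW.root_notMem⟩
  isTree := by
    have h0 : ∀ v : {v : U.V // v ∉ W}, ¬ U.Skip W v U.root := fun v h => h.ne_root rfl
    have h1 : ∀ p p' v : {v : U.V // v ∉ W}, U.Skip W p v → U.Skip W p' v → p = p' :=
      fun p p' v h h' => Subtype.ext (Skip.unique p.2 p'.2 h h')
    have := U.isTree.finite
    refine ⟨inferInstanceAs (Finite {v : U.V // v ∉ W}),
      isTree_fromRel (r := ⟨U.root, hW.root_notMem⟩) h0 h1 (reach_skip hW),
      U.isTree.root_mem, ?_⟩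
    rintro ⟨v, hv⟩ (hb : v ∈ U.bdry)
    rw [RootedGraph.valence, Set.ncard_eq_one]
    have hadj := fromRel_adj_iff (r := ⟨U.root, hW.root_notMem⟩) h0 h1 (reach_skip hW)
    by_cases hr : v = U.root
    · subst hr
      obtain ⟨c, hc, hu⟩ := U.exists_root_ch
      obtain ⟨w, hw, hcw⟩ := exists_pass hW c
      refine ⟨⟨w, hw⟩, Set.ext fun y => ?_⟩
      refine (hadj _ _).trans ⟨?_, ?_⟩
      · rintro (⟨x, hx, hxy⟩ | h)
        · rw [hu _ hx] at hxy
          exact Subtype.ext (pass_unique hW y.2 hw hxy hcw)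
        · exact absurd h (h0 _)
      · rintro rfl
        exact Or.inl ⟨c, hc, hcw⟩
    · obtain ⟨p, hp, hpv⟩ := exists_skip hW hr
      refine ⟨⟨p, hp⟩, Set.ext fun y => ?_⟩
      refine (hadj _ _).trans ⟨?_, ?_⟩
      · rintro (⟨x, hx, -⟩ | h)
        · exact absurd hx (U.not_ch_of_bdry hb hr x)
        · exact h1 _ _ _ h hpv
      · rintro rfl
        exact Or.inr hpv

theorem ch_erased (hW : U.IsWhite W) (a b : {v : U.V // v ∉ W}) :
    (U.erased W hW).Ch a b ↔ U.Skip W a b :=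
  ch_fromRel (U.erased W hW) rfl (fun _ h => h.ne_root rfl)
    (fun p p' _ h h' => Subtype.ext (Skip.unique p.2 p'.2 h h')) (reach_skip hW) a b

theorem exists_walk {x v : U.V} (h : ReflTransGen (U.Pass W) x v) :
    ∃ p : U.G.Walk x v, ∀ y ∈ p.support, y ∈ W ∨ y = v := by
  induction h using ReflTransGen.head_induction_on with
  | refl => exact ⟨.nil, by simp⟩
  | head h _ ih =>
    obtain ⟨p, hp⟩ := ih
    refine ⟨.cons h.2.1 p, fun y hy => ?_⟩
    rcases List.mem_cons.1 hy with rfl | hy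
    · exact Or.inl h.1
    · exact hp y hy

theorem exists_path_of_skip {u v : U.V} (h : U.Skip W u v) :
    ∃ p : U.G.Walk u v, p.IsPath ∧ ∀ y ∈ p.support, y ∉ W → y = u ∨ y = v := by
  classical
  obtain ⟨x, hx, hxv⟩ := h
  obtain ⟨p, hp⟩ := exists_walk hxv
  refine ⟨(SimpleGraph.Walk.cons hx.1 p).bypass, SimpleGraph.Walk.bypass_isPath _, fun y hy hyW => ?_⟩
  rcases List.mem_cons.1 (SimpleGraph.Walk.support_bypass_subset_support _ hy) with rfl | hy
  · exact Or.inl rfl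
  · exact Or.inr ((hp y hy).resolve_left hyW)

/-- Induction on the path: all inner vertices are in `W` and so have one parent and one child, and
in each of the four cases the direction of the first edge combines with that of the remaining path.
Only the end vertex is required to lie outside `W`, since the induction starts again from vertices
of `W`. -/
theorem skip_of_path (hW : U.IsWhite W) {u v : U.V} (hv : v ∉ W) (p : U.G.Walk u v)
    (hp : p.IsPath) (h : ∀ y ∈ p.support, y ∉ W → y = u ∨ y = v) (huv : u ≠ v) :
    U.Skip W u v ∨ U.Skip W v u := by
  induction p with
  | nil => exact absurd rfl huv
  | @cons a b v hab p ih =>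
    rw [SimpleGraph.Walk.cons_isPath_iff] at hp
    by_cases hbv : b = v
    · subst hbv
      exact (U.ch_or_ch_of_adj hab).imp (fun h => ⟨_, h, .refl⟩) fun h => ⟨_, h, .refl⟩
    · have hbW : b ∈ W := by
        by_contra hbW
        rcases h b (List.mem_cons_of_mem _ p.start_mem_support) hbW with h | h
        · exact hab.ne h.symm
        · exact hbv h
      have ih := ih hv hp.1 (fun y hy hyW => by
        rcases h y (List.mem_cons_of_mem _ hy) hyW with rfl | h
        -- Here the path being simple is used: it does not return to its first vertex.
        · exact absurd hy hp.2
        · exact Or.inr h) hbv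
      rcases U.ch_or_ch_of_adj hab with hc | hc
      · rcases ih with ⟨x, hx, hxv⟩ | ⟨x, hx, hxv⟩
        · exact Or.inl ⟨b, hc, hxv.head ⟨hbW, hx⟩⟩
        · rcases ReflTransGen.cases_tail hxv with h | ⟨c, hxc, h⟩
          · subst h
            exact absurd (U.ch_unique _ _ _ hc hx) huv
          · obtain rfl := U.ch_unique _ _ _ h.2 hc
            exact Or.inr ⟨x, hx, hxc⟩
      · rcases ih with ⟨x, hx, hxv⟩ | ⟨x, hx, hxv⟩
        · obtain ⟨-, d, -, hd⟩ := hW b hbW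
          obtain rfl := (hd _ hx).trans (hd _ hc).symm
          rcases ReflTransGen.cases_head hxv with h | ⟨c, h, h'⟩
          · exact absurd h huv
          · exact Or.inl ⟨c, h.2, h'⟩
        · exact Or.inr ⟨x, hx, hxv.tail ⟨hbW, hc⟩⟩

theorem adj_erased (hW : U.IsWhite W) (a b : {v : U.V // v ∉ W}) :
    (U.erased W hW).G.Adj a b ↔ a.1 ≠ b.1 ∧ ∃ p : U.G.Walk a b, p.IsPath ∧
      ∀ y ∈ p.support, y ∉ W → y = a.1 ∨ y = b.1 := by
  constructor
  · intro h
    refine ⟨fun h' => h.ne (Subtype.ext h'), ?_⟩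
    rcases ((U.erased W hW).adj_iff_ch).1 h with h | h
    · exact exists_path_of_skip ((ch_erased hW a b).1 h)
    · obtain ⟨p, hp, hp'⟩ := exists_path_of_skip ((ch_erased hW b a).1 h)
      exact ⟨p.reverse, hp.reverse, fun y hy hyW =>
        (hp' y (by simpa using hy) hyW).symm⟩
  · rintro ⟨hne, p, hp, hp'⟩
    exact ((U.erased W hW).adj_iff_ch).2 ((skip_of_path hW b.2 p hp hp' hne).imp
      (ch_erased hW a b).2 (ch_erased hW b a).2)

end FTree

/-! ### Subdivisions as the inverse of deleting unary dots. -/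

namespace Subdivision

variable {T : FTree} (S : Subdivision T.toRootedGraph)

theorem isWhite : S.tree.IsWhite S.white := fun w hw =>
  ⟨(S.white_dot w hw).1, (S.tree.valence_eq_two_iff (S.white_dot w hw).1).1 (S.white_dot w hw).2⟩

/-- A subdivided tree is recovered by deleting the white dots. -/
theorem exists_iso : ∃ e : T.Iso (S.tree.erased S.white S.isWhite).toRootedGraph,
    ∀ v, (e v).1 = S.emb v := by
  have hr : ∀ y : S.tree.V, y ∉ S.white ↔ y ∈ Set.range S.emb := fun y => not_not
  let e : T.V ≃ {v : S.tree.V // v ∉ S.white} := Equiv.ofBijective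
    (fun v => ⟨S.emb v, (hr _).2 ⟨v, rfl⟩⟩)
    ⟨fun a b h => S.emb.injective (congrArg Subtype.val h), fun ⟨y, hy⟩ => by
      obtain ⟨v, rfl⟩ := (hr y).1 hy
      exact ⟨v, rfl⟩⟩
  refine ⟨⟨⟨e, fun {a b} => ?_⟩, Subtype.ext S.emb_root, S.emb_bdry⟩, fun v => rfl⟩
  refine (FTree.adj_erased S.isWhite (e a) (e b)).trans (Iff.trans ?_ (S.adj_iff a b).symm)
  refine and_congr (not_congr S.emb.injective.eq_iff) ?_
  simp only [hr]
  rfl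

/-- A tree from which dots with one input edge have been deleted is subdivided by these dots. -/
def ofErased (U : FTree) (W : Set U.V) (hW : U.IsWhite W) {T : FTree}
    (e : T.Iso (U.erased W hW).toRootedGraph) : Subdivision T.toRootedGraph :=
  have hr : ∀ y, y ∈ Set.range (fun v => (e v).1) ↔ y ∉ W := fun y =>
    ⟨fun ⟨v, hv⟩ => hv ▸ (e v).2, fun h => ⟨e.toIso.symm ⟨y, h⟩,
      congrArg Subtype.val (e.toIso.apply_symm_apply ⟨y, h⟩)⟩⟩
  { tree := U
    emb := ⟨fun v => (e v).1, fun _ _ h => e.toIso.injective (Subtype.ext h)⟩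
    emb_root := congrArg Subtype.val e.map_root
    emb_bdry := e.map_bdry
    white_dot := fun w hw => by
      have h := hW w (not_not.1 fun h => hw ((hr w).2 h))
      exact ⟨h.1, (U.valence_eq_two_iff h.1).2 h.2⟩
    adj_iff := fun u v => by
      refine (e.toIso.map_adj_iff).symm.trans ((FTree.adj_erased hW _ _).trans ?_)
      refine and_congr (not_congr ⟨fun h => e.toIso.injective (Subtype.ext h), fun h => h ▸ rfl⟩) ?_
      refine exists_congr fun p => and_congr_right fun _ => forall₂_congr fun y _ => ?_
      exact imp_congr (hr y).symm Iff.rfl }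

theorem mem_white_ofErased {U : FTree} {W : Set U.V} {hW : U.IsWhite W}
    (e : T.Iso (U.erased W hW).toRootedGraph) (y : U.V) : y ∈ (ofErased U W hW e).white ↔ y ∈ W := by
  refine ⟨fun h => not_not.1 fun h' => h ⟨e.toIso.symm ⟨y, h'⟩,
      congrArg Subtype.val (e.toIso.apply_symm_apply ⟨y, h'⟩)⟩, ?_⟩
  rintro h ⟨v, rfl⟩
  exact (e v).2 h

end Subdivision

end Opetopes

/-! ### Erasing unit dots from decorated trees, compared with deletion on graphs. -/

namespace Opetopes

open Relation

namespace PolyMonad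

open DTree

variable {P : PolyMonad} {C : (Σ i, P.Op i) → Type} {X Y : P.I → Type} {V V' : Type}

/-- Since the unit is cartesian, a family over the inputs of a unit operation amounts to a single
value. For a dot with a unit operation this value is the one tree grafted on it. -/
theorem exists_unit_eq {x : Σ i, P.Op i} (h : P.IsUnitOp x) (k : ∀ a : P.Ar x.2, X (P.src a)) :
    ∃ z : X x.1, P.unit z = ⟨x.2, k⟩ := by
  obtain ⟨z, ⟨-, hz⟩, -⟩ := P.unit_cart (X := X) (Y := fun _ => Unit) (fun _ _ => ()) (i := x.1) ()
    ⟨x.2, k⟩ (obj_unit _ h).symm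
  exact ⟨z, hz⟩

theorem IsUnitOp.exists_eq {i : P.I} (z : X i) :
    ∃ (b : P.Op i) (k : ∀ a : P.Ar b, X (P.src a)), P.IsUnitOp ⟨i, b⟩ ∧ P.unit z = ⟨b, k⟩ := by
  obtain ⟨k, hk⟩ := exists_arity_of_contractD_leaf z
  exact ⟨_, k, rfl, hk⟩

theorem subst_node_plusUnit {i : P.I} {b : P.Op i} (c : C ⟨i, b⟩)
    (f : ∀ e : P.Ar b, DTree P.toPoly (P.PlusObj C) X (P.src e)) :
    subst (.node b (plusUnit c) f) = .node b c fun e => subst (f e) := by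
  have h : fill (plusUnit (P := P) c) (fun e => subst (f e)) =
      .node b c fun e => .leaf (subst (f e)) := by
    symm
    refine eq_fill _ _ _ rfl ?_
    exact P.join_map_unit (X := DTree P.toPoly C X) ⟨b, fun e => subst (f e)⟩
  rw [subst, h]
  rfl

theorem subst_node_unitTree {i : P.I} {b : P.Op i} (h : P.IsUnitOp ⟨i, b⟩)
    {f : ∀ e : P.Ar b, DTree P.toPoly (P.PlusObj C) X (P.src e)}
    {z : DTree P.toPoly (P.PlusObj C) X i} (hz : P.unit z = ⟨b, f⟩) :
    subst (.node b (unitTree h) f) = subst z := by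
  have h : fill (unitTree (C := C) h) (fun e => subst (f e)) = .leaf (subst z) := by
    symm
    refine eq_fill _ _ _ rfl ?_
    have h := P.unit_nat (X := DTree P.toPoly (P.PlusObj C) X) (fun _ => subst) z
    rw [hz] at h
    exact h.symm
  rw [subst, h]
  rfl

section

variable {W : Set V} {i : P.I}

theorem erase_node_of_notMem {b : P.Op i} {c : V}
    (f : ∀ e : P.Ar b, DTree P.toPoly (fun _ => V) X (P.src e)) (hc : c ∉ W) :
    erase W (.node b c f) = .node b c fun e => erase W (f e) := by
  rw [erase, mapDec, eraser_neg hc, subst_node_plusUnit]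
  rfl

theorem erase_node_of_mem {b : P.Op i} {c : V}
    {f : ∀ e : P.Ar b, DTree P.toPoly (fun _ => V) X (P.src e)} (hc : c ∈ W)
    (hb : P.IsUnitOp ⟨i, b⟩) {z : DTree P.toPoly (fun _ => V) X i} (hz : P.unit z = ⟨b, f⟩) :
    erase W (.node b c f) = erase W z := by
  rw [erase, mapDec, eraser_pos hc hb]
  refine subst_node_unitTree hb ?_
  refine (P.unit_nat (X := DTree P.toPoly (fun _ => V) X) (fun _ => mapDec (eraser W)) z).symm.trans ?_
  rw [hz]
  rfl

theorem erase_map (g : ∀ i, X i → Y i) (D : DTree P.toPoly (fun _ => V) X i) :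
    erase W (D.map g) = (erase W D).map g := by
  rw [erase, erase, ← subst_nat, map_mapDec]

theorem contractD_erase (D : DTree P.toPoly (fun _ => V) X i) :
    P.contractD (erase W D) = P.contractD D := by
  rw [erase, contractD_subst, contractD_mapDec]

theorem erase_mapDec (h : V → V') (W : Set V') (D : DTree P.toPoly (fun _ => V) X i) :
    erase W (D.mapDec fun _ => h) = (erase (h ⁻¹' W) D).mapDec fun _ => h := by
  rw [erase, erase, mapDec_mapDec, subst_mapDec, mapDec_mapDec]
  congr 2
  funext x v
  by_cases hv : h v ∈ W
  · by_cases hx : P.IsUnitOp x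
    · rw [eraser_pos hv hx, eraser_pos (show v ∈ h ⁻¹' W from hv) hx]; rfl
    · rw [eraser, dif_neg fun h => hx h.2, eraser, dif_neg fun h => hx h.2]; rfl
  · rw [eraser_neg hv, eraser_neg (show v ∉ h ⁻¹' W from hv)]; rfl

theorem erase_relabel (h : V → V') (W : Set V') (D : DTree P.toPoly (fun _ => V) (fun _ => V) i) :
    erase W (D.relabel h) = (erase (h ⁻¹' W) D).relabel h := by
  rw [relabel, erase_mapDec, erase_map]
  rfl

theorem erase_congr {W W' : Set V} {D : DTree P.toPoly (fun _ => V) X i}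
    (h : AllNode (fun _ w => w ∈ W ↔ w ∈ W') D) : erase W D = erase W' D := by
  rw [erase, erase, (mapDec_congr_iff _ _ _).2]
  refine h.mono fun x w hw => ?_
  by_cases h' : w ∈ W
  · by_cases hx : P.IsUnitOp x
    · rw [eraser_pos h' hx, eraser_pos (hw.1 h') hx]
    · rw [eraser, dif_neg fun h => hx h.2, eraser, dif_neg fun h => hx h.2]
  · rw [eraser_neg h', eraser_neg (hw.not.1 h')]

/-- The eraser keeps a dot labelled in `W` unless its operation is a unit, so the absence of such
labels afterwards reveals that all of them carried units. -/
theorem isUnitOp_of_erase {D : DTree P.toPoly (fun _ => V) X i}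
    (h : AllNode (fun _ w => w ∉ W) (erase W D)) :
    AllNode (fun x w => w ∈ W → P.IsUnitOp x) D := by
  rw [erase, allNode_subst, allNode_mapDec] at h
  refine h.mono fun x w hw hwW => ?_
  by_contra hx
  rw [eraser, dif_neg fun h => hx h.2] at hw
  exact hw.1 hwW

end

section

variable {U : FTree} {W : Set U.V} {i : P.I}

/-- A dot in `W` carries a unit operation and hence a single branch, so erasing it moves the root
label one step up along `U.Pass W`. The accumulated steps between two remaining dots form a `U.Skip
W`, the child relation after deletion. -/
theorem exists_erase (hW : U.IsWhite W) {D : DTree P.toPoly (fun _ => U.V) (fun _ => U.V) i}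
    (h : IsRepr U.toRootedGraph D) (hu : AllNode (fun x w => w ∈ W → P.IsUnitOp x) D) :
    ∃ E : DTree P.toPoly (fun _ => {v // v ∉ W}) (fun _ => {v // v ∉ W}) i,
      IsRepr (U.erased W hW).toRootedGraph E ∧ erase W D = E.relabel Subtype.val ∧
      ReflTransGen (U.Pass W) D.vlabel E.vlabel := by
  induction D with
  | leaf x =>
    have hx : x ∉ W := fun hx => (hW x hx).1 h.1
    exact ⟨.leaf ⟨x, hx⟩, ⟨h.1, fun h' => h.2 (congrArg Subtype.val h')⟩, rfl, .refl⟩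
  | @node i b c f ih =>
    by_cases hc : c ∈ W
    · have hb := hu.1 hc
      obtain ⟨z, hz⟩ := exists_unit_eq (X := DTree P.toPoly (fun _ => U.V) (fun _ => U.V)) hb f
      -- The property is phrased with the fixed starting vertex `c`, so that it can pass by
      -- `unit_forall` from the branch at the input to the tree `z` that replaces the dot.
      let Q : ∀ i, DTree P.toPoly (fun _ => U.V) (fun _ => U.V) i → Prop := fun i D =>
        ∃ E : DTree P.toPoly (fun _ => {v // v ∉ W}) (fun _ => {v // v ∉ W}) i,
          IsRepr (U.erased W hW).toRootedGraph E ∧ erase W D = E.relabel Subtype.val ∧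
          ReflTransGen (U.Pass W) c E.vlabel
      obtain ⟨E, h1, h2, h3⟩ : Q i z := (unit_forall hz Q).2 fun a => by
        obtain ⟨E, h1, h2, h3⟩ := ih a (h.2.2.2 a) (hu.2 a)
        exact ⟨E, h1, h2, h3.head ⟨hc, (h.2.2.1 _).2 ⟨a, rfl⟩⟩⟩
      exact ⟨E, h1, (erase_node_of_mem hc hb hz).trans h2, h3⟩
    · choose E h1 h2 h3 using fun a => ih a (h.2.2.2 a) (hu.2 a)
      have hsk : ∀ a, U.Skip W c (E a).vlabel := fun a => ⟨_, (h.2.2.1 _).2 ⟨a, rfl⟩, h3 a⟩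
      refine ⟨.node (C := fun _ => {v // v ∉ W}) b ⟨c, hc⟩ E, ⟨h.1, fun a a' haa => h.2.1 ?_,
        fun w => ?_, h1⟩, ?_, .refl⟩
      · have haa : (E a).vlabel = (E a').vlabel := haa
        refine eq_of_siblings U.ch_unique U.not_transGen_ch ((h.2.2.1 _).2 ⟨a, rfl⟩)
          ((h.2.2.1 _).2 ⟨a', rfl⟩) (FTree.Pass.reach (h3 a)) ?_
        rw [haa]
        exact FTree.Pass.reach (h3 a')
      · refine (FTree.ch_erased hW ⟨c, hc⟩ w).trans ⟨?_, ?_⟩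
        · rintro ⟨x, hx, hxw⟩
          obtain ⟨a, rfl⟩ := (h.2.2.1 _).1 hx
          exact ⟨a, Subtype.ext (FTree.pass_unique hW (E a).vlabel.2 w.2 (h3 a) hxw)⟩
        · rintro ⟨a, rfl⟩
          exact hsk a
      · rw [erase_node_of_notMem _ hc]
        exact congrArg (DTree.node (C := fun _ => U.V) b c) (funext h2)

/-- Read backwards, each step of `U.Pass W` is filled by inserting a dot with a unit operation,
which erasing removes again. -/
theorem exists_erase_eq (hW : U.IsWhite W)
    {E : DTree P.toPoly (fun _ => {v // v ∉ W}) (fun _ => {v // v ∉ W}) i}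
    (h : IsRepr (U.erased W hW).toRootedGraph E) {x : U.V}
    (hx : ReflTransGen (U.Pass W) x E.vlabel) :
    ∃ D : DTree P.toPoly (fun _ => U.V) (fun _ => U.V) i,
      D.vlabel = x ∧ IsRepr U.toRootedGraph D ∧ erase W D = E.relabel Subtype.val := by
  have key : ∀ {i : P.I} {E : DTree P.toPoly (fun _ => {v // v ∉ W}) (fun _ => {v // v ∉ W}) i}
      {x y : U.V}, ReflTransGen (U.Pass W) x y →
      (∃ D : DTree P.toPoly (fun _ => U.V) (fun _ => U.V) i,
        D.vlabel = y ∧ IsRepr U.toRootedGraph D ∧ erase W D = E.relabel Subtype.val) →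
      ∃ D : DTree P.toPoly (fun _ => U.V) (fun _ => U.V) i,
        D.vlabel = x ∧ IsRepr U.toRootedGraph D ∧ erase W D = E.relabel Subtype.val := by
    intro i E x y hxy hD
    induction hxy using ReflTransGen.head_induction_on with
    | refl => exact hD
    | @head x x' hp _ ih =>
      obtain ⟨D, h1, h2, h3⟩ := ih
      -- The inserted dot `x` carries the unit operation `b`, with `D` on its only input.
      obtain ⟨b, k, hb, hk⟩ := IsUnitOp.exists_eq (P := P) D
      have hv : ∀ a, (k a).vlabel = x' := (unit_forall hk fun _ D => D.vlabel = x').1 h1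
      have hr : ∀ a, IsRepr U.toRootedGraph (k a) :=
        (unit_forall hk fun _ D => IsRepr U.toRootedGraph D).1 h2
      obtain ⟨hd, d, -, hd'⟩ := hW x hp.1
      refine ⟨.node (C := fun _ => U.V) b x k, rfl, ⟨hd, fun a a' _ =>
        (subsingleton_arity_unit hk).elim a a', fun w => ⟨fun hw => ?_, ?_⟩, hr⟩,
        (erase_node_of_mem hp.1 hb hk).trans h3⟩
      · obtain ⟨a⟩ := nonempty_arity_unit hk
        exact ⟨a, (hv a).trans ((hd' _ hp.2).trans (hd' _ hw).symm)⟩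
      · rintro ⟨a, rfl⟩
        rw [hv a]
        exact hp.2
  induction E generalizing x with
  | leaf y =>
    exact key hx ⟨.leaf y.1, rfl, ⟨h.1, fun h' => h.2 (Subtype.ext h')⟩, rfl⟩
  | node b c f ih =>
    refine key hx ?_
    have hch : ∀ e, U.Skip W c (f e).vlabel := fun e =>
      (FTree.ch_erased hW _ _).1 ((h.2.2.1 _).2 ⟨e, rfl⟩)
    choose y hy hyv using hch
    choose D h1 h2 h3 using fun e => ih e (h.2.2.2 e) (hyv e)
    refine ⟨.node (C := fun _ => U.V) b c.1 D, rfl, ⟨h.1, fun e e' hee => h.2.1 ?_,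
      fun w => ⟨fun hw => ?_, ?_⟩, h2⟩, ?_⟩
    · have hee : (D e).vlabel = (D e').vlabel := hee
      rw [h1, h1] at hee
      exact Subtype.ext (FTree.pass_unique hW (f e).vlabel.2 (f e').vlabel.2 (hyv e) (hee ▸ hyv e'))
    · obtain ⟨v, hv, hwv⟩ := FTree.exists_pass hW w
      obtain ⟨e, he⟩ := (h.2.2.1 ⟨v, hv⟩).1 ((FTree.ch_erased hW _ _).2 ⟨w, hw, hwv⟩)
      refine ⟨e, (h1 e).trans ?_⟩
      refine eq_of_siblings U.ch_unique U.not_transGen_ch (hy e) hw (FTree.Pass.reach (hyv e)) ?_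
      exact (congrArg (fun q : {v // v ∉ W} => ReflTransGen U.Ch w q.1) he).mpr (FTree.Pass.reach hwv)
    · rintro ⟨e, rfl⟩
      rw [h1]
      exact hy e
    · rw [erase_node_of_notMem _ c.2]
      exact congrArg (DTree.node (C := fun _ => U.V) b c.1) (funext h3)

/-- A labelled tree with white dots is determined by the tree without the white dots. -/
theorem IsRepr.eq_of_erase_eq (hW : U.IsWhite W)
    {D D' : DTree P.toPoly (fun _ => U.V) (fun _ => U.V) i}
    (h : IsRepr U.toRootedGraph D) (h' : IsRepr U.toRootedGraph D')
    (hu : AllNode (fun x w => w ∈ W → P.IsUnitOp x) D)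
    (hu' : AllNode (fun x w => w ∈ W → P.IsUnitOp x) D') (hv : D.vlabel = D'.vlabel)
    (he : erase W D = erase W D') : D = D' := by
  induction D with
  | leaf x =>
    cases D' with
    | leaf x' => exact congrArg DTree.leaf hv
    | node b c f => exact absurd ((show x = c from hv) ▸ h.1) h'.1
  | @node i b c f ih =>
    cases D' with
    | leaf x' => exact absurd ((show x' = c from hv.symm) ▸ h'.1) h.1
    | node b' c' f' =>
      obtain rfl : c = c' := hv
      -- If `c` is erased, the operation and the erased branches are the unit applied to the erased
      -- tree, by naturality; if it is kept, they are visible at the root.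
      have key : (⟨b, fun e => erase W (f e)⟩ : P.Obj (DTree P.toPoly (fun _ => U.V) fun _ => U.V) i) =
          ⟨b', fun e => erase W (f' e)⟩ := by
        by_cases hc : c ∈ W
        · obtain ⟨z, hz⟩ := exists_unit_eq (X := DTree P.toPoly (fun _ => U.V) fun _ => U.V) (hu.1 hc) f
          obtain ⟨z', hz'⟩ := exists_unit_eq (X := DTree P.toPoly (fun _ => U.V) fun _ => U.V) (hu'.1 hc) f'
          rw [erase_node_of_mem hc (hu.1 hc) hz, erase_node_of_mem hc (hu'.1 hc) hz'] at he
          have h1 := P.unit_nat (X := DTree P.toPoly (fun _ => U.V) fun _ => U.V)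
            (fun _ => erase (X := fun _ => U.V) W) z
          have h2 := P.unit_nat (X := DTree P.toPoly (fun _ => U.V) fun _ => U.V)
            (fun _ => erase (X := fun _ => U.V) W) z'
          rw [hz] at h1
          rw [hz', ← he] at h2
          exact h1.trans h2.symm
        · rw [erase_node_of_notMem _ hc, erase_node_of_notMem _ hc] at he
          obtain ⟨rfl, -, h2⟩ := DTree.node.inj he
          exact Sigma.ext rfl h2
      obtain rfl : b = b' := congrArg Sigma.fst key
      have key := congrFun (eq_of_heq (Sigma.ext_iff.1 key).2)
      refine congrArg (DTree.node (C := fun _ => U.V) b c) (funext fun e =>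
        ih e (h.2.2.2 e) (h'.2.2.2 e) (hu.2 e) (hu'.2 e) ?_ (key e))
      -- Both branch roots lie above `c` and below the same vertex outside `W`, the root label of
      -- the common erased tree, so they are equal as siblings.
      obtain ⟨E, -, h2, h3⟩ := exists_erase hW (h.2.2.2 e) (hu.2 e)
      obtain ⟨E', -, h2', h3'⟩ := exists_erase hW (h'.2.2.2 e) (hu'.2 e)
      have hE : (E.vlabel : U.V) = E'.vlabel := by
        refine (vlabel_relabel Subtype.val E).symm.trans (Eq.trans ?_ (vlabel_relabel Subtype.val E'))
        rw [← h2, ← h2']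
        exact congrArg vlabel (key e)
      refine eq_of_siblings U.ch_unique U.not_transGen_ch ((h.2.2.1 _).2 ⟨e, rfl⟩)
        ((h'.2.2.1 _).2 ⟨e, rfl⟩) (FTree.Pass.reach h3) ?_
      rw [hE]
      exact FTree.Pass.reach h3'

end

end PolyMonad

end Opetopes

/-! ### The dots of a subdivided tree named by the leaves and null-dots of the nesting. -/

namespace Opetopes

open Relation

namespace Constellation

variable {T U : FTree} (C : Constellation T U)

open Classical in
/-- The leaf or null-dot of the nesting that corresponds to a dot. -/
noncomputable def label (t : C.sub.tree.V) : U.V :=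
  if h : ∃ d : T.dots, C.sub.emb d = t then C.black h.choose
  else if h : t ∈ C.sub.white then C.white ⟨t, h⟩ else U.root

theorem label_emb (d : T.dots) : C.label (C.sub.emb d) = C.black d := by
  have h : ∃ d' : T.dots, C.sub.emb d' = C.sub.emb d := ⟨d, rfl⟩
  rw [label, dif_pos h]
  exact congrArg (fun d => (C.black d : U.V)) (Subtype.ext (C.sub.emb.injective h.choose_spec))

theorem label_white (w : C.sub.white) : C.label w = C.white w := by
  have h : ¬ ∃ d : T.dots, C.sub.emb d = (w : C.sub.tree.V) := fun ⟨d, hd⟩ => w.2 ⟨d, hd⟩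
  rw [label, dif_neg h, dif_pos w.2]

theorem dot_cases {t : C.sub.tree.V} (ht : t ∈ C.sub.tree.dots) :
    (∃ d : T.dots, C.sub.emb d = t) ∨ ∃ w : C.sub.white, (w : C.sub.tree.V) = t := by
  by_cases h : t ∈ C.sub.white
  · exact Or.inr ⟨⟨t, h⟩, rfl⟩
  · obtain ⟨v, rfl⟩ := not_not.1 h
    exact Or.inl ⟨⟨v, fun hv => ht ((C.sub.emb_bdry v).2 hv)⟩, rfl⟩

theorem emb_mem_dots (d : T.dots) : C.sub.emb d ∈ C.sub.tree.dots :=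
  fun h => d.2 ((C.sub.emb_bdry _).1 h)

theorem label_mem_ends {t : C.sub.tree.V} (ht : t ∈ C.sub.tree.dots) : C.label t ∈ U.ends := by
  rcases C.dot_cases ht with ⟨d, rfl⟩ | ⟨w, rfl⟩
  · exact Or.inl (C.label_emb d ▸ (C.black d).2)
  · exact Or.inr (C.label_white w ▸ (C.white w).2)

theorem label_mem_nullDots {t : C.sub.tree.V} (ht : t ∈ C.sub.tree.dots) :
    C.label t ∈ U.nullDots ↔ t ∈ C.sub.white := by
  rcases C.dot_cases ht with ⟨d, rfl⟩ | ⟨w, rfl⟩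
  · refine iff_of_false (fun h => ?_) fun h => h ⟨d, rfl⟩
    rw [C.label_emb] at h
    exact h.1 (C.black d).2.1
  · exact iff_of_true (C.label_white w ▸ (C.white w).2) w.2

theorem label_injOn : Set.InjOn C.label C.sub.tree.dots := by
  intro t ht t' ht' h
  rcases C.dot_cases ht with ⟨d, rfl⟩ | ⟨w, rfl⟩ <;> rcases C.dot_cases ht' with ⟨d', rfl⟩ | ⟨w', rfl⟩
  · rw [C.label_emb, C.label_emb] at h
    exact congrArg (fun d : T.dots => C.sub.emb d) (C.black.injective (Subtype.ext h))
  · rw [C.label_emb, C.label_white] at h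
    exact absurd (h ▸ (C.black d).2.1) (C.white w').2.1
  · rw [C.label_emb, C.label_white] at h
    exact absurd (h ▸ (C.black d').2.1) (C.white w).2.1
  · rw [C.label_white, C.label_white] at h
    exact congrArg Subtype.val (C.white.injective (Subtype.ext h))

theorem exists_label_eq {a : U.V} (ha : a ∈ U.ends) : ∃ t ∈ C.sub.tree.dots, C.label t = a := by
  rcases ha with ha | ha
  · refine ⟨_, C.emb_mem_dots (C.black.symm ⟨a, ha⟩), ?_⟩
    rw [C.label_emb, Equiv.apply_symm_apply]
  · refine ⟨_, (C.sub.white_dot _ (C.white.symm ⟨a, ha⟩).2).1, ?_⟩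
    rw [C.label_white, Equiv.apply_symm_apply]

/-- The dots labelled by `a` and `b` are adjacent. -/
def Adjacent (a b : U.V) : Prop :=
  ∃ t t', t ∈ C.sub.tree.dots ∧ t' ∈ C.sub.tree.dots ∧ C.label t = a ∧ C.label t' = b ∧
    C.sub.tree.Ch t t'

theorem adjacent_iff {t t' : C.sub.tree.V} (ht : t ∈ C.sub.tree.dots) (ht' : t' ∈ C.sub.tree.dots) :
    C.Adjacent (C.label t) (C.label t') ↔ C.sub.tree.Ch t t' := by
  constructor
  · rintro ⟨s, s', hs, hs', h, h', hc⟩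
    rwa [C.label_injOn hs ht h, C.label_injOn hs' ht' h'] at hc
  · exact fun h => ⟨t, t', ht, ht', rfl, rfl, h⟩

theorem adjacent_unique (p p' q : U.V) (h : C.Adjacent p q) (h' : C.Adjacent p' q) : p = p' := by
  obtain ⟨t, s, ht, hs, rfl, rfl, hc⟩ := h
  obtain ⟨t', s', ht', hs', rfl, h2, hc'⟩ := h'
  obtain rfl := C.label_injOn hs' hs h2
  rw [C.sub.tree.ch_unique _ _ _ hc hc']

theorem wellFounded_adjacent : WellFounded C.Adjacent := by
  classical
  -- A left inverse of the labelling on dots, with the root as junk value; it pulls well-foundedness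
  -- back from the subdivided tree.
  let g : U.V → C.sub.tree.V := fun a =>
    if h : ∃ t ∈ C.sub.tree.dots, C.label t = a then h.choose else C.sub.tree.root
  have hg : ∀ t ∈ C.sub.tree.dots, g (C.label t) = t := by
    intro t ht
    have h : ∃ t' ∈ C.sub.tree.dots, C.label t' = C.label t := ⟨t, ht, rfl⟩
    exact (dif_pos h).trans (C.label_injOn h.choose_spec.1 ht h.choose_spec.2)
  refine Subrelation.wf (r := InvImage C.sub.tree.Ch g) ?_ (InvImage.wf g C.sub.tree.wf_ch)
  rintro a b ⟨t, t', ht, ht', rfl, rfl, h⟩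
  change C.sub.tree.Ch _ _
  rwa [hg t ht, hg t' ht']

/-- In terms of labels, the black and the white dots inside a sphere have a uniform description, the
form in which `exists_blowupObj_eq` meets the kernel rule. -/
theorem kernel_eq (x : U.V) :
    ({t | ∃ d : T.dots, C.sub.emb d = t ∧ U.le (C.black d) x} ∪
      {t | ∃ w : C.sub.white, (w : C.sub.tree.V) = t ∧ U.le (C.white w) x}) =
    {t | t ∈ C.sub.tree.dots ∧ C.label t ∈ U.endsAbove x} := by
  ext t
  constructor
  · rintro (⟨d, rfl, h⟩ | ⟨w, rfl, h⟩)
    · refine ⟨C.emb_mem_dots d, C.label_mem_ends (C.emb_mem_dots d), ?_⟩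
      rw [C.label_emb]
      exact (U.le_iff _ _).1 h
    · have hd := (C.sub.white_dot _ w.2).1
      refine ⟨hd, C.label_mem_ends hd, ?_⟩
      rw [C.label_white]
      exact (U.le_iff _ _).1 h
  · rintro ⟨ht, h⟩
    rcases C.dot_cases ht with ⟨d, rfl⟩ | ⟨w, rfl⟩
    · rw [C.label_emb] at h
      exact Or.inl ⟨d, rfl, (U.le_iff _ _).2 h.2⟩
    · rw [C.label_white] at h
      exact Or.inr ⟨w, rfl, (U.le_iff _ _).2 h.2⟩

theorem exists_top {x : U.V} (hx : x ∈ U.dots) :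
    ∃ t ∈ U.endsAbove x, ∀ k ∈ U.endsAbove x, k ≠ t → ∃ p ∈ U.endsAbove x, C.Adjacent p k := by
  have h := C.kernel_rule x hx
  rw [C.kernel_eq, FTree.isKernel_iff] at h
  obtain ⟨-, r, hr, h⟩ := h
  refine ⟨_, hr.2, fun k hk hkr => ?_⟩
  obtain ⟨t, ht, rfl⟩ := C.exists_label_eq hk.1
  obtain ⟨p, hp, hc⟩ := h t ⟨ht, hk⟩ fun h => hkr (h ▸ rfl)
  exact ⟨_, hp.2, (C.adjacent_iff hp.1 ht).2 hc⟩

end Constellation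

namespace PolyMonad

open DTree

variable {P : PolyMonad} {V V' : Type}

theorem contractObj_relabel (h : V → V') {x : P.plusPoly.I}
    (N : DTree P.plusPoly (fun _ => V) (fun _ => V) x) :
    P.contractObj (N.relabel h) = plusMap (fun _ => h) (P.contractObj N) := by
  refine Eq.trans (congrArg ofObj ?_) (ofObj_map (fun _ => h) (P.plus.contractD N))
  have h1 := contractD_mapDec (P := P.plus) (C := fun _ => V) (D := fun _ => V') (X := fun _ => V')
    (fun _ => h) (DTree.map (P := P.plusPoly) (fun _ => h) N)
  have h2 := contractD_nat (P := P.plus) (C := fun _ => V) (X := fun _ => V) (Y := fun _ => V')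
    (fun _ => h) N
  exact h1.trans h2

theorem pruneD_relabel (h : V → V') {x : P.plusPoly.I}
    (N : DTree P.plusPoly (fun _ => V) (fun _ => V) x) :
    pruneD (N.relabel h) = (pruneD N).relabel h := by
  induction N with
  | leaf x => rfl
  | node R c f ih =>
    change pruneD (.node (C := fun _ => V') R (h c) fun e => (f e).relabel h) = _
    rw [pruneD, pruneD]
    split_ifs with hR
    · rfl
    · exact congrArg (DTree.node (C := fun _ => V') R (h c)) (funext ih)

theorem blowupObj_relabel (h : V → V') {x : P.plusPoly.I}
    (N : DTree P.plusPoly (fun _ => V) (fun _ => V) x) :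
    P.blowupObj (N.relabel h) = plusMap (fun _ => h) (P.blowupObj N) := by
  rw [blowupObj, pruneD_relabel, contractObj_relabel, blowupObj]

theorem map_unit_relabel (h : V → V') {i : P.I} (D : DTree P.toPoly (fun _ => V) (fun _ => V) i) :
    (D.relabel h).map (fun _ _ => ()) = (D.map fun _ _ => ()).mapDec fun _ => h := by
  rw [relabel, map_mapDec, DTree.map_map]

theorem isRepr_allNode {U : RootedGraph} {i : P.I}
    {D : DTree P.toPoly (fun _ => U.V) (fun _ => U.V) i} (h : IsRepr U D) :
    AllNode (fun _ w => w ∈ U.dots) D := by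
  induction D with
  | leaf x => trivial
  | node b c f ih => exact ⟨h.1, fun e => ih e (h.2.2.2 e)⟩

end PolyMonad

/-! ### Constellations matching decorations of their two trees. -/

open DTree PolyMonad

variable {P : PolyMonad}

/-- The subdivided tree of `C` is decorated so that, without the white dots, it is `DM`, and, with
the labels given by `C`, it is the blow-up of `DN`. -/
def Constellation.Matches {T U : FTree} (C : Constellation T U) {x : P.plusPoly.I}
    (DM : DTree P.toPoly (fun _ => T.V) (fun _ => T.V) x.1)
    (DN : DTree P.plusPoly (fun _ => U.V) (fun _ => U.V) x) : Prop :=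
  ∃ DB : DTree P.toPoly (fun _ => C.sub.tree.V) (fun _ => C.sub.tree.V) x.1,
    Decorates C.sub.tree.toRootedGraph DB ∧
    erase C.sub.white DB = DM.relabel C.sub.emb ∧
    (P.blowupObj DN).1 = (DB.map fun _ _ => ()).mapDec fun _ => C.label

namespace Constellation

variable {T U T' U' : FTree} {C : Constellation T U} {C' : Constellation T' U'} {x : P.plusPoly.I}
  {i : P.I}

theorem allNode_emb {W : Set C.sub.tree.V} (hW : W = C.sub.white)
    (DM : DTree P.toPoly (fun _ => T.V) (fun _ => T.V) i) :
    AllNode (fun _ w => w ∉ W) (DM.relabel C.sub.emb) := by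
  subst hW
  induction DM with
  | leaf x => trivial
  | node b c f ih => exact ⟨fun h => h ⟨c, rfl⟩, ih⟩

theorem vlabel_eq {D D' : DTree P.toPoly (fun _ => U.V) (fun _ => U.V) i}
    (h : Decorates U.toRootedGraph D) (h' : Decorates U.toRootedGraph D') :
    D.vlabel = D'.vlabel := by
  obtain ⟨c, -, hc⟩ := U.exists_root_ch
  exact (hc _ h.1).trans (hc _ h'.1).symm

/-- The subdivided tree of `C` carries a unique decoration compatible with that of `T`. -/
theorem eq_of_erase_eq {DM : DTree P.toPoly (fun _ => T.V) (fun _ => T.V) i}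
    {D D' : DTree P.toPoly (fun _ => C.sub.tree.V) (fun _ => C.sub.tree.V) i}
    (h : Decorates C.sub.tree.toRootedGraph D) (h' : Decorates C.sub.tree.toRootedGraph D')
    (he : erase C.sub.white D = DM.relabel C.sub.emb)
    (he' : erase C.sub.white D' = DM.relabel C.sub.emb) : D = D' :=
  IsRepr.eq_of_erase_eq C.sub.isWhite h.2 h'.2
    (isUnitOp_of_erase (he ▸ allNode_emb rfl DM)) (isUnitOp_of_erase (he' ▸ allNode_emb rfl DM))
    (vlabel_eq h h') (he.trans he'.symm)

theorem exists_decoration (C : Constellation T U) {DM : DTree P.toPoly (fun _ => T.V) (fun _ => T.V) i}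
    (h : Decorates T.toRootedGraph DM) :
    ∃ D : DTree P.toPoly (fun _ => C.sub.tree.V) (fun _ => C.sub.tree.V) i,
      Decorates C.sub.tree.toRootedGraph D ∧ erase C.sub.white D = DM.relabel C.sub.emb := by
  obtain ⟨e, he⟩ := C.sub.exists_iso
  have hE := h.iso e
  obtain ⟨y, hy, hyv⟩ := (FTree.ch_erased C.sub.isWhite _ _).1 hE.1
  obtain ⟨D, h1, h2, h3⟩ := exists_erase_eq C.sub.isWhite hE.2 hyv
  refine ⟨D, ⟨h1.symm ▸ hy, h2⟩, h3.trans ((relabel_relabel _ _ _).trans ?_)⟩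
  exact congrArg (fun g => DM.relabel g) (funext he)

/-- Labels are injective on dots, so the dots above a given dot are the same as the labels adjacent
to its label. Inputs ending in a leaf have no root label and impose nothing. -/
theorem represents_label (C : Constellation T U)
    {D : DTree P.toPoly (fun _ => C.sub.tree.V) (fun _ => C.sub.tree.V) i}
    (h : IsRepr C.sub.tree.toRootedGraph D) :
    Represents C.Adjacent U.ends ((D.map fun _ _ => ()).mapDec fun _ => C.label) := by
  induction D with
  | leaf x => trivial
  | node b c f ih =>
    have key : ∀ e q, rootLabel (((f e).map fun _ _ => ()).mapDec fun _ => C.label) = some q →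
        (f e).vlabel ∈ C.sub.tree.dots ∧ C.label (f e).vlabel = q := by
      intro e q hq
      have := h.2.2.2 e
      cases hfe : f e with
      | leaf y => rw [hfe] at hq; cases hq
      | node b' c' f' =>
        rw [hfe] at hq this
        exact ⟨this.1, Option.some.inj hq⟩
    refine ⟨C.label_mem_ends h.1, fun e q hq => ?_, fun q _ hcq => ?_, fun e e' q hq hq' => ?_,
      fun e => ih e (h.2.2.2 e)⟩
    · obtain ⟨h1, rfl⟩ := key e q hq
      exact (C.adjacent_iff h.1 h1).2 ((h.2.2.1 _).2 ⟨e, rfl⟩)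
    · obtain ⟨t, t', ht, ht', h1, rfl, hc⟩ := hcq
      rw [C.label_injOn ht h.1 h1] at hc
      obtain ⟨e, rfl⟩ := (h.2.2.1 _).1 hc
      refine ⟨e, ?_⟩
      have := h.2.2.2 e
      change rootLabel (((f e).map fun _ _ => ()).mapDec fun _ => C.label) = _
      cases hfe : f e with
      | leaf y => rw [hfe] at ht' this; exact absurd this.1 ht'
      | node b' c' f' => rfl
    · obtain ⟨h1, h2⟩ := key e q hq
      obtain ⟨h1', h2'⟩ := key e' q hq'
      exact h.2.1 (C.label_injOn h1 h1' (h2.trans h2'.symm))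

/-- The decoration of the underlying tree extends to the subdivision. Its labels satisfy the kernel
rule at every sphere, so `exists_blowupObj_eq` at the lowest vertex of `U` yields the decoration of
the nesting. -/
theorem exists_matches (C : Constellation T U) {DM : DTree P.toPoly (fun _ => T.V) (fun _ => T.V) x.1}
    (h : Decorates T.toRootedGraph DM) (hx : (P.contractD DM).1 = x.2) :
    ∃ DN : DTree P.plusPoly (fun _ => U.V) (fun _ => U.V) x,
      Decorates U.toRootedGraph DN ∧ C.Matches DM DN := by
  obtain ⟨DB, hB, he⟩ := C.exists_decoration h
  obtain ⟨v, hv, -⟩ := U.exists_root_ch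
  have hvr := U.ne_root_of_ch hv
  -- The root of `U` has only `v` above it, so all names lie above `v`.
  have hends : U.endsAbove v = U.ends := by
    refine Set.Subset.antisymm (fun a ha => ha.1) fun a ha => ⟨ha, ?_⟩
    rcases ReflTransGen.cases_head (U.reach a) with h | ⟨w, hw, hwa⟩
    · exact absurd h.symm (U.ne_root_of_mem_ends ha)
    · obtain ⟨c, -, hc⟩ := U.exists_root_ch
      rwa [hc _ hv, ← hc _ hw]
  -- Erasing unit dots does not change the contraction, so the subdivided tree contracts to the same
  -- operation as `DM`.
  have hcon : (P.contractD ((DB.map fun _ _ => ()).mapDec fun _ => C.label)).1 = x.2 := by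
    rw [contractD_mapDec, contractD_nat]
    refine Eq.trans ?_ hx
    have := congrArg (fun D => (P.contractD D).1) he
    rw [contractD_erase] at this
    refine this.trans ?_
    rw [relabel, contractD_mapDec, contractD_nat]
    rfl
  have hex : ∃ t, rootLabel ((DB.map fun _ _ => ()).mapDec fun _ => C.label) = some t ∧
      t = C.label DB.vlabel ∧ DB.vlabel ∈ C.sub.tree.dots := by
    -- A leaf is impossible here: the subdivided tree would have no dot, whereas the names above `v`
    -- are labels of dots.
    cases DB with
    | leaf y =>
      exfalso
      obtain ⟨a, ha⟩ := U.exists_mem_endsAbove hvr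
      obtain ⟨t, ht, -⟩ := C.exists_label_eq ha.1
      rcases ReflTransGen.cases_head (C.sub.tree.reach t) with h | ⟨w, hw, hwt⟩
      · exact C.sub.tree.ne_root_of_dot ht h.symm
      · obtain ⟨c, -, hc⟩ := C.sub.tree.exists_root_ch
        rw [hc _ hw, ← hc _ hB.1] at hwt
        rcases ReflTransGen.cases_head hwt with h | ⟨w, hw, -⟩
        · exact ht (h ▸ hB.2.1)
        · exact C.sub.tree.not_ch_of_bdry hB.2.1 hB.2.2 _ hw
    | node b c f => exact ⟨_, rfl, rfl, hB.2.1⟩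
  obtain ⟨t, ht, htv, hdot⟩ := hex
  have hu := isUnitOp_of_erase (he ▸ allNode_emb rfl DM)
  obtain ⟨N, h1, h2, h3⟩ := exists_blowupObj_eq C.adjacent_unique C.wellFounded_adjacent
    (fun w hw => C.exists_top hw) v hvr x ⟨_, hcon⟩ ht (by
      -- Immediately below the lowest dot is the root vertex, which is not a dot and bears no name.
      rintro p - hp
      rw [htv] at hp
      obtain ⟨s, s', hs, hs', -, h2, hc⟩ := hp
      rw [C.label_injOn hs' hdot h2] at hc
      exact C.sub.tree.ne_root_of_dot hs (C.sub.tree.ch_unique _ _ _ hc hB.1))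
    (hends ▸ C.represents_label hB.2) (by
      rw [allNode_mapDec, allNode_map]
      have := (isRepr_allNode hB.2)
      rw [allNode_iff_split] at this hu ⊢
      exact fun n hn => hu n ((C.label_mem_nullDots (this n)).1 hn))
  exact ⟨N, ⟨h1.symm ▸ hv, h2⟩, DB, hB, he, congrArg Subtype.val h3⟩

theorem label_iso {e : T.Iso T'.toRootedGraph} {f : U.Iso U'.toRootedGraph}
    {τ : C.sub.tree.Iso C'.sub.tree.toRootedGraph} (h1 : ∀ v, τ (C.sub.emb v) = C'.sub.emb (e v))
    (h2 : ∀ (d : T.dots) (d' : T'.dots), e d = d' → f (C.black d) = C'.black d')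
    (h3 : ∀ (w : C.sub.white) (w' : C'.sub.white), τ w = w' → f (C.white w) = C'.white w')
    {t : C.sub.tree.V} (ht : t ∈ C.sub.tree.dots) : C'.label (τ t) = f (C.label t) := by
  rcases C.dot_cases ht with ⟨d, rfl⟩ | ⟨w, rfl⟩
  · have hd : e d ∈ T'.dots := fun hb => d.2 ((e.map_bdry _).1 hb)
    rw [C.label_emb, h1]
    exact (C'.label_emb ⟨_, hd⟩).trans (h2 d ⟨_, hd⟩ rfl).symm
  · have hw : τ w ∈ C'.sub.white := by
      rintro ⟨v, hv⟩
      refine w.2 ⟨e.symm v, τ.toIso.injective ?_⟩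
      refine (h1 _).trans (Eq.trans ?_ hv)
      exact congrArg C'.sub.emb (e.toIso.apply_symm_apply v)
    rw [C.label_white]
    exact (C'.label_white ⟨_, hw⟩).trans (h3 w ⟨_, hw⟩ rfl).symm

theorem white_iso {e : T.Iso T'.toRootedGraph} {τ : C.sub.tree.Iso C'.sub.tree.toRootedGraph}
    (h1 : ∀ v, τ (C.sub.emb v) = C'.sub.emb (e v)) : τ ⁻¹' C'.sub.white = C.sub.white := by
  ext w
  refine not_congr ⟨?_, ?_⟩
  · rintro ⟨v, hv⟩
    refine ⟨e.symm v, τ.toIso.injective ((h1 _).trans (Eq.trans ?_ hv))⟩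
    exact congrArg C'.sub.emb (e.toIso.apply_symm_apply v)
  · rintro ⟨v, rfl⟩
    exact ⟨e v, (h1 v).symm⟩

/-- Transport along `τ` gives a decoration of the second subdivided tree with the same erasure,
hence the one already there. The two blow-ups therefore agree after renaming, and a blow-up
determines its `P⁺`-tree. This makes the correspondence well defined on isomorphism classes. -/
theorem Matches.eq_relabel {e : T.Iso T'.toRootedGraph} {f : U.Iso U'.toRootedGraph}
    (hC : C.IsoOver C' e f) {DM : DTree P.toPoly (fun _ => T.V) (fun _ => T.V) x.1}
    {DN : DTree P.plusPoly (fun _ => U.V) (fun _ => U.V) x}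
    {DN' : DTree P.plusPoly (fun _ => U'.V) (fun _ => U'.V) x}
    (h : C.Matches DM DN) (h' : C'.Matches (DM.relabel e) DN') (hN : Decorates U.toRootedGraph DN)
    (hN' : Decorates U'.toRootedGraph DN') : DN' = DN.relabel f := by
  obtain ⟨τ, h1, h2, h3⟩ := hC
  obtain ⟨DB, hB, hBe, hBb⟩ := h
  obtain ⟨DB', hB', hBe', hBb'⟩ := h'
  obtain rfl : DB.relabel τ = DB' := by
    refine eq_of_erase_eq (hB.iso τ) hB' ?_ hBe'
    rw [erase_relabel, white_iso h1, hBe, relabel_relabel, relabel_relabel]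
    exact congrArg (fun g => DM.relabel g) (funext h1)
  have hf := hN.iso f
  obtain ⟨c, -, hc⟩ := U'.exists_root_ch
  refine IsRepr.eq_of_blowupObj_eq hN'.2 hf.2 ((hc _ hN'.1).trans (hc _ hf.1).symm) ?_
  rw [blowupObj_relabel]
  refine Subtype.ext (hBb'.trans ?_)
  change _ = (P.blowupObj DN).1.mapDec _
  rw [hBb, map_unit_relabel, mapDec_mapDec, mapDec_mapDec, mapDec_congr_iff, allNode_map]
  exact (isRepr_allNode hB.2).mono fun _ t ht => label_iso h1 h2 h3 ht

theorem eq_on_of_relabel_eq {V : Type} {DM : DTree P.toPoly (fun _ => T.V) (fun _ => T.V) i}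
    (h : Decorates T.toRootedGraph DM) {g g' : T.V → V} (hg : DM.relabel g = DM.relabel g')
    (hr : g T.root = g' T.root) (v : T.V) : g v = g' v := by
  obtain ⟨l, hl⟩ := exists_labelled DM
  rw [hl] at h hg
  rw [relabel_labelled, relabel_labelled, labelled_inj] at hg
  obtain ⟨a, rfl⟩ := h.labelled_bijective.2 v
  cases a with
  | none => exact hr
  | some a => exact congrFun hg a

/-- Both subdivided trees have the shape of the same blow-up, which provides `τ`; its compatibility
with the labels and the embeddings is then read off from the decorations. This gives injectivity on
isomorphism classes. -/
theorem Matches.isoOver {e : T.Iso T'.toRootedGraph} {f : U.Iso U'.toRootedGraph}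
    {DM : DTree P.toPoly (fun _ => T.V) (fun _ => T.V) x.1}
    {DN : DTree P.plusPoly (fun _ => U.V) (fun _ => U.V) x} (hM : Decorates T.toRootedGraph DM)
    (h : C.Matches DM DN) (h' : C'.Matches (DM.relabel e) (DN.relabel f)) : C.IsoOver C' e f := by
  obtain ⟨DB, hB, hBe, hBb⟩ := h
  obtain ⟨DB', hB', hBe', hBb'⟩ := h'
  rw [blowupObj_relabel] at hBb'
  have hbb : (P.blowupObj DN).1.mapDec (fun _ => f) = _ := hBb'
  rw [hBb, mapDec_mapDec] at hbb
  have hs : DB.shape = DB'.shape := by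
    have := congrArg shape hbb
    rwa [shape_mapDec, shape_mapDec, shape_map, shape_map] at this
  obtain ⟨τ, rfl⟩ := hB.exists_iso_of_shape hB' hs
  have hlab : ∀ t ∈ C.sub.tree.dots, C'.label (τ t) = f (C.label t) := by
    rw [map_unit_relabel, mapDec_mapDec, mapDec_congr_iff, allNode_map] at hbb
    obtain ⟨l, hl⟩ := exists_labelled DB
    intro t ht
    rw [hl] at hB hbb
    obtain ⟨a, rfl⟩ := hB.labelled_bijective.2 t
    rcases a with _ | n | m
    · exact absurd C.sub.tree.isTree.root_mem ht
    · refine (?_ : f (C.label _) = C'.label (τ _)).symm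
      have key : ∀ {i : P.I} (T : Tr P.toPoly i) (l : T.Verts → C.sub.tree.V) (n : T.Nodes),
          AllNode (fun _ t => f (C.label t) = C'.label (τ t)) (T.labelled l) →
          f (C.label (l (.inl n))) = C'.label (τ (l (.inl n))) := by
        intro i T l n h
        induction n with
        | here => exact h.1
        | up e n ih => exact ih (fun v => l (Tree.upVert e v)) (h.2 e)
      exact key _ _ n hbb
    · exact absurd (hB.2.labelled_inr m).1 ht
  -- White dots are recognised by having a null-dot as label, and `f` preserves null-dots.
  have hw : AllNode (fun _ t => t ∈ τ ⁻¹' C'.sub.white ↔ t ∈ C.sub.white) DB := by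
    refine (isRepr_allNode hB.2).mono fun _ t ht => ?_
    have ht' : τ t ∈ C'.sub.tree.dots := fun hb => ht ((τ.map_bdry t).1 hb)
    rw [← C.label_mem_nullDots ht]
    refine (C'.label_mem_nullDots ht').symm.trans ?_
    rw [hlab t ht]
    rw [U'.mem_nullDots_iff, U.mem_nullDots_iff]
    refine and_congr (not_congr (f.map_bdry _)) ⟨fun h w hw => h _ ((f.ch_iff _ _).2 hw), fun h w hw => ?_⟩
    obtain ⟨w, rfl⟩ := f.toIso.surjective w
    exact h _ ((f.ch_iff _ _).1 hw)
  -- After erasing the white dots both decorations are relabellings of `DM`, whose labels are all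
  -- vertices of `T` except the root.
  have hemb : ∀ v, τ (C.sub.emb v) = C'.sub.emb (e v) := by
    refine eq_on_of_relabel_eq hM (g := fun v => τ (C.sub.emb v)) (g' := fun v => C'.sub.emb (e v))
      ?_ ?_
    · rw [← relabel_relabel e C'.sub.emb, ← hBe', erase_relabel, erase_congr hw, hBe, relabel_relabel]
    · exact (congrArg τ C.sub.emb_root).trans (τ.map_root.trans (C'.sub.emb_root.symm.trans
        (congrArg C'.sub.emb e.map_root).symm))
  refine ⟨τ, hemb, fun d d' hd => ?_, fun w w' hw => ?_⟩
  · rw [← C.label_emb, ← C'.label_emb, ← hlab _ (C.emb_mem_dots d), hemb, hd]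
  · rw [← C.label_white, ← C'.label_white, ← hlab _ (C.sub.white_dot _ w.2).1, hw]

end Constellation

end Opetopes

/-! ### The constellation determined by a `P⁺`-tree. -/

namespace Opetopes

open Relation DTree PolyMonad

namespace Constellation

section

variable {T U T' : FTree} {W : Set T'.V} {hW : T'.IsWhite W}
  (e : T.Iso (T'.erased W hW).toRootedGraph) {σ : T'.V → U.V}

/-- The constellation with a given subdivision and a given labelling of the dots. -/
noncomputable def ofErased (h1 : ∀ t ∈ T'.dots, σ t ∈ U.ends) (h2 : Set.InjOn σ T'.dots)
    (h3 : ∀ a ∈ U.ends, ∃ t ∈ T'.dots, σ t = a) (h4 : ∀ t ∈ T'.dots, σ t ∈ U.nullDots ↔ t ∈ W)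
    (h5 : ∀ x ∈ U.dots, ∃ t ∈ U.endsAbove x, ∀ k ∈ U.endsAbove x, k ≠ t →
      ∃ p ∈ T'.dots, ∃ q ∈ T'.dots, σ p ∈ U.endsAbove x ∧ σ q = k ∧ T'.Ch p q) :
    Constellation T U :=
  have hd : ∀ d : T.dots, (e d).1 ∈ T'.dots := fun d hb => d.2 ((e.map_bdry _).1 hb)
  have hl : ∀ d : T.dots, σ (e d).1 ∈ U.leaves := fun d =>
    (h1 _ (hd d)).resolve_right fun h => (e d).2 ((h4 _ (hd d)).1 h)
  have hw : ∀ w : (Subdivision.ofErased T' W hW e).white, w.1 ∈ W := fun w =>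
    (Subdivision.mem_white_ofErased e _).1 w.2
  have hwd : ∀ w : (Subdivision.ofErased T' W hW e).white, w.1 ∈ T'.dots := fun w => (hW _ (hw w)).1
  { sub := Subdivision.ofErased T' W hW e
    black := Equiv.ofBijective (fun d => ⟨σ (e d).1, hl d⟩)
      ⟨fun d d' h => Subtype.ext (e.toIso.injective (Subtype.ext
        (h2 (hd d) (hd d') (congrArg Subtype.val h)))), fun ⟨a, ha⟩ => by
        obtain ⟨t, ht, rfl⟩ := h3 a (Or.inl ha)
        have htW : t ∉ W := fun h => ((h4 t ht).2 h).1 ha.1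
        have he : e (e.toIso.symm ⟨t, htW⟩) = ⟨t, htW⟩ := e.toIso.apply_symm_apply _
        refine ⟨⟨e.toIso.symm ⟨t, htW⟩, fun hb => ?_⟩, Subtype.ext ?_⟩
        · have := (e.map_bdry _).2 hb
          rw [he] at this
          exact ht this
        · exact congrArg (fun v : {v // v ∉ W} => σ v.1) he⟩
    white := Equiv.ofBijective (fun w => ⟨σ w.1, (h4 _ (hwd w)).2 (hw w)⟩)
      ⟨fun w w' h => Subtype.ext (h2 (hwd w) (hwd w') (congrArg Subtype.val h)), fun ⟨a, ha⟩ => by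
        obtain ⟨t, ht, rfl⟩ := h3 a (Or.inr ha)
        exact ⟨⟨t, (Subdivision.mem_white_ofErased e t).2 ((h4 t ht).1 ha)⟩, rfl⟩⟩
    kernel_rule := fun x hx => by
      have hK : ({t | ∃ d : T.dots, (e d).1 = t ∧ U.le (σ (e d).1) x} ∪
          {t | ∃ w : (Subdivision.ofErased T' W hW e).white, w.1 = t ∧ U.le (σ w.1) x}) =
          {t | t ∈ T'.dots ∧ σ t ∈ U.endsAbove x} := by
        ext t
        constructor
        · rintro (⟨d, rfl, h⟩ | ⟨w, rfl, h⟩)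
          · exact ⟨hd d, h1 _ (hd d), (U.le_iff _ _).1 h⟩
          · exact ⟨hwd w, h1 _ (hwd w), (U.le_iff _ _).1 h⟩
        · rintro ⟨ht, h⟩
          by_cases htW : t ∈ W
          · exact Or.inr ⟨⟨t, (Subdivision.mem_white_ofErased e t).2 htW⟩, rfl, (U.le_iff _ _).2 h.2⟩
          · have he : e (e.toIso.symm ⟨t, htW⟩) = ⟨t, htW⟩ := e.toIso.apply_symm_apply _
            refine Or.inl ⟨⟨e.toIso.symm ⟨t, htW⟩, fun hb => ?_⟩, congrArg Subtype.val he,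
              (U.le_iff _ _).2 ?_⟩
            · have := (e.map_bdry _).2 hb
              rw [he] at this
              exact ht this
            · exact (congrArg (fun v : {v // v ∉ W} => ReflTransGen U.Ch x (σ v.1)) he).mpr h.2
      refine (congrArg T'.IsKernel hK).mpr ?_
      rw [FTree.isKernel_iff]
      obtain ⟨t, ht, h⟩ := h5 x hx
      obtain ⟨s, hs, rfl⟩ := h3 t ht.1
      refine ⟨fun t h => h.1, s, ⟨hs, ht⟩, fun k hk hks => ?_⟩
      obtain ⟨p, hp, q, hq, hpx, hqk, hc⟩ := h (σ k) hk.2 fun h => hks (h2 hk.1 hs h)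
      obtain rfl := h2 hq hk.1 hqk
      exact ⟨p, ⟨hp, hpx⟩, hc⟩ }

theorem label_ofErased (h1 : ∀ t ∈ T'.dots, σ t ∈ U.ends) (h2 : Set.InjOn σ T'.dots)
    (h3 : ∀ a ∈ U.ends, ∃ t ∈ T'.dots, σ t = a) (h4 : ∀ t ∈ T'.dots, σ t ∈ U.nullDots ↔ t ∈ W)
    (h5 : ∀ x ∈ U.dots, ∃ t ∈ U.endsAbove x, ∀ k ∈ U.endsAbove x, k ≠ t →
      ∃ p ∈ T'.dots, ∃ q ∈ T'.dots, σ p ∈ U.endsAbove x ∧ σ q = k ∧ T'.Ch p q)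
    {t : T'.V} (ht : t ∈ T'.dots) : (ofErased e h1 h2 h3 h4 h5).label t = σ t := by
  rcases (ofErased e h1 h2 h3 h4 h5).dot_cases ht with ⟨d, rfl⟩ | ⟨w, rfl⟩
  · exact (ofErased e h1 h2 h3 h4 h5).label_emb d
  · exact (ofErased e h1 h2 h3 h4 h5).label_white w

end

end Constellation

namespace DTree

variable {P : Poly} {X : P.I → Type} {V W : Type}

theorem allNode_labelled (Q : V → Prop) {i : P.I} (T : Tree P X i) (g : T.Verts → V) :
    AllNode (fun _ v => Q v) (T.labelled g) ↔ ∀ n, Q (g (.inl n)) := by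
  induction T with
  | leaf x => exact iff_of_true trivial fun n => nomatch n
  | node b f ih =>
    refine ⟨fun h n => ?_, fun h => ⟨h .here, fun e => (ih e _).2 fun n => h (.up e n)⟩⟩
    cases n with
    | here => exact h.1
    | up e n => exact (ih e fun v => g (Tree.upVert e v)).1 (h.2 e) n

theorem decorate_eq {i : P.I} (T : Tr P i) (k : T.Nodes → W) (g : T.Verts → V) (σ : V → W)
    (h : ∀ n, σ (g (.inl n)) = k n) :
    decorate (C := fun _ => W) T k = ((T.labelled g).map fun _ _ => ()).mapDec fun _ => σ := by
  induction T with
  | leaf x => rfl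
  | node b f ih =>
    have h1 := h .here
    exact (congrArg₂ (fun c k => DTree.node (C := fun _ => W) b c k) h1.symm
      (funext fun e => ih e (fun n => k (.up e n)) (fun v => g (Tree.upVert e v))
        fun n => h (.up e n)))

end DTree

namespace PolyMonad

variable {P : PolyMonad} {V : Type} {U : FTree} {x : P.plusPoly.I}

theorem IsRepr.supp_pruneD {N : DTree P.plusPoly (fun _ => U.V) (fun _ => U.V) x}
    (h : IsRepr U.toRootedGraph N) :
    supp (fun _ _ => ∅) (fun _ v => {v}) (pruneD N) ⊆ {a | ReflTransGen U.Ch N.vlabel a} := by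
  induction N with
  | leaf v => rintro a rfl; exact .refl
  | node R c f ih =>
    rw [pruneD]
    split_ifs with hR
    · rintro a rfl; exact .refl
    · rintro a (ha | ha)
      · exact ha.elim
      · obtain ⟨e, he⟩ := Set.mem_iUnion.1 ha
        exact (ih e (h.2.2.2 e) he).head ((h.2.2.1 _).2 ⟨e, rfl⟩)

theorem IsRepr.disj_pruneD {N : DTree P.plusPoly (fun _ => U.V) (fun _ => U.V) x}
    (h : IsRepr U.toRootedGraph N) : Disj (fun _ _ => ∅) (fun _ v => {v}) (pruneD N) := by
  induction N with
  | leaf v => trivial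
  | node R c f ih =>
    rw [pruneD]
    split_ifs with hR
    · trivial
    · refine ⟨fun e => Set.empty_disjoint _, fun e e' hee => ?_, fun e => ih e (h.2.2.2 e)⟩
      refine Set.disjoint_left.2 fun a ha ha' => hee (h.2.1 ?_)
      exact eq_of_siblings U.ch_unique U.not_transGen_ch ((h.2.2.1 _).2 ⟨e, rfl⟩)
        ((h.2.2.1 _).2 ⟨e', rfl⟩) (IsRepr.supp_pruneD (h.2.2.2 e) ha)
        (IsRepr.supp_pruneD (h.2.2.2 e') ha')

/-- The leaves of the pruned tree have distinct labels, since they lie above different siblings;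
contraction turns this into distinct labels at the dots of the blow-up. -/
theorem IsRepr.injective_blowup {N : DTree P.plusPoly (fun _ => U.V) (fun _ => U.V) x}
    (h : IsRepr U.toRootedGraph N) :
    Function.Injective (P.plus.contractD (X := fun _ => U.V) (pruneD N)).2 := by
  intro n n' hn
  by_contra hne
  have := disjoint_of_contractD (P := P.plus) (C := fun _ => U.V) (X := fun _ => U.V)
    (z := pruneD N) rfl (IsRepr.disj_pruneD h) n n' hne
  exact Set.disjoint_left.1 this rfl hn

/-- The white dots of the blow-up carry unit operations. -/
theorem IsRepr.isUnitOp_blowupObj {N : DTree P.plusPoly (fun _ => U.V) (fun _ => U.V) x}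
    (h : IsRepr U.toRootedGraph N) :
    AllNode (fun y w => w ∈ U.nullDots → P.IsUnitOp y) (P.blowupObj N).1 := by
  induction N with
  | leaf v =>
    rw [blowupObj_leaf]
    exact ⟨fun hv => absurd h.1 hv.1, fun _ => trivial⟩
  | node R c f ih =>
    by_cases hR : IsEmpty (P.plusPoly.Ar R)
    · rw [blowupObj_null hR]
      rename_i y
      have hu : P.IsUnitOp y := by
        refine Eq.trans ?_ R.2
        rw [(isEmpty_nodes_iff R.1).1 hR]
        rfl
      exact ⟨fun _ => hu, fun _ => trivial⟩
    · rw [blowupObj_node hR]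
      refine (allNode_subst _ _).2 ((allNode_decorate _ _ _).2 fun n => ih n (h.2.2.2 n))

/-- A unit operation has exactly one input, so the dots that carry units are unary. -/
theorem IsRepr.exists_unique_ch {i : P.I} {D : DTree P.toPoly (fun _ => U.V) (fun _ => U.V) i}
    (h : IsRepr U.toRootedGraph D) {W : Set U.V}
    (hu : AllNode (fun y w => w ∈ W → P.IsUnitOp y) D) :
    AllNode (fun _ w => w ∈ W → ∃ c, U.Ch w c ∧ ∀ c', U.Ch w c' → c' = c) D := by
  induction D with
  | leaf v => trivial
  | node b c f ih =>
    refine ⟨fun hc => ?_, fun e => ih e (h.2.2.2 e) (hu.2 e)⟩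
    obtain ⟨z, hz⟩ := exists_unit_eq (X := DTree P.toPoly (fun _ => U.V) fun _ => U.V) (hu.1 hc) f
    obtain ⟨a⟩ := nonempty_arity_unit hz
    refine ⟨_, (h.2.2.1 _).2 ⟨a, rfl⟩, fun c' hc' => ?_⟩
    obtain ⟨a', rfl⟩ := (h.2.2.1 _).1 hc'
    exact congrArg (fun a => (f a).vlabel) ((subsingleton_arity_unit hz).elim a' a)

theorem adjIn_of_isRepr {i : P.I} {D : DTree P.toPoly (fun _ => U.V) (fun _ => U.V) i}
    (h : IsRepr U.toRootedGraph D) (σ : U.V → V) :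
    AdjIn (fun a b => ∃ p ∈ U.dots, ∃ q ∈ U.dots, σ p = a ∧ σ q = b ∧ U.Ch p q)
      ((D.map fun _ _ => ()).mapDec fun _ => σ) := by
  induction D with
  | leaf v => trivial
  | node b c f ih =>
    refine ⟨fun e q hq => ?_, fun e => ih e (h.2.2.2 e)⟩
    have h1 := h.2.2.2 e
    have h2 := (h.2.2.1 _).2 ⟨e, rfl⟩
    change rootLabel (((f e).map fun _ _ => ()).mapDec fun _ => σ) = some q at hq
    cases hfe : f e with
    | leaf y => rw [hfe] at hq; cases hq
    | node b' c' f' =>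
      rw [hfe] at hq h1 h2
      exact ⟨c, h.1, c', h1.1, rfl, Option.some.inj hq, h2⟩

theorem shape_ofObj {C : (Σ i, P.Op i) → Type} (z : P.plusPoly.Obj C x) :
    (ofObj z).1.shape = z.1.1 := by
  rw [shape, DTree.map_unit]
  exact congrArg Sigma.fst (split_decorate z.1.1 z.2)

theorem contractD_fst {C : (Σ i, P.Op i) → Type} {X : P.I → Type} {i : P.I}
    (D : DTree P.toPoly C X i) : (P.contractD D).1 = (P.contract D.shape).1 := by
  rw [shape, contract_split, contractD_nat]
  rfl

/-- The constellation of the scars of the substitutions that `DN` prescribes. -/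
theorem exists_constellation {T : FTree} {DM : DTree P.toPoly (fun _ => T.V) (fun _ => T.V) x.1}
    (hM : Decorates T.toRootedGraph DM) {DN : DTree P.plusPoly (fun _ => U.V) (fun _ => U.V) x}
    (hDN : Decorates U.toRootedGraph DN) (hN : (P.contractObj DN).1.shape = DM.shape) :
    ∃ C : Constellation T U, C.Matches DM DN := by
  obtain ⟨hr, hDN⟩ := hDN
  obtain ⟨R, k, hk, hRk⟩ : ∃ (R : P.plusPoly.Op x) (k : P.plusPoly.Ar R → U.V),
      Function.Injective k ∧ P.blowupObj DN = ofObj (C := fun _ => U.V) ⟨R, k⟩ :=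
    ⟨_, _, IsRepr.injective_blowup hDN, rfl⟩
  let T' := R.1.ftree
  let DB : DTree P.toPoly (fun _ => T'.V) (fun _ => T'.V) x.1 := R.1.labelled some
  have hB : Decorates T'.toRootedGraph DB := decorates_ftree R.1
  -- Vertices that are not dots get the root of `U`; as this is neither a leaf nor a null-dot, they
  -- never count as white.
  let σ : T'.V → U.V := fun a : Option R.1.Verts => match a with
    | some (.inl n) => k n
    | _ => U.root
  have hσ : (P.blowupObj DN).1 = (DB.map fun _ _ => ()).mapDec fun _ => σ := by
    rw [hRk]
    exact decorate_eq R.1 k some σ fun n => rfl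
  have hdots : ∀ t, t ∈ T'.dots ↔ ∃ n, t = some (.inl n) := by
    rintro (_ | n | l)
    · exact iff_of_false (fun h => h (Or.inl rfl)) fun ⟨n, hn⟩ => nomatch hn
    · exact iff_of_true (fun h => h.elim (fun h => nomatch h) fun ⟨l, hl⟩ => nomatch hl) ⟨n, rfl⟩
    · exact iff_of_false (fun h => h (Or.inr ⟨l, rfl⟩)) fun ⟨n, hn⟩ => nomatch hn
  have hends : U.endsAbove DN.vlabel = U.ends := by
    refine Set.Subset.antisymm (fun a ha => ha.1) fun a ha => ⟨ha, ?_⟩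
    rcases ReflTransGen.cases_head (U.reach a) with h | ⟨w, hw, hwa⟩
    · exact absurd h.symm (U.ne_root_of_mem_ends ha)
    · obtain ⟨c, -, hc⟩ := U.exists_root_ch
      rwa [hc _ hr, ← hc _ hw]
  have hlab : ∀ a, a ∈ U.ends ↔ ∃ n, k n = a := by
    intro a
    rw [← hends, ← IsRepr.labels_blowupObj hDN, hRk]
    refine (mem_supp_decorate (P := P.toPoly) (C := fun _ => U.V) _ a R.1 k).trans ?_
    exact exists_congr fun n => eq_comm
  have h1 : ∀ t ∈ T'.dots, σ t ∈ U.ends := by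
    intro t ht
    obtain ⟨n, rfl⟩ := (hdots t).1 ht
    exact (hlab _).2 ⟨n, rfl⟩
  have h2 : Set.InjOn σ T'.dots := by
    intro t ht t' ht' h
    obtain ⟨n, rfl⟩ := (hdots t).1 ht
    obtain ⟨n', rfl⟩ := (hdots t').1 ht'
    rw [hk h]
  have h3 : ∀ a ∈ U.ends, ∃ t ∈ T'.dots, σ t = a := by
    intro a ha
    obtain ⟨n, rfl⟩ := (hlab a).1 ha
    exact ⟨some (.inl n), (hdots _).2 ⟨n, rfl⟩, rfl⟩
  have hu : AllNode (fun y t => t ∈ σ ⁻¹' U.nullDots → P.IsUnitOp y) DB := by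
    have := IsRepr.isUnitOp_blowupObj hDN
    rw [hσ, allNode_mapDec, allNode_map] at this
    exact this
  have hW : T'.IsWhite (σ ⁻¹' U.nullDots) := by
    intro t ht
    have htd : t ∈ T'.dots := by
      rcases t with _ | n | l
      · exact absurd U.isTree.root_mem ht.1
      · exact (hdots _).2 ⟨n, rfl⟩
      · exact absurd U.isTree.root_mem ht.1
    obtain ⟨n, rfl⟩ := (hdots t).1 htd
    exact ⟨htd, (allNode_labelled _ _ _).1 (IsRepr.exists_unique_ch hB.2 hu) n ht⟩
  obtain ⟨DE, hE1, hE2, hE3⟩ := exists_erase hW hB.2 hu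
  have hE : Decorates (T'.erased _ hW).toRootedGraph DE :=
    ⟨(FTree.ch_erased hW _ _).2 ⟨_, hB.1, hE3⟩, hE1⟩
  -- The blow-up without its white dots is the contraction of `DN`, whose shape is that of `DM` by
  -- hypothesis; so `T` is isomorphic to the tree with the white dots deleted.
  have hs : DM.shape = DE.shape := by
    rw [← hN, IsRepr.contractObj_eq hDN]
    change (erase U.nullDots (P.blowupObj DN).1).shape = _
    rw [hσ, erase_mapDec, erase_map, hE2, shape_mapDec, shape_map, shape_relabel]
  obtain ⟨e, rfl⟩ := hM.exists_iso_of_shape hE hs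
  have h5 : ∀ x ∈ U.dots, ∃ t ∈ U.endsAbove x, ∀ k ∈ U.endsAbove x, k ≠ t →
      ∃ p ∈ T'.dots, ∃ q ∈ T'.dots, σ p ∈ U.endsAbove x ∧ σ q = k ∧ T'.Ch p q := by
    intro v hv
    have hvr : ReflTransGen U.Ch DN.vlabel v := by
      rcases ReflTransGen.cases_head (U.reach v) with h | ⟨w, hw, hwa⟩
      · exact absurd h.symm (U.ne_root_of_dot hv)
      · obtain ⟨c, -, hc⟩ := U.exists_root_ch
        rwa [hc _ hr, ← hc _ hw]
    -- The kernel rule: what has been substituted inside the sphere `v` is a tree of its own, with a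
    -- root dot from which all others are reached.
    obtain ⟨t, ht, h⟩ := IsRepr.exists_top hDN (hσ ▸ adjIn_of_isRepr hB.2 σ) hvr
    refine ⟨t, ht, fun k hk hkt => ?_⟩
    obtain ⟨_, hp, p, hpd, q, hqd, rfl, rfl, hc⟩ := h k hk hkt
    exact ⟨p, hpd, q, hqd, hp, rfl, hc⟩
  refine ⟨.ofErased e h1 h2 h3 (fun t ht => Iff.rfl) h5, DB, hB, ?_, ?_⟩
  · have hwhite : (Subdivision.ofErased T' _ hW e).white = σ ⁻¹' U.nullDots :=
      Set.ext fun y => Subdivision.mem_white_ofErased e y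
    refine (congrArg (fun W => erase W DB) hwhite).trans (hE2.trans ?_)
    exact relabel_relabel _ _ _
  · rw [hσ]
    refine (mapDec_congr_iff _ _ _).2 ((allNode_map _ _ _).2 ?_)
    exact (isRepr_allNode hB.2).mono fun _ t ht =>
      (Constellation.label_ofErased e h1 h2 h3 (fun t ht => Iff.rfl) h5 ht).symm

end PolyMonad

end Opetopes

/-! ### From matching decorations to `IsConstellationOf`. -/

namespace Opetopes

open Relation DTree

namespace DTree

variable {P : Poly} {X : P.I → Type} {V : Type}

theorem allLeaf_labelled (Q : V → Prop) {i : P.I} (T : Tree P X i) (g : T.Verts → V) :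
    AllLeaf (fun _ v => Q v) (T.labelled g) ↔ ∀ l, Q (g (.inr l)) := by
  induction T with
  | leaf x =>
    refine ⟨fun h l => ?_, fun h => h .here⟩
    cases l
    exact h
  | node b f ih =>
    refine ⟨fun h l => ?_, fun h e => (ih e _).2 fun l => h (.up e l)⟩
    cases l with
    | up e l => exact (ih e fun v => g (Tree.upVert e v)).1 (h e) l

theorem split_labelled {i : P.I} (T : Tree P X i) (g : T.Verts → V) :
    (T.labelled g).split.1 = T.relabel fun l => g (.inr l) := by
  induction T with
  | leaf x => rfl
  | node b f ih => exact congrArg (Tree.node b) (funext fun e => ih e _)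

end DTree

namespace PolyMonad

variable {P : PolyMonad} {X : P.I → Type} {S V : Type}

theorem contract_relabel_comp {i : P.I} (T : Tree P.toPoly X i) (f : T.Leaves → S) (g : S → V) :
    P.contract (T.relabel fun l => g (f l)) = P.map (fun _ => g) (P.contract (T.relabel f)) := by
  induction T with
  | leaf x => exact (P.unit_nat (fun _ => g) _).symm
  | node b f ih =>
    refine Eq.trans ?_ (P.join_nat (fun _ => g) _).symm
    exact congrArg (fun k => P.join ⟨b, k⟩) (funext fun e => ih e _)

theorem map_eq_cast (g : S → V) {i : P.I} {b : P.Op i} (z : P.Obj (fun _ => S) i) (h : z.1 = b) :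
    P.map (fun _ => g) z = ⟨b, fun a => g (z.2 (cast (congrArg P.Ar h.symm) a))⟩ := by
  subst h
  rfl

/-- `leafOf` gives the decorations of the inputs of the contraction. -/
theorem contractD_labelled {i : P.I} {b : P.Op i} (T : Tr P.toPoly i) (h : (P.contract T).1 = b)
    (g : T.Verts → V) :
    P.contractD (T.labelled g) = ⟨b, fun a => g (.inr (leafOf T h a))⟩ := by
  rw [← contract_split, split_labelled]
  refine (contract_relabel_comp T id fun l => g (.inr l)).trans ?_
  exact map_eq_cast _ _ ((contract_relabel T id).trans h)

/-- Lying in the image of `leafOf T h` holds at all inputs, hence at all leaves, by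
`allLeaf_iff_of_contractD`. -/
theorem leafOf_surjective {i : P.I} {b : P.Op i} (T : Tr P.toPoly i) (h : (P.contract T).1 = b) :
    Function.Surjective (leafOf T h) := by
  have := (allLeaf_iff_of_contractD (contractD_labelled T h id)
    fun _ v => ∃ a, (.inr (leafOf T h a) : T.Verts) = v).2 fun a => ⟨a, rfl⟩
  intro l
  obtain ⟨a, ha⟩ := (allLeaf_labelled _ _ _).1 this l
  exact ⟨a, Sum.inr.inj ha⟩

theorem split_pruneD {x : P.plusPoly.I} (N : Tr P.plusPoly x) (g : N.Verts → V) :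
    (pruneD (N.labelled g)).split.1 = N.prune g := by
  induction N with
  | leaf x => rfl
  | node R f ih =>
    change (pruneD (.node (C := fun _ => V) R _ _)).split.1 = _
    rw [pruneD, Tree.prune]
    split_ifs with hR
    · rfl
    · exact congrArg (Tree.node R) (funext fun e => ih e _)

theorem blowupObj_labelled {x : P.plusPoly.I} (N : Tr P.plusPoly x) (g : N.Verts → V) :
    P.blowupObj (N.labelled g) =
      ofObj (C := fun _ => V) ⟨(blowup (P := P) N).1, fun n => g ((blowup (P := P) N).2 n)⟩ := by
  have h1 : P.blowupObj (N.labelled id) = ofObj (blowup (P := P) N) := by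
    refine congrArg ofObj ((contract_split (P := P.plus) (pruneD (N.labelled id))).symm.trans ?_)
    exact congrArg P.plus.contract (split_pruneD N id)
  have h2 := relabel_labelled g N id
  refine (congrArg P.blowupObj h2.symm).trans ?_
  rw [blowupObj_relabel, h1]
  exact (ofObj_map (P := P) (C := fun _ => N.Verts) (fun _ => g) (blowup (P := P) N)).symm

theorem decorate_inj {C : (Σ i, P.Op i) → Type} {i : P.I} (T : Tree P.toPoly X i)
    {k k' : ∀ n : T.Nodes, C (T.deco n)} (h : decorate T k = decorate T k') : k = k' := by
  have := congrArg split h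
  rw [split_decorate, split_decorate] at this
  exact eq_of_heq (Sigma.ext_iff.1 this).2

variable {T U : FTree} {C : Constellation T U} {x : P.plusPoly.I}

/-- The contraction is the blow-up without the dots labelled by null-dots. These are the white dots
of the subdivision, so what remains is `DM`, renamed. -/
theorem _root_.Opetopes.Constellation.Matches.contractObj_eq
    {DM : DTree P.toPoly (fun _ => T.V) (fun _ => T.V) x.1}
    {DN : DTree P.plusPoly (fun _ => U.V) (fun _ => U.V) x} (h : C.Matches DM DN)
    (hN : IsRepr U.toRootedGraph DN) :
    (P.contractObj DN).1 = (DM.map fun _ _ => ()).mapDec fun _ v => C.label (C.sub.emb v) := by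
  obtain ⟨DB, hB, hBe, hBb⟩ := h
  rw [IsRepr.contractObj_eq hN]
  change erase U.nullDots (P.blowupObj DN).1 = _
  rw [hBb, erase_mapDec, erase_map]
  have hw : AllNode (fun _ t => t ∈ C.label ⁻¹' U.nullDots ↔ t ∈ C.sub.white) DB :=
    (isRepr_allNode hB.2).mono fun _ t ht => C.label_mem_nullDots ht
  rw [erase_congr hw, hBe, map_unit_relabel, mapDec_mapDec]

/-- A labelled `P⁺`-tree that matches `C` exhibits `C` as the constellation it determines. -/
theorem isConstellationOf_of_matches {M : P.plus.Op x} {N : Tr P.plus.toPoly x}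
    (h : (P.plus.contract N).1 = M) {gM : M.1.Verts → T.V}
    {gN : Tree.Verts (P := P.plusPoly) N → U.V}
    (hM : Decorates T.toRootedGraph (M.1.labelled gM))
    (hN : Decorates U.toRootedGraph (Tree.labelled (P := P.plusPoly) N gN))
    (hC : C.Matches (M.1.labelled gM) (Tree.labelled (P := P.plusPoly) N gN))
    {α : T.Iso M.1.graph} {β : U.Iso N.graph} (hα : ∀ v, α (gM v) = some v)
    (hβ : ∀ v, β (gN v) = some v) : IsConstellationOf M N h C α β := by
  have hcases : ∀ {V : FTree} {i : P.I} {S : Tr P.toPoly i} {g : S.Verts → V.V},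
      Decorates V.toRootedGraph (S.labelled g) → ∀ v ∈ V.dots, ∃ n, v = g (.inl n) := by
    intro V i S g hS v hv
    obtain ⟨a, rfl⟩ := hS.labelled_bijective.2 v
    rcases a with _ | n | l
    · exact absurd V.isTree.root_mem hv
    · exact ⟨n, rfl⟩
    · exact absurd (hS.2.labelled_inr l).1 hv
  constructor
  · intro d
    obtain ⟨n, hn⟩ := hcases hM d d.2
    refine ⟨n, (congrArg α hn).trans (hα _), ?_⟩
    have h1 := hC.contractObj_eq hN.2
    have h2 := contractD_labelled (P := P.plus) N h gN
    have h3 : (P.contractObj (Tree.labelled (P := P.plusPoly) N gN)).1 =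
        decorate (C := fun _ => U.V) M.1 fun n => gN (.inr (leafOf N h n)) :=
      congrArg (fun z => (ofObj (C := fun _ => U.V) z).1) h2
    -- The dots of `M` carry the same leaves of `N` whether these are computed by contraction or
    -- read off from the constellation.
    have h4 := h3.symm.trans (h1.trans (decorate_eq M.1 _ gM
      (fun v => C.label (C.sub.emb v)) fun n => rfl).symm)
    have h5 := congrFun (decorate_inj (C := fun _ => U.V) M.1 h4) n
    refine Eq.trans (congrArg β ?_) (hβ _)
    exact (C.label_emb d).symm.trans ((congrArg (fun v => C.label (C.sub.emb v)) hn).trans h5.symm)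
  · obtain ⟨DB, hB, hBe, hBb⟩ := hC
    have h1 := blowupObj_labelled (P := P) N gN
    have h2 := (congrArg Subtype.val h1).symm.trans hBb
    have hs : DB.shape = (blowup (P := P) N).1.1 := by
      have h3 := congrArg shape h2
      rw [shape_mapDec, shape_map] at h3
      exact h3.symm.trans (shape_ofObj _)
    obtain ⟨gB, rfl⟩ := exists_labelled_of_shape DB hs
    have h3 : decorate (C := fun _ => U.V) (blowup (P := P) N).1.1
        (fun n => gN ((blowup (P := P) N).2 n)) = _ :=
      h2.trans (decorate_eq _ _ gB C.label fun n => rfl).symm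
    have h4 := congrFun (decorate_inj (C := fun _ => U.V) _ h3)
    obtain ⟨τ, hτ⟩ := hB.exists_iso
    refine ⟨τ, fun d => ?_, fun w => ?_, fun l => ?_⟩
    · obtain ⟨n, hn⟩ := hcases hB _ (C.emb_mem_dots d)
      refine ⟨n, (congrArg τ hn).trans (hτ _), ?_⟩
      refine Eq.trans (congrArg β ?_) (hβ _)
      exact (C.label_emb d).symm.trans ((congrArg C.label hn).trans (h4 n).symm)
    · obtain ⟨n, hn⟩ := hcases hB _ (C.sub.white_dot w w.2).1
      refine ⟨n, (congrArg τ hn).trans (hτ _), ?_⟩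
      refine Eq.trans (congrArg β ?_) (hβ _)
      exact (C.label_white w).symm.trans ((congrArg C.label hn).trans (h4 n).symm)
    · obtain ⟨m, hm⟩ : ∃ m, (l : T.V) = gM (.inr m) := by
        obtain ⟨a, ha⟩ := hM.labelled_bijective.2 (l : T.V)
        rcases a with _ | n | m
        · exact absurd ha.symm l.2.2
        · exact absurd l.2.1 (ha ▸ (hM.2.labelled_inl n).1)
        · exact ⟨m, ha.symm⟩
      obtain ⟨a, rfl⟩ := leafOf_surjective M.1 M.2 m
      refine ⟨a, (congrArg α hm).trans (hα _), ?_⟩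
      -- Erasing leaves the contraction unchanged, so the leaves of the blow-up and of `M` belonging
      -- to the same input `a` correspond.
      have h5 := congrArg P.contractD hBe
      rw [contractD_erase, contractD_labelled _ (blowup (P := P) N).1.2, relabel_labelled,
        contractD_labelled _ M.2] at h5
      have h6 := congrFun (eq_of_heq (Sigma.ext_iff.1 h5).2) a
      refine Eq.trans (congrArg τ ?_) (hτ _)
      exact (congrArg C.sub.emb hm).trans h6.symm

end PolyMonad

end Opetopes

/-! ### Linear nestings and the degrees up to 2. -/

namespace Opetopes

open Relation DTree PolyMonad

namespace FTree

variable {U : FTree}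

theorem not_pass_empty {a b : U.V} (h : ReflTransGen (U.Pass ∅) a b) : a = b := by
  rcases ReflTransGen.cases_head h with h | ⟨c, h, -⟩
  · exact h
  · exact h.1.elim

/-- Nothing is deleted. -/
theorem exists_iso_erased {W : Set U.V} (hW : U.IsWhite W) (hE : W = ∅) :
    ∃ e : U.Iso (U.erased W hW).toRootedGraph, ∀ v, (e v).1 = v := by
  subst hE
  let e : U.V ≃ {v : U.V // v ∉ (∅ : Set U.V)} :=
    ⟨fun v => ⟨v, fun h => h⟩, fun v => v.1, fun _ => rfl, fun _ => rfl⟩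
  have hs : ∀ a b : U.V, U.Skip ∅ a b ↔ U.Ch a b := fun a b =>
    ⟨fun ⟨x, hx, hxb⟩ => not_pass_empty hxb ▸ hx, fun h => ⟨b, h, .refl⟩⟩
  refine ⟨⟨⟨e, fun {a b} => ?_⟩, rfl, fun v => Iff.rfl⟩, fun v => rfl⟩
  refine ((U.erased ∅ hW).adj_iff_ch).trans (Iff.trans ?_ U.adj_iff_ch.symm)
  exact or_congr ((ch_erased hW _ _).trans (hs a b)) ((ch_erased hW _ _).trans (hs b a))

theorem isWhite_dots (h : U.IsLinear) : U.IsWhite U.dots := fun w hw =>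
  ⟨hw, (U.valence_eq_two_iff hw).1 (h w hw)⟩

theorem isLinear_iff : U.IsLinear ↔ U.IsWhite U.dots :=
  ⟨isWhite_dots, fun h w hw => (U.valence_eq_two_iff hw).2 (h w hw).2⟩

theorem nullDots_eq_empty (h : U.IsLinear) : U.nullDots = ∅ :=
  Set.eq_empty_iff_forall_notMem.2 fun v hv => by
    have h1 := hv.2
    rw [h v hv.1] at h1
    omega

/-- A linear tree has exactly one leaf. -/
theorem ends_eq_singleton (h : U.IsLinear) : ∃ l, U.ends = {l} := by
  obtain ⟨c, hc, -⟩ := U.exists_root_ch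
  obtain ⟨l, hl, -⟩ := U.exists_mem_endsAbove (U.ne_root_of_ch hc)
  -- With all dots counted as white, every end is the first vertex outside the white set above `c`,
  -- and that vertex is unique.
  have key : ∀ a ∈ U.ends, a ∉ U.dots ∧ ReflTransGen (U.Pass U.dots) c a := by
    intro a ha
    have hd : a ∉ U.dots := fun hd => by
      rcases ha with ha | ha
      · exact hd ha.1
      · rw [nullDots_eq_empty h] at ha
        exact ha
    refine ⟨hd, ?_⟩
    have h2 : ∀ v, v ≠ U.root → ReflTransGen (U.Pass U.dots) c v := by
      intro v
      induction v using U.wf_ch.induction with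
      | _ v ih =>
        intro hv
        obtain ⟨p, hp⟩ := U.exists_ch hv
        by_cases hpr : p = U.root
        · subst hpr
          obtain ⟨d, -, hd⟩ := U.exists_root_ch
          rw [hd _ hc, hd _ hp]
        · refine (ih p hp hpr).tail ⟨fun hb => U.not_ch_of_bdry hb hpr v hp, hp⟩
    exact h2 a (U.ne_root_of_mem_ends ha)
  refine ⟨l, Set.Subset.antisymm (fun a ha => ?_) (Set.singleton_subset_iff.2 hl)⟩
  exact pass_unique (isWhite_dots h) (key a ha).1 (key l hl).1 (key a ha).2 (key l hl).2

end FTree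

namespace Constellation

variable {T U T' U' : FTree}

theorem white_eq_empty (C : Constellation T U) (hU : U.IsLinear) : C.sub.white = ∅ :=
  Set.eq_empty_iff_forall_notMem.2 fun w hw => by
    have h : ∀ v, v ∉ U.nullDots := Set.eq_empty_iff_forall_notMem.1 (FTree.nullDots_eq_empty hU)
    exact h _ (C.white ⟨w, hw⟩).2

/-- If the nesting is linear there are no white dots. -/
theorem exists_iso_sub (C : Constellation T U) (hU : U.IsLinear) :
    ∃ e : T.Iso C.sub.tree.toRootedGraph, ∀ v, e v = C.sub.emb v := by
  obtain ⟨e, he⟩ := C.sub.exists_iso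
  obtain ⟨e', he'⟩ := FTree.exists_iso_erased C.sub.isWhite (C.white_eq_empty hU)
  refine ⟨e.trans e'.symm, fun v => ?_⟩
  exact (e'.toIso.symm_apply_eq).2 (Subtype.ext ((he v).trans (he' _).symm))

/-- A linear nesting has no null-dots, so there are no white dots and the subdivision is trivial;
and it has a single end, so all labels agree. Nothing remains to be checked for `e` and `f`. -/
theorem isoOver_of_isLinear (C : Constellation T U) (C' : Constellation T' U') (hU : U.IsLinear)
    (hU' : U'.IsLinear) (e : T.Iso T'.toRootedGraph) (f : U.Iso U'.toRootedGraph) :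
    C.IsoOver C' e f := by
  obtain ⟨ε, hε⟩ := C.exists_iso_sub hU
  obtain ⟨ε', hε'⟩ := C'.exists_iso_sub hU'
  obtain ⟨l, hl⟩ := FTree.ends_eq_singleton hU'
  refine ⟨(ε.symm.trans e).trans ε', fun v => ?_, fun d d' _ => ?_, fun w => ?_⟩
  · rw [← hε v, ← hε']
    exact congrArg (fun v => ε' (e v)) (ε.toIso.symm_apply_apply v)
  · have h1 : f (C.black d) ∈ U'.ends := Or.inl ⟨(f.map_bdry _).2 (C.black d).2.1, fun h =>
      (C.black d).2.2 (f.toIso.injective (h.trans f.map_root.symm))⟩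
    have h2 : (C'.black d' : U'.V) ∈ U'.ends := Or.inl (C'.black d').2
    rw [hl] at h1 h2
    exact (show f (C.black d) = l from h1).trans (show (C'.black d' : U'.V) = l from h2).symm
  · exact absurd w.2 (Set.eq_empty_iff_forall_notMem.1 (C.white_eq_empty hU) _)

theorem nonempty_of_isLinear (hT : T.dots.ncard = 1) (hU : U.IsLinear) :
    Nonempty (Constellation T U) := by
  obtain ⟨d, hd⟩ := Set.ncard_eq_one.1 hT
  obtain ⟨l, hl⟩ := FTree.ends_eq_singleton hU
  have hW : T.IsWhite ∅ := fun w hw => hw.elim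
  obtain ⟨e, -⟩ := FTree.exists_iso_erased hW rfl
  have hmem : ∀ t, t ∈ T.dots ↔ t = d := fun t => by rw [hd]; rfl
  have hle : l ∈ U.ends := hl ▸ rfl
  refine ⟨.ofErased (σ := fun _ => l) e (fun t _ => hle) (fun t ht t' ht' _ => ?_) (fun a ha => ?_)
    (fun t _ => ?_) fun x hx => ⟨l, ?_, fun k hk hkl => ?_⟩⟩
  · rw [(hmem t).1 ht, (hmem t').1 ht']
  · rw [hl] at ha
    exact ⟨d, (hmem d).2 rfl, ha.symm⟩
  · rw [FTree.nullDots_eq_empty hU]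
    exact iff_of_false (Set.notMem_empty _) (Set.notMem_empty _)
  · obtain ⟨a, ha⟩ := U.exists_mem_endsAbove (U.ne_root_of_dot hx)
    have ha' := ha.1
    rw [hl] at ha'
    exact (show a = l from ha') ▸ ha
  · have := hk.1
    rw [hl] at this
    exact absurd this hkl

end Constellation

/-! ### Trees over the identity monad -/

namespace FTree

variable {U U' : FTree}

theorem exists_isRepr_idMonad (h : U.IsLinear) (v : U.V) (hv : v ≠ U.root) :
    ∃ D : DTree idMonad.toPoly (fun _ => U.V) (fun _ => U.V) (), D.vlabel = v ∧
      IsRepr U.toRootedGraph D := by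
  induction v using U.wf_ch_swap.induction with
  | _ v ih =>
    by_cases hd : v ∈ U.dots
    · obtain ⟨-, c, hc, hu⟩ := isWhite_dots h v hd
      obtain ⟨D, h1, h2⟩ := ih c hc (U.ne_root_of_ch hc)
      refine ⟨.node (P := idMonad.toPoly) (C := fun _ => U.V) () v fun _ => D, rfl, hd,
        fun _ _ _ => rfl, fun w => ⟨fun hw => ⟨(), h1.trans (hu w hw).symm⟩, ?_⟩, fun _ => h2⟩
      rintro ⟨-, rfl⟩
      exact h1.symm ▸ hc
    · exact ⟨.leaf v, rfl, not_not.1 hd, hv⟩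

theorem exists_decorates_idMonad (h : U.IsLinear) :
    ∃ D : DTree idMonad.toPoly (fun _ => U.V) (fun _ => U.V) (), Decorates U.toRootedGraph D := by
  obtain ⟨c, hc, -⟩ := U.exists_root_ch
  obtain ⟨D, h1, h2⟩ := exists_isRepr_idMonad h c (U.ne_root_of_ch hc)
  exact ⟨D, h1.symm ▸ hc, h2⟩

/-- Each dot has one operation and one input, so the graph alone determines the labelled tree. -/
theorem eq_of_isRepr_idMonad {i : idMonad.I} {D D' : DTree idMonad.toPoly (fun _ => U.V) (fun _ => U.V) i}
    (h : IsRepr U.toRootedGraph D) (h' : IsRepr U.toRootedGraph D') (hv : D.vlabel = D'.vlabel) :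
    D = D' := by
  induction D with
  | leaf x =>
    cases D' with
    | leaf x' => exact congrArg DTree.leaf hv
    | node b c f => exact absurd ((show x = c from hv) ▸ h.1) h'.1
  | node b c f ih =>
    cases D' with
    | leaf x' => exact absurd ((show x' = c from hv.symm) ▸ h'.1) h.1
    | node b' c' f' =>
      obtain rfl : c = c' := hv
      obtain rfl : b = b' := rfl
      refine congrArg (DTree.node (C := fun _ => U.V) b c) (funext fun e =>
        ih e (h.2.2.2 e) (h'.2.2.2 e) ?_)
      obtain ⟨e', he'⟩ := (h'.2.2.1 _).1 ((h.2.2.1 _).2 ⟨e, rfl⟩)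
      exact he'.symm

/-- All operations of the identity monad are units, so all dots are unary. -/
theorem isLinear_of_decorates_idMonad {i : idMonad.I}
    {D : DTree idMonad.toPoly (fun _ => U.V) (fun _ => U.V) i} (h : Decorates U.toRootedGraph D) :
    U.IsLinear := by
  rw [isLinear_iff]
  refine fun w hw => ⟨hw, ?_⟩
  have hu : ∀ {i : idMonad.I} (D : DTree idMonad.toPoly (fun _ => U.V) (fun _ => U.V) i),
      AllNode (fun y w => w ∈ U.dots → idMonad.IsUnitOp y) D := by
    intro i D
    induction D with
    | leaf x => trivial
    | node b c f ih => exact ⟨fun _ => rfl, ih⟩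
  obtain ⟨g, hg⟩ := exists_labelled D
  have h1 := IsRepr.exists_unique_ch (P := idMonad) h.2 (hu D)
  rw [hg] at h h1
  obtain ⟨a, rfl⟩ := h.labelled_bijective.2 w
  rcases a with _ | n | l
  · exact absurd U.isTree.root_mem hw
  · exact (allNode_labelled _ _ _).1 h1 n hw
  · exact absurd (h.2.labelled_inr l).1 hw

theorem exists_iso_of_isLinear (h : U.IsLinear) (h' : U'.IsLinear) (hc : U.dots.ncard = 1)
    (hc' : U'.dots.ncard = 1) : Nonempty (U.Iso U'.toRootedGraph) := by
  -- A linear tree with one dot always has the shape of the one-dot tree over the identity monad,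
  -- and equal shapes give isomorphic trees.
  have key : ∀ {U : FTree} {i : idMonad.I}
      {D : DTree idMonad.toPoly (fun _ => U.V) (fun _ => U.V) i},
      U.dots.ncard = 1 → Decorates U.toRootedGraph D →
      D.shape = .node (P := idMonad.toPoly) () fun _ => .leaf () := by
    intro U i D hc hD
    obtain ⟨d, hd⟩ := Set.ncard_eq_one.1 hc
    have hmem : ∀ t, t ∈ U.dots ↔ t = d := fun t => by rw [hd]; rfl
    cases D with
    | leaf x =>
      exfalso
      have hdd := (hmem d).2 rfl
      rcases ReflTransGen.cases_head (U.reach d) with h | ⟨w, hw, hwt⟩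
      · exact U.ne_root_of_dot hdd h.symm
      · obtain ⟨c, -, hc⟩ := U.exists_root_ch
        rw [hc _ hw, ← hc _ hD.1] at hwt
        rcases ReflTransGen.cases_head hwt with h | ⟨w, hw, -⟩
        · exact hdd (h ▸ hD.2.1)
        · exact U.not_ch_of_bdry hD.2.1 hD.2.2 _ hw
    | node b c f =>
      refine congrArg (Tree.node (P := idMonad.toPoly) b) (funext fun e => ?_)
      have h1 := hD.2.2.2.2 e
      have h2 := (hD.2.2.2.1 _).2 ⟨e, rfl⟩
      change (f e).shape = _
      cases hfe : f e with
      | leaf y => rfl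
      | node b' c' f' =>
        rw [hfe] at h1 h2
        have h3 : U.Ch c c' := h2
        rw [(hmem c).1 hD.2.1, (hmem c').1 h1.1] at h3
        exact absurd (TransGen.single h3) (U.not_transGen_ch d)
  obtain ⟨D, hD⟩ := exists_decorates_idMonad h
  obtain ⟨D', hD'⟩ := exists_decorates_idMonad h'
  obtain ⟨f, -⟩ := hD.exists_iso_of_shape hD' ((key hc hD).trans (key hc' hD').symm)
  exact ⟨f⟩

/-- There is a linear tree with one dot. -/
theorem exists_isLinear : ∃ U : FTree, U.IsLinear ∧ U.dots.ncard = 1 := by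
  let T : Tr idMonad.toPoly () := .node () fun _ => .leaf ()
  refine ⟨T.ftree, isLinear_of_decorates_idMonad (decorates_ftree T), Set.ncard_eq_one.2
    ⟨some (.inl .here), Set.ext ?_⟩⟩
  rintro (_ | n | l)
  · exact iff_of_false (fun h => h (Or.inl rfl)) fun h => nomatch h
  · refine iff_of_true (fun h => h.elim (fun h => nomatch h) fun ⟨l, hl⟩ => nomatch hl) ?_
    have h : ∀ {i : idMonad.I} (n : Tree.Nodes (P := idMonad.toPoly) (X := fun _ => Unit) (i := i)
        (.node () fun _ => .leaf ())), n = .here := by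
      intro i n
      cases n with
      | here => rfl
      | up e n => exact nomatch n
    exact congrArg (fun n => (some (.inl n) : Option T.Verts)) (h n)
  · exact iff_of_false (fun h => h (Or.inr ⟨l, rfl⟩)) fun h => nomatch h

end FTree

end Opetopes

/-! ### The correspondence by induction on the degree. -/

namespace Opetopes

open DTree PolyMonad

/-- The trees decorated by the vertices of `N` that have the shape of a tree over `P^k`. -/
abbrev Labelled (k : ℕ) (N : FTree) (z : Z (k + 2)) : Type :=
  DTree (opMonad k).toPoly (fun _ => N.V) (fun _ => N.V) z.target.target

/-- The nesting of the last constellation is decorated by `D`, which has the shape of `z`, the complex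
without its last constellation is decorated by a tree of the shape of the target of `z`, and the
last constellation matches these decorations. -/
def Corr : {k : ℕ} → {N : FTree} → ZoomComplex (k + 2) N → (z : Z (k + 2)) → Labelled k N z → Prop
  | 0, N, _, z, D => Decorates N.toRootedGraph D ∧ D.shape = z.tree
  | k + 1, N, .zoom (M := M) X C, z, D => (Decorates N.toRootedGraph D ∧ D.shape = z.tree) ∧
      ∃ D₀ : Labelled k M z.target, Corr X z.target D₀ ∧
        C.Matches (P := opMonad k) (x := z.target.target) D₀ D

theorem Corr.decorates {k : ℕ} {N : FTree} {X : ZoomComplex (k + 2) N} {z : Z (k + 2)}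
    {D : Labelled k N z} (h : Corr X z D) : Decorates N.toRootedGraph D ∧ D.shape = z.tree := by
  cases k with
  | zero => exact h
  | succ k =>
    cases X with
    | zoom X C => exact h.1

theorem exists_corr {k : ℕ} {N : FTree} (X : ZoomComplex (k + 2) N) (hX : X.IsOpetopic) :
    ∃ (z : Z (k + 2)) (D : Labelled k N z), Corr X z D := by
  induction k generalizing N with
  | zero =>
    cases X with
    | zoom X C =>
      obtain ⟨D, hD⟩ := FTree.exists_decorates_idMonad hX.2
      exact ⟨⟨⟨(), ()⟩, ⟨D.shape, rfl⟩⟩, D, hD, rfl⟩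
  | succ k ih =>
    cases X with
    | zoom X C =>
      obtain ⟨z, D, h⟩ := ih X hX
      obtain ⟨h1, h2⟩ := h.decorates
      have hz : ((opMonad k).contractD D).1 = z.target.2 := by
        rw [contractD_fst, h2]
        exact z.2.2
      obtain ⟨DN, h3, h4⟩ := C.exists_matches (P := opMonad k) (x := z.target) h1 hz
      -- The contraction of `DN` is `D` up to labels, so the new type has `z` as its target.
      have h5 : ((opMonad k).plus.contract DN.shape).1 = z.2 := by
        refine (contractD_fst (P := (opMonad k).plus) DN).symm.trans (Subtype.ext ?_)
        refine (shape_ofObj (P := opMonad k) ((opMonad k).plus.contractD DN)).symm.trans ?_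
        exact (congrArg shape (h4.contractObj_eq h3.2)).trans
          ((shape_mapDec _ _).trans ((shape_map _ _).trans h2))
      exact ⟨⟨z, ⟨DN.shape, h5⟩⟩, DN, ⟨h3, rfl⟩, D, h, h4⟩

theorem exists_complex {k : ℕ} (z : Z (k + 2)) :
    ∃ (N : FTree) (X : ZoomComplex (k + 2) N) (D : Labelled k N z), X.IsOpetopic ∧ Corr X z D := by
  induction k with
  | zero =>
    obtain ⟨I, hI, hc⟩ := FTree.exists_isLinear
    have hN : z.tree.ftree.IsLinear :=
      FTree.isLinear_of_decorates_idMonad (i := z.target.target) (decorates_ftree z.tree)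
    obtain ⟨C⟩ := Constellation.nonempty_of_isLinear hc hI
    obtain ⟨C'⟩ := Constellation.nonempty_of_isLinear hc hN
    exact ⟨_, .zoom (.zoom (.single C) C) C', z.tree.labelled some,
      ⟨⟨⟨⟨hI, hc⟩, hI, hc⟩, hI, hc⟩, hN⟩, decorates_ftree z.tree, shape_labelled _ _⟩
  | succ k ih =>
    obtain ⟨M, X, D, hX, h⟩ := ih z.target
    obtain ⟨h1, h2⟩ := h.decorates
    -- The tree of `z` contracts to its target, whose shape the induction hypothesis has put on `M`.
    have h3 : ((opMonad k).contractObj (z.tree.labelled (some : _ → z.tree.ftree.V))).1.shape =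
        D.shape := by
      refine (shape_ofObj (P := opMonad k) _).trans ?_
      refine Eq.trans ?_ h2.symm
      refine congrArg Subtype.val (a₂ := Sigma.snd (β := (opMonad (k + 1)).Op) z.target) ?_
      refine (contractD_fst (P := (opMonad k).plus) _).trans ?_
      exact (congrArg (fun T => ((opMonad k).plus.contract T).1)
        (shape_labelled z.tree some)).trans z.2.2
    obtain ⟨C, hC⟩ := exists_constellation (P := opMonad k) h1 (decorates_ftree z.tree) h3
    exact ⟨_, .zoom X C, z.tree.labelled some, hX, ⟨decorates_ftree z.tree, shape_labelled _ _⟩,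
      D, h, hC⟩

/-- Besides single-valuedness on isomorphism classes, the statement tracks the decoration along `f`:
the induction step needs the matched decorations of the shared tree to agree, not just the types. -/
theorem Corr.eq {k : ℕ} {N N' : FTree} {X : ZoomComplex (k + 2) N} {X' : ZoomComplex (k + 2) N'}
    {z z' : Z (k + 2)} {D : Labelled k N z} {D' : Labelled k N' z'} (h : Corr X z D)
    (h' : Corr X' z' D') {f : N.Iso N'.toRootedGraph} (hf : X.IsoOver X' f) :
    (⟨z, D.relabel f⟩ : Σ z, Labelled k N' z) = ⟨z', D'⟩ := by
  induction k generalizing N N' with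
  | zero =>
    obtain ⟨⟨⟨⟩, ⟨⟩⟩, T⟩ := z
    obtain ⟨⟨⟨⟩, ⟨⟩⟩, T'⟩ := z'
    obtain ⟨h1, h2⟩ := h
    obtain ⟨h1', h2'⟩ := h'
    have h3 := h1.iso f
    obtain ⟨c, -, hc⟩ := N'.exists_root_ch
    have h4 : D.relabel f = D' := FTree.eq_of_isRepr_idMonad h3.2 h1'.2
      ((hc _ h3.1).trans (hc _ h1'.1).symm)
    obtain rfl : T = T' := Subtype.ext (h2.symm.trans
      (((shape_relabel f D).symm.trans (congrArg shape h4)).trans h2'))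
    rw [h4]
  | succ k ih =>
    cases X with
    | zoom X C =>
      cases X' with
      | zoom X' C' =>
        obtain ⟨e, he, hC⟩ := hf
        obtain ⟨w, T⟩ := z
        obtain ⟨w', T'⟩ := z'
        obtain ⟨⟨h1, h2⟩, D₀, h3, h4⟩ := h
        obtain ⟨⟨h1', h2'⟩, D₀', h3', h4'⟩ := h'
        have h5 := ih h3 h3' he
        change (⟨w, D₀.relabel e⟩ : Σ z, Labelled k _ z) = ⟨w', D₀'⟩ at h5
        obtain rfl : w = w' := congrArg Sigma.fst h5
        obtain rfl := eq_of_heq (Sigma.ext_iff.1 h5).2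
        have h6 : D' = D.relabel f := h4.eq_relabel hC h4' h1 h1'
        obtain rfl : T = T' := Subtype.ext (h2.symm.trans
          (((shape_relabel f D).symm.trans (congrArg shape h6.symm)).trans h2'))
        rw [h6]

theorem isoOver_zero {N N' : FTree} {X : ZoomComplex 0 N} {X' : ZoomComplex 0 N'}
    (hX : X.IsOpetopic) (hX' : X'.IsOpetopic) (f : N.Iso N'.toRootedGraph) : X.IsoOver X' f := by
  cases X with
  | single C =>
    cases X' with
    | single C' =>
      obtain ⟨e⟩ := FTree.exists_iso_of_isLinear hX.1.1 hX'.1.1 hX.1.2 hX'.1.2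
      exact ⟨e, C.isoOver_of_isLinear C' hX.2.1 hX'.2.1 e f⟩

theorem ZoomComplex.IsOpetopic.nesting {N : FTree} {X : ZoomComplex 0 N} (hX : X.IsOpetopic) :
    N.IsLinear ∧ N.dots.ncard = 1 := by
  cases X with
  | single C => exact hX.2

theorem ZoomComplex.IsOpetopic.nesting_one {N : FTree} {X : ZoomComplex 1 N} (hX : X.IsOpetopic) :
    N.IsLinear ∧ N.dots.ncard = 1 := by
  cases X with
  | zoom X C => exact hX.2

theorem isoOver_one {N N' : FTree} {X : ZoomComplex 1 N} {X' : ZoomComplex 1 N'}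
    (hX : X.IsOpetopic) (hX' : X'.IsOpetopic) (f : N.Iso N'.toRootedGraph) : X.IsoOver X' f := by
  cases X with
  | zoom X C =>
    cases X' with
    | zoom X' C' =>
      have h := ZoomComplex.IsOpetopic.nesting hX.1
      have h' := ZoomComplex.IsOpetopic.nesting hX'.1
      obtain ⟨e⟩ := FTree.exists_iso_of_isLinear h.1 h'.1 h.2 h'.2
      exact ⟨e, isoOver_zero hX.1 hX'.1 e, C.isoOver_of_isLinear C' hX.2.1 hX'.2.1 e f⟩

theorem isoOver_two {N N' : FTree} {X : ZoomComplex 2 N} {X' : ZoomComplex 2 N'}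
    (hX : X.IsOpetopic) (hX' : X'.IsOpetopic) (f : N.Iso N'.toRootedGraph) : X.IsoOver X' f := by
  cases X with
  | zoom X C =>
    cases X' with
    | zoom X' C' =>
      have h := ZoomComplex.IsOpetopic.nesting_one hX.1
      have h' := ZoomComplex.IsOpetopic.nesting_one hX'.1
      obtain ⟨e⟩ := FTree.exists_iso_of_isLinear h.1 h'.1 h.2 h'.2
      exact ⟨e, isoOver_one hX.1 hX'.1 e, C.isoOver_of_isLinear C' hX.2 hX'.2 e f⟩

/-- Equal shapes provide an isomorphism on each nesting that respects the decorations. These extend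
over the constellations by `Matches.isoOver`, and in degree 2 any isomorphism of the nestings
extends. -/
theorem Corr.exists_iso {k : ℕ} {N N' : FTree} {X : ZoomComplex (k + 2) N}
    {X' : ZoomComplex (k + 2) N'} {z : Z (k + 2)} {D : Labelled k N z} {D' : Labelled k N' z}
    (hX : X.IsOpetopic) (hX' : X'.IsOpetopic) (h : Corr X z D) (h' : Corr X' z D') :
    ∃ f : N.Iso N'.toRootedGraph, D' = D.relabel f ∧ X.IsoOver X' f := by
  obtain ⟨f, hf⟩ := h.decorates.1.exists_iso_of_shape h'.decorates.1
    (h.decorates.2.trans h'.decorates.2.symm)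
  refine ⟨f, hf, ?_⟩
  induction k generalizing N N' with
  | zero => exact isoOver_two hX hX' f
  | succ k ih =>
    cases X with
    | zoom X C =>
      cases X' with
      | zoom X' C' =>
        obtain ⟨-, D₀, h3, h4⟩ := h
        obtain ⟨-, D₀', h3', h4'⟩ := h'
        obtain ⟨e, rfl⟩ := h3.decorates.1.exists_iso_of_shape h3'.decorates.1
          (h3.decorates.2.trans h3'.decorates.2.symm)
        subst hf
        exact ⟨e, ih hX hX' h3 h3' e rfl, h4.isoOver h3.decorates.1 h4'⟩

theorem Corr.corresponds {k : ℕ} {N : FTree} {X : ZoomComplex (k + 2) N} {z : Z (k + 2)}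
    {g : z.tree.Verts → N.V} (h : Corr X z (z.tree.labelled g)) {β : N.Iso z.tree.graph}
    (hβ : ∀ v, β (g v) = some v) : X.Corresponds z β := by
  induction k generalizing N with
  | zero => trivial
  | succ k ih =>
    cases X with
    | zoom X C =>
      obtain ⟨⟨h1, -⟩, D₀, h3, h4⟩ := h
      obtain ⟨g₀, rfl⟩ := exists_labelled_of_shape D₀ h3.decorates.2
      obtain ⟨α, hα⟩ := h3.decorates.1.exists_iso
      exact ⟨α, ih h3 hα, isConstellationOf_of_matches (P := opMonad k) z.contract_tree
        h3.decorates.1 h1 h4 hα hβ⟩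

end Opetopes

/-! ### The bijections. -/

namespace Opetopes

open DTree

/-- The equivalence is delivered with the relation that defines it, since its compatibility with
targets and with nestings is proved for the relation. -/
theorem exists_quotient_equiv {A : Type 1} {B : Type} (s : Setoid A) (R : A → B → Prop)
    (h1 : ∀ a, ∃ b, R a b) (h2 : ∀ a a' b b', s.r a a' → R a b → R a' b' → b = b')
    (h3 : ∀ a a' b, R a b → R a' b → s.r a a') (h4 : ∀ b, ∃ a, R a b) :
    ∃ φ : Quotient s ≃ B, ∀ a b, R a b ↔ φ (Quotient.mk s a) = b := by
  choose g hg using h1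
  have hwd : ∀ a a', s.r a a' → g a = g a' := fun a a' h => h2 a a' _ _ h (hg a) (hg a')
  let φ : Quotient s → B := Quotient.lift g hwd
  have hφ : ∀ a b, R a b ↔ φ (Quotient.mk s a) = b := fun a b =>
    ⟨fun h => h2 a a _ _ (s.refl a) (hg a) h, fun h => h ▸ hg a⟩
  refine ⟨Equiv.ofBijective φ ⟨?_, fun b => ?_⟩, hφ⟩
  · intro x y
    induction x using Quotient.inductionOn with
    | h a =>
      induction y using Quotient.inductionOn with
      | h a' => exact fun h => Quotient.sound (h3 a a' _ ((hφ a _).2 h) ((hφ a' _).2 rfl))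
  · obtain ⟨a, ha⟩ := h4 b
    exact ⟨_, (hφ a b).1 ha⟩

/-- The relation between zoom complexes and types of `P^k`. -/
def Rel : (k : ℕ) → OpetopicComplex k → Z k → Prop
  | 0, _, _ => True
  | 1, _, _ => True
  | _ + 2, X, z => ∃ D, Corr X.complex z D

theorem exists_rel_equiv (k : ℕ) :
    ∃ φ : Opetope k ≃ Z k, ∀ X z, Rel k X z ↔ φ X.toOpetope = z := by
  obtain ⟨I, hI, hc⟩ := FTree.exists_isLinear
  obtain ⟨C⟩ := Constellation.nonempty_of_isLinear hc hI
  match k with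
  | 0 =>
    -- In degrees 0 and 1 both sides have one element, so the relation that always holds is the
    -- graph of the bijection.
    refine exists_quotient_equiv (opetopicSetoid 0) (Rel 0) (fun _ => ⟨(), trivial⟩)
      (fun _ _ b b' _ _ _ => Subsingleton.elim (α := Unit) b b') (fun X X' _ _ _ => ?_)
      fun _ => ⟨⟨I, .single C, ⟨hI, hc⟩, hI, hc⟩, trivial⟩
    have h := X.isOpetopic.nesting
    have h' := X'.isOpetopic.nesting
    obtain ⟨f⟩ := FTree.exists_iso_of_isLinear h.1 h'.1 h.2 h'.2
    exact ⟨f, isoOver_zero X.isOpetopic X'.isOpetopic f⟩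
  | 1 =>
    refine exists_quotient_equiv (opetopicSetoid 1) (Rel 1) (fun _ => ⟨⟨(), ()⟩, trivial⟩)
      (fun _ _ ⟨_, _⟩ ⟨_, _⟩ _ _ _ => rfl) (fun X X' _ _ _ => ?_)
      fun _ => ⟨⟨I, .zoom (.single C) C, ⟨⟨hI, hc⟩, hI, hc⟩, hI, hc⟩, trivial⟩
    have h := X.isOpetopic.nesting_one
    have h' := X'.isOpetopic.nesting_one
    obtain ⟨f⟩ := FTree.exists_iso_of_isLinear h.1 h'.1 h.2 h'.2
    exact ⟨f, isoOver_one X.isOpetopic X'.isOpetopic f⟩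
  | k + 2 =>
    refine exists_quotient_equiv (opetopicSetoid (k + 2)) (Rel (k + 2))
      (fun X => exists_corr X.complex X.isOpetopic) ?_ ?_ fun z => ?_
    · rintro X X' z z' ⟨f, hf⟩ ⟨D, h⟩ ⟨D', h'⟩
      exact congrArg Sigma.fst (h.eq h' hf)
    · rintro X X' z ⟨D, h⟩ ⟨D', h'⟩
      obtain ⟨f, -, hf⟩ := h.exists_iso X.isOpetopic X'.isOpetopic h'
      exact ⟨f, hf⟩
    · obtain ⟨N, X, D, hX, h⟩ := exists_complex z
      exact ⟨⟨N, X, hX⟩, D, h⟩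

theorem Rel.target {k : ℕ} {X : OpetopicComplex (k + 1)} {z : Z (k + 1)} (h : Rel (k + 1) X z) :
    Rel k X.target z.target := by
  match k with
  | 0 => trivial
  | 1 => trivial
  | k + 2 =>
    obtain ⟨N, X, hX⟩ := X
    cases X with
    | zoom X C =>
      obtain ⟨D, -, D₀, h, -⟩ := h
      exact ⟨D₀, h⟩

theorem Rel.corresponds {k : ℕ} {X : OpetopicComplex (k + 2)} {z : Z (k + 2)}
    (h : Rel (k + 2) X z) : ∃ α : X.nesting.Iso z.tree.graph, X.complex.Corresponds z α := by
  obtain ⟨D, h⟩ := h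
  obtain ⟨g, rfl⟩ := exists_labelled_of_shape D h.decorates.2
  obtain ⟨α, hα⟩ := h.decorates.1.exists_iso
  exact ⟨α, h.corresponds hα⟩

end Opetopes

theorem mainTheorem2 :
    ∃ φ : ∀ k : ℕ, Opetopes.Opetope k ≃ Opetopes.Z k,
      (∀ (k : ℕ) (X : Opetopes.Opetope (k + 1)), φ k X.target = (φ (k + 1) X).target) ∧
      ∀ (k : ℕ) (X : Opetopes.OpetopicComplex (k + 2)),
        ∃ α : X.nesting.Iso (φ (k + 2) X.toOpetope).tree.graph,
          X.complex.Corresponds (φ (k + 2) X.toOpetope) α := by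
  choose φ hφ using Opetopes.exists_rel_equiv
  refine ⟨φ, fun k X => ?_, fun k X => Opetopes.Rel.corresponds ((hφ _ X _).2 rfl)⟩
  induction X using Quotient.inductionOn with
  | h X => exact (hφ k X.target _).1 (Opetopes.Rel.target ((hφ (k + 1) X _).2 rfl))
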